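/- Let $G$ be a compact Lie group with Lie algebra $\mathfrak g$ and an $\mathrm{Ad}$-invariant inner product $\langle\cdot,\cdot\rangle$ on $\mathfrak g$, by which moment maps are regarded as $\mathfrak g$-valued. Let $p$ be a point of a Hamiltonian $G$-space, with isotropy group $H\subset G$ (a compact Lie subgroup with Lie algebra $\mathfrak h\subset\mathfrak g$), let $\beta\in\mathfrak g$ be the value of the moment map at $p$, let $K\supset H$ be the stabilizer of $\beta$ under $\mathrm{Ad}$, with Lie algebra $\mathfrak k$, and let $(X,\omega_X)$ be the symplectic representation of $H$ at $p$ (more generally, let $H$ be any compact Lie subgroup of $G$, $\beta\in\mathfrak g$ any vector fixed by $H$, and $(X,\omega_X)$ any finite-dimensional symplectic representation of $H$). Assume that $G/H$ is connected (for example, that $G$ is connected). For $x\in X$ let $Q_x\in\mathfrak h$ be defined by $\langle Q_x,\phi\rangle=\tfrac12\,\omega_X(\phi x,x)$ for all $\phi\in\mathfrak h$. Identify $\mathfrak k/\mathfrak h$ with the orthogonal complement of $\mathfrak h$ in $\mathfrak k$. The standard neighborhood is $G\times_H(\mathfrak k/\mathfrak h\oplus X)$, the quotient of $G\times(\mathfrak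 k/\mathfrak h\oplus X)$ by the action $h\cdot(g,\nu,x)=(gh^{-1},\mathrm{Ad}_h\nu,hx)$ of $H$. It is identified by $(g,\nu,x)\mapsto(g,\nu-Q_x,x)$ with the symplectic reduction $\mu_H^{-1}(0)/H$ of $G\times(\mathfrak k\oplus X)$, where $\mu_H(g,\nu,x)\cdot\phi=\langle\nu,\phi\rangle+\tfrac12\omega_X(\phi x,x)$ for $\phi\in\mathfrak h$, and carries the moment map $\mu$ induced by $\mu_G(g,\nu,x)=\mathrm{Ad}_g(\beta+\nu)$; that is, $\mu([g,\nu,x])=\mathrm{Ad}_g(\beta+\nu-Q_x)$. Assume that the $H$-orbit $[1,0]$ of $(1,0)$ is a critical point of $|\mu|^2$ on $G\times_H(\mathfrak k/\mathfrak h\oplus X)$ (equivalently, $\beta\in\mathfrak h$), and let $$Z=\{x\in X:\ \beta x=0,\ Q_x=0\}.$$ Then the connected component containing $[1,0]$ of the critical set of $|\mu|^2$ in $G\times_H(\mathfrak k/\mathfrak h\oplus X)$ is the set $G\times_H Z$ of the $H$-orbits of all points $(g,z)$ with $g\in G$ and $z\in Z$. Moreover this set is a real algebraic variety: there are $N\in\mathbb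 N$ and a closed smooth embedding of $G\times_H(\mathfrak k/\mathfrak h\oplus X)$ into $\mathbb R^N$ that maps $G\times_H Z$ onto the common zero set of a set of real polynomials in $N$ variables. -/

import Mathlib

open scoped Manifold ContDiff Topology

noncomputable section

namespace HamiltonianModel

section LieGroupBasics

/-- The adjoint action of `g` on the Lie algebra of `G`: the derivative at `1` of conjugation
by `g`.  In Mathlib the tangent space of `G` at `1` is by definition the model space `E`,
so the Lie algebra of `G` is written `E` throughout. -/
def Ad (E : Type*) [NormedAddCommGroup E] [NormedSpace ℝ E]
    {G : Type*} [TopologicalSpace G] [ChartedSpace E G] [Group G] (g : G) : E →L[ℝ] E :=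
  mfderiv 𝓘(ℝ, E) 𝓘(ℝ, E) (fun x : G => g * x * g⁻¹) 1

variable {E : Type*} [NormedAddCommGroup E] [NormedSpace ℝ E]
  {G : Type*} [TopologicalSpace G] [ChartedSpace E G] [Group G] [LieGroup 𝓘(ℝ, E) ∞ G]

theorem contMDiff_conj (g : G) :
    ContMDiff 𝓘(ℝ, E) 𝓘(ℝ, E) ∞ (fun x : G => g * x * g⁻¹) :=
  (contMDiff_const.mul contMDiff_id).mul contMDiff_const

theorem hasMFDerivAt_conj (g : G) (a : G) (ha : a = 1) :
    HasMFDerivAt 𝓘(ℝ, E) 𝓘(ℝ, E) (fun x : G => g * x * g⁻¹) a (Ad E g) := by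
  subst ha
  exact ((contMDiff_conj g).mdifferentiableAt (by simp)).hasMFDerivAt

theorem Ad_eq_of_hasMFDerivAt (g : G) (L : E →L[ℝ] E)
    (h : HasMFDerivAt 𝓘(ℝ, E) 𝓘(ℝ, E) (fun x : G => g * x * g⁻¹) 1 L) : Ad E g = L :=
  hasMFDerivAt_unique (hasMFDerivAt_conj g 1 rfl) h

theorem Ad_one : Ad E (1 : G) = ContinuousLinearMap.id ℝ E := by
  apply Ad_eq_of_hasMFDerivAt
  have := hasMFDerivAt_id (I := 𝓘(ℝ, E)) (1 : G)
  exact this.congr_of_eventuallyEq (Filter.Eventually.of_forall fun x => by simp)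

theorem Ad_mul (g h : G) : Ad E (g * h) = (Ad E g).comp (Ad E h) := by
  apply Ad_eq_of_hasMFDerivAt
  have h2 := HasMFDerivAt.comp (1 : G) (hasMFDerivAt_conj (E := E) g _ (by simp))
    (hasMFDerivAt_conj (E := E) h 1 rfl)
  exact h2.congr_of_eventuallyEq (Filter.Eventually.of_forall fun x => by
    simp [mul_assoc])

theorem Ad_mul_apply (g h : G) (ξ : E) : Ad E (g * h) ξ = Ad E g (Ad E h ξ) := by
  rw [Ad_mul]; rfl

theorem Ad_inv_apply (g : G) (ξ : E) : Ad E g⁻¹ (Ad E g ξ) = ξ := by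
  rw [← Ad_mul_apply, inv_mul_cancel, Ad_one]; rfl

theorem hasMFDerivAt_mul_curves {γ δ : ℝ → G} {u v : ℝ →L[ℝ] E}
    (hγ0 : γ 0 = 1) (hδ0 : δ 0 = 1)
    (hγ : HasMFDerivAt 𝓘(ℝ, ℝ) 𝓘(ℝ, E) γ 0 u) (hδ : HasMFDerivAt 𝓘(ℝ, ℝ) 𝓘(ℝ, E) δ 0 v) :
    HasMFDerivAt 𝓘(ℝ, ℝ) 𝓘(ℝ, E) (fun t => γ t * δ t) 0 (u + v) := by
  have hm : MDifferentiableAt (𝓘(ℝ, E).prod 𝓘(ℝ, E)) 𝓘(ℝ, E) (fun p : G × G => p.1 * p.2)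
      (1, 1) := (contMDiff_mul 𝓘(ℝ, E) ∞).mdifferentiableAt (by simp)
  let L : E × E →L[ℝ] E :=
    mfderiv (𝓘(ℝ, E).prod 𝓘(ℝ, E)) 𝓘(ℝ, E) (fun p : G × G => p.1 * p.2) (1, 1)
  have hL : HasMFDerivAt (𝓘(ℝ, E).prod 𝓘(ℝ, E)) 𝓘(ℝ, E) (fun p : G × G => p.1 * p.2)
      (γ 0, δ 0) L := by
    rw [hγ0, hδ0]; exact hm.hasMFDerivAt
  have h1 : mfderiv 𝓘(ℝ, E) 𝓘(ℝ, E) (fun x : G => x * 1) 1 = ContinuousLinearMap.id ℝ E := by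
    have : (fun x : G => x * 1) = id := by ext x; simp
    rw [this]; exact (hasMFDerivAt_id (I := 𝓘(ℝ, E)) (1 : G)).mfderiv
  have h2 : mfderiv 𝓘(ℝ, E) 𝓘(ℝ, E) (fun x : G => 1 * x) 1 = ContinuousLinearMap.id ℝ E := by
    have : (fun x : G => 1 * x) = id := by ext x; simp
    rw [this]; exact (hasMFDerivAt_id (I := 𝓘(ℝ, E)) (1 : G)).mfderiv
  have key : ∀ a b : E, L (a, b) = a + b := by
    intro a b
    refine (mfderiv_prod_eq_add_apply (v := ((a, b) : E × E)) hm).trans ?_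
    exact congrArg₂ (· + ·) (DFunLike.congr_fun h1 a) (DFunLike.congr_fun h2 b)
  have h := HasMFDerivAt.comp (0 : ℝ) hL (hγ.prodMk hδ)
  have e : L.comp (u.prod v) = u + v := by
    ext; exact key _ _
  exact e ▸ h

/-- The Lie algebra of a closed subgroup `K` of `G`: velocities at `0` of curves in `K`
through `1`, smooth near `0`. -/
def lieOfSubgroup (E : Type*) [NormedAddCommGroup E] [NormedSpace ℝ E]
    {G : Type*} [TopologicalSpace G] [ChartedSpace E G] [Group G] [LieGroup 𝓘(ℝ, E) ∞ G]
    (K : Subgroup G) : Submodule ℝ E where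
  carrier := {ξ | ∃ γ : ℝ → G, ContMDiffAt 𝓘(ℝ, ℝ) 𝓘(ℝ, E) ∞ γ 0 ∧ γ 0 = 1 ∧
    (∀ t, γ t ∈ K) ∧ HasMFDerivAt 𝓘(ℝ, ℝ) 𝓘(ℝ, E) γ 0 (ContinuousLinearMap.toSpanSingleton ℝ ξ)}
  add_mem' := by
    rintro a b ⟨γ, h1, h2, h3, h4⟩ ⟨δ, k1, k2, k3, k4⟩
    refine ⟨fun t => γ t * δ t, h1.mul k1, by simp [h2, k2], fun t => K.mul_mem (h3 t) (k3 t), ?_⟩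
    have := hasMFDerivAt_mul_curves h2 k2 h4 k4
    have e : ContinuousLinearMap.toSpanSingleton ℝ (a + b) =
      ContinuousLinearMap.toSpanSingleton ℝ a + ContinuousLinearMap.toSpanSingleton ℝ b := by
      ext; simp
    exact e ▸ this
  zero_mem' := by
    refine ⟨fun _ => 1, contMDiffAt_const, rfl, fun _ => K.one_mem, ?_⟩
    have := hasMFDerivAt_const (I := 𝓘(ℝ, ℝ)) (I' := 𝓘(ℝ, E)) (1 : G) (0 : ℝ)
    have e : ContinuousLinearMap.toSpanSingleton ℝ (0 : E) = 0 := by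
      ext; simp
    exact e ▸ this
  smul_mem' := by
    rintro c a ⟨γ, h1, h2, h3, h4⟩
    have hs : HasMFDerivAt 𝓘(ℝ, ℝ) 𝓘(ℝ, ℝ) (fun t : ℝ => c * t) 0
        (ContinuousLinearMap.toSpanSingleton ℝ c) := by
      have : HasDerivAt (fun t : ℝ => c * t) c 0 := by
        simpa using (hasDerivAt_id (0 : ℝ)).const_mul c
      exact this.hasFDerivAt.hasMFDerivAt
    have hc : ContMDiffAt 𝓘(ℝ, ℝ) 𝓘(ℝ, ℝ) ∞ (fun t : ℝ => c * t) 0 :=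
      (contDiff_const.mul contDiff_id).contMDiff.contMDiffAt
    refine ⟨fun t => γ (c * t), ?_, by simpa using h2, fun t => h3 _, ?_⟩
    · exact ContMDiffAt.comp (0 : ℝ) (by simpa using h1) hc
    · have h4' : HasMFDerivAt 𝓘(ℝ, ℝ) 𝓘(ℝ, E) γ (c * 0)
          (ContinuousLinearMap.toSpanSingleton ℝ a) := by
        rw [mul_zero]; exact h4
      have h := HasMFDerivAt.comp (0 : ℝ) h4' hs
      have e : ContinuousLinearMap.toSpanSingleton ℝ (c • a) =
          (ContinuousLinearMap.toSpanSingleton ℝ a).comp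
            (ContinuousLinearMap.toSpanSingleton ℝ c) := by
        ext; simp
      exact e ▸ h

theorem Ad_mem_lieOfSubgroup {K : Subgroup G} {k : G} (hk : k ∈ K) {ξ : E}
    (hξ : ξ ∈ lieOfSubgroup E K) : Ad E k ξ ∈ lieOfSubgroup E K := by
  obtain ⟨γ, h1, h2, h3, h4⟩ := hξ
  refine ⟨fun t => k * γ t * k⁻¹, (contMDiffAt_const.mul h1).mul contMDiffAt_const,
    by simp [h2], fun t => K.mul_mem (K.mul_mem hk (h3 t)) (K.inv_mem hk), ?_⟩
  have h := HasMFDerivAt.comp (0 : ℝ) (hasMFDerivAt_conj (E := E) k _ h2) h4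
  have e : ContinuousLinearMap.toSpanSingleton ℝ (Ad E k ξ) =
      (Ad E k).comp (ContinuousLinearMap.toSpanSingleton ℝ ξ) := by
    ext; simp
  exact e ▸ h

end LieGroupBasics

/-- The data attached to a point `p` of a Hamiltonian `G`-space: an invariant inner product `B`
on the Lie algebra of `G`, the isotropy group `H` as a Lie subgroup of `G`, the value `β` of the
moment map at `p` (an element of the Lie algebra by means of `B`; it is fixed by `H`), and a
symplectic representation `X` of `H`. -/
structure LocalData (E F X G H : Type*)
    [NormedAddCommGroup E] [NormedSpace ℝ E]
    [NormedAddCommGroup F] [NormedSpace ℝ F]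
    [NormedAddCommGroup X] [NormedSpace ℝ X]
    [TopologicalSpace G] [ChartedSpace E G] [Group G]
    [TopologicalSpace H] [ChartedSpace F H] [Group H] where
  /-- the inner product on the Lie algebra of `G` -/
  B : E →ₗ[ℝ] E →ₗ[ℝ] ℝ
  B_symm : ∀ ξ η, B ξ η = B η ξ
  B_pos : ∀ ξ, ξ ≠ 0 → 0 < B ξ ξ
  B_Ad : ∀ (g : G) (ξ η : E), B (Ad E g ξ) (Ad E g η) = B ξ η
  /-- the inclusion of `H` in `G` -/
  ι : H →* G
  ι_smooth : ContMDiff 𝓘(ℝ, F) 𝓘(ℝ, E) ∞ ι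
  ι_injective : Function.Injective ι
  ι_immersion : Function.Injective (mfderiv 𝓘(ℝ, F) 𝓘(ℝ, E) ι 1)
  /-- the value of the moment map at `p` -/
  β : E
  β_fixed : ∀ h : H, Ad E (ι h) β = β
  /-- the symplectic form on `X` -/
  ωX : X →ₗ[ℝ] X →ₗ[ℝ] ℝ
  ωX_alt : ∀ x, ωX x x = 0
  ωX_nondeg : ∀ x, (∀ y, ωX x y = 0) → x = 0
  /-- the action of `H` on `X` -/
  ρ : H →* (X →L[ℝ] X)
  ρ_smooth : ContMDiff 𝓘(ℝ, F) 𝓘(ℝ, X →L[ℝ] X) ∞ ρ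
  ρ_symplectic : ∀ (h : H) (x y : X), ωX (ρ h x) (ρ h y) = ωX x y

set_option linter.unusedSectionVars false

namespace LocalData

variable {E F X G H : Type*}
  [NormedAddCommGroup E] [NormedSpace ℝ E]
  [NormedAddCommGroup F] [NormedSpace ℝ F] [FiniteDimensional ℝ F]
  [NormedAddCommGroup X] [NormedSpace ℝ X]
  [TopologicalSpace G] [ChartedSpace E G] [Group G] [LieGroup 𝓘(ℝ, E) ∞ G]
  [TopologicalSpace H] [ChartedSpace F H] [Group H] [LieGroup 𝓘(ℝ, F) ∞ H]
  (D : LocalData E F X G H)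

/-- The inclusion of the Lie algebra of `H` in that of `G`. -/
def dι : F →L[ℝ] E := mfderiv 𝓘(ℝ, F) 𝓘(ℝ, E) D.ι 1

/-- The infinitesimal action of the Lie algebra of `H` on `X`; `φ x` is `D.dρ φ x`. -/
def dρ : F →L[ℝ] (X →L[ℝ] X) := mfderiv 𝓘(ℝ, F) 𝓘(ℝ, X →L[ℝ] X) D.ρ 1

/-- The stabilizer of `β` in `G`. -/
def K : Subgroup G where
  carrier := {g | Ad E g D.β = D.β}
  mul_mem' := by
    intro a b ha hb
    have ha' : Ad E a D.β = D.β := ha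
    have hb' : Ad E b D.β = D.β := hb
    change Ad E (a * b) D.β = D.β
    rw [Ad_mul_apply, hb', ha']
  one_mem' := by
    change Ad E (1 : G) D.β = D.β
    rw [Ad_one]; rfl
  inv_mem' := by
    intro a ha
    have ha' : Ad E a D.β = D.β := ha
    change Ad E a⁻¹ D.β = D.β
    conv_lhs => rw [← ha']
    exact Ad_inv_apply a D.β

/-- The Lie algebra of the stabilizer of `β`. -/
def lieK : Submodule ℝ E := lieOfSubgroup E D.K

/-- The quotient of the Lie algebra of `K` by that of `H`, realized as the orthogonal complement
of the latter in the former. -/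
def kPerp : Submodule ℝ E where
  carrier := {ν | ν ∈ D.lieK ∧ ∀ φ : F, D.B ν (D.dι φ) = 0}
  add_mem' := by
    rintro a b ⟨h1, h2⟩ ⟨k1, k2⟩
    exact ⟨D.lieK.add_mem h1 k1, fun φ => by simp [h2, k2]⟩
  zero_mem' := ⟨D.lieK.zero_mem, fun φ => by simp⟩
  smul_mem' := by
    rintro c a ⟨h1, h2⟩
    exact ⟨D.lieK.smul_mem c h1, fun φ => by simp [h2]⟩

theorem hasMFDerivAt_ι (a : H) (ha : a = 1) : HasMFDerivAt 𝓘(ℝ, F) 𝓘(ℝ, E) D.ι a D.dι := by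
  subst ha
  exact (D.ι_smooth.mdifferentiableAt (by simp)).hasMFDerivAt

theorem hasMFDerivAt_ρ (a : H) (ha : a = 1) :
    HasMFDerivAt 𝓘(ℝ, F) 𝓘(ℝ, X →L[ℝ] X) D.ρ a D.dρ := by
  subst ha
  exact (D.ρ_smooth.mdifferentiableAt (by simp)).hasMFDerivAt

theorem dι_Ad (h : H) (φ : F) : D.dι (Ad F h φ) = Ad E (D.ι h) (D.dι φ) := by
  have h1 := HasMFDerivAt.comp (1 : H) (D.hasMFDerivAt_ι _ (by simp))
    (hasMFDerivAt_conj (E := F) h 1 rfl)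
  have h2 := HasMFDerivAt.comp (1 : H) (hasMFDerivAt_conj (E := E) (D.ι h) _ (by simp))
    (D.hasMFDerivAt_ι 1 rfl)
  have h3 := h2.congr_of_eventuallyEq (f₁ := D.ι ∘ fun x : H => h * x * h⁻¹)
    (Filter.Eventually.of_forall fun x => by simp)
  exact DFunLike.congr_fun (hasMFDerivAt_unique h1 h3) φ

theorem ρ_inv_apply (h : H) (x : X) : D.ρ h⁻¹ (D.ρ h x) = x := by
  have : D.ρ h⁻¹ * D.ρ h = 1 := by rw [← map_mul]; simp
  exact DFunLike.congr_fun this x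

theorem dρ_Ad (h : H) (φ : F) (x : X) :
    D.dρ (Ad F h φ) (D.ρ h x) = D.ρ h (D.dρ φ x) := by
  have h1 := HasMFDerivAt.comp (1 : H) (D.hasMFDerivAt_ρ _ (by simp))
    (hasMFDerivAt_conj (E := F) h 1 rfl)
  let C : (X →L[ℝ] X) →L[ℝ] (X →L[ℝ] X) :=
    (ContinuousLinearMap.compL ℝ X X X (D.ρ h)).comp
      ((ContinuousLinearMap.compL ℝ X X X).flip (D.ρ h⁻¹))
  have h2 := HasMFDerivAt.comp (1 : H) (C.hasMFDerivAt (x := D.ρ 1)) (D.hasMFDerivAt_ρ 1 rfl)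
  have h3 := h2.congr_of_eventuallyEq (f₁ := D.ρ ∘ fun x : H => h * x * h⁻¹)
    (Filter.Eventually.of_forall fun x => by
      simp only [Function.comp, map_mul, C]; rfl)
  have h4 := DFunLike.congr_fun (hasMFDerivAt_unique h1 h3) φ
  have h5 : D.dρ (Ad F h φ) (D.ρ h x) = D.ρ h (D.dρ φ (D.ρ h⁻¹ (D.ρ h x))) :=
    DFunLike.congr_fun (F := X →L[ℝ] X) h4 (D.ρ h x)
  rw [h5, D.ρ_inv_apply]

/-- The restriction of the inner product to the Lie algebra of `H`. -/
def BH : LinearMap.BilinForm ℝ F := D.B.compl₁₂ D.dι.toLinearMap D.dι.toLinearMap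

theorem BH_apply (φ ψ : F) : D.BH φ ψ = D.B (D.dι φ) (D.dι ψ) := rfl

theorem BH_nondegenerate : D.BH.Nondegenerate := by
  have key : ∀ φ : F, D.BH φ φ = 0 → φ = 0 := by
    intro φ h
    by_contra hne
    have : D.dι φ ≠ 0 := fun h0 => hne (D.ι_immersion (h0.trans (map_zero D.dι).symm))
    exact (D.B_pos _ this).ne' h
  exact ⟨fun φ h => key φ (h φ), fun φ h => key φ (h φ)⟩

/-- The moment map of the linear action of `H` on `X`, as an element of the dual of the Lie
algebra of `H`: `φ ↦ (1/2) ω(φ x, x)`. -/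
def linearMoment (x : X) : Module.Dual ℝ F :=
  (1 / 2 : ℝ) • ((D.ωX.flip x).comp
    ((ContinuousLinearMap.apply ℝ X x).toLinearMap.comp D.dρ.toLinearMap))

theorem linearMoment_apply (x : X) (φ : F) :
    D.linearMoment x φ = 1 / 2 * D.ωX (D.dρ φ x) x := rfl

/-- The element `Q_x` of the Lie algebra of `H` with `⟨Q_x, φ⟩ = (1/2) ω(φ x, x)` for all `φ`
in the Lie algebra of `H`. -/
def Q (x : X) : F := (D.BH.toDual D.BH_nondegenerate).symm (D.linearMoment x)

theorem BH_Q (x : X) (φ : F) : D.BH (D.Q x) φ = 1 / 2 * D.ωX (D.dρ φ x) x :=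
  LinearMap.BilinForm.apply_toDual_symm_apply (hB := D.BH_nondegenerate) _ _

theorem eq_Q {ψ : F} {x : X} (h : ∀ φ, D.BH ψ φ = 1 / 2 * D.ωX (D.dρ φ x) x) : ψ = D.Q x := by
  refine (D.BH.toDual D.BH_nondegenerate).injective ?_
  ext φ
  rw [LinearMap.BilinForm.toDual_def, LinearMap.BilinForm.toDual_def, h, BH_Q]

theorem Q_ρ (h : H) (x : X) : D.Q (D.ρ h x) = Ad F h (D.Q x) := by
  refine (D.eq_Q fun φ => ?_).symm
  have e : φ = Ad F h (Ad F h⁻¹ φ) := by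
    have := Ad_inv_apply (E := F) h⁻¹ φ
    rw [inv_inv] at this
    exact this.symm
  rw [e, D.dρ_Ad, D.ρ_symplectic, ← D.BH_Q, BH_apply, BH_apply, dι_Ad, dι_Ad, D.B_Ad]

theorem dι_mem_lieK (φ : F) : D.dι φ ∈ D.lieK := by
  let e := extChartAt 𝓘(ℝ, F) (1 : H)
  let c : ℝ → F := fun t => e 1 + t • φ
  let γ : ℝ → H := fun t => e.symm (c t)
  have hc0 : c 0 = e 1 := by simp [c]
  have hγ0 : γ 0 = 1 := by
    change e.symm (c 0) = 1
    rw [hc0]; exact extChartAt_to_inv (I := 𝓘(ℝ, F)) (1 : H)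
  have hcs : ContMDiffAt 𝓘(ℝ, ℝ) 𝓘(ℝ, F) ∞ c 0 :=
    (contDiff_const.add (contDiff_id.smul contDiff_const)).contMDiff.contMDiffAt
  have hes : ContMDiffAt 𝓘(ℝ, F) 𝓘(ℝ, F) ∞ e.symm (c 0) := by
    rw [hc0]
    have := contMDiffOn_extChartAt_symm (I := 𝓘(ℝ, F)) (n := ∞) (1 : H)
    exact this.contMDiffAt (extChartAt_target_mem_nhds (I := 𝓘(ℝ, F)) (1 : H))
  have hγs : ContMDiffAt 𝓘(ℝ, ℝ) 𝓘(ℝ, F) ∞ γ 0 := ContMDiffAt.comp (0 : ℝ) hes hcs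
  have hcd : HasFDerivAt c (ContinuousLinearMap.toSpanSingleton ℝ φ) 0 := by
    have : HasDerivAt c φ 0 := by
      have h := ((hasDerivAt_id (0 : ℝ)).smul_const φ).const_add (e 1)
      rw [one_smul] at h
      exact h
    exact this.hasFDerivAt
  have hγd : HasMFDerivAt 𝓘(ℝ, ℝ) 𝓘(ℝ, F) γ 0 (ContinuousLinearMap.toSpanSingleton ℝ φ) := by
    refine ⟨hγs.continuousAt, ?_⟩
    have hev : ∀ᶠ t in 𝓝 (0 : ℝ), c t ∈ e.target := by
      refine hcd.continuousAt.eventually_mem ?_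
      rw [hc0]; exact extChartAt_target_mem_nhds (I := 𝓘(ℝ, F)) (1 : H)
    have hw : writtenInExtChartAt 𝓘(ℝ, ℝ) 𝓘(ℝ, F) 0 γ =ᶠ[𝓝 (0 : ℝ)] c := by
      filter_upwards [hev] with t ht
      simp only [writtenInExtChartAt, hγ0, extChartAt_model_space_eq_id, Function.comp]
      exact e.right_inv ht
    exact (hcd.congr_of_eventuallyEq hw).hasFDerivWithinAt (s := Set.range 𝓘(ℝ, ℝ))
  refine ⟨fun t => D.ι (γ t), ?_, by simp [hγ0], fun t => D.β_fixed (γ t), ?_⟩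
  · exact ContMDiffAt.comp (0 : ℝ) D.ι_smooth.contMDiffAt hγs
  · have h := HasMFDerivAt.comp (0 : ℝ) (D.hasMFDerivAt_ι (γ 0) hγ0) hγd
    have e : ContinuousLinearMap.toSpanSingleton ℝ (D.dι φ) =
        D.dι.comp (ContinuousLinearMap.toSpanSingleton ℝ φ) := by
      ext; simp
    exact e ▸ h

/-- The moment map of the action of `H` on `G × (𝔨 ⊕ X)`. -/
def muH (q : G × D.lieK × X) : Module.Dual ℝ F :=
  (D.B q.2.1).comp D.dι.toLinearMap + D.linearMoment q.2.2

/-- The moment map of the action of `G` on `G × (𝔨 ⊕ X)`, with values in the Lie algebra of `G`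
by means of the inner product. -/
def muG (q : G × D.lieK × X) : E := Ad E q.1 (D.β + q.2.1)

/-- The space `G × (𝔨/𝔥 ⊕ X)`. -/
abbrev Total : Type _ := G × D.kPerp × X

/-- The identification of `G × (𝔨/𝔥 ⊕ X)` with the zero level of `muH`. -/
def toLevel (q : D.Total) : G × D.lieK × X :=
  (q.1, ⟨q.2.1, q.2.1.2.1⟩ - ⟨D.dι (D.Q q.2.2), D.dι_mem_lieK _⟩, q.2.2)

theorem toLevel_injective : Function.Injective D.toLevel := by
  rintro ⟨g, ν, x⟩ ⟨g', ν', x'⟩ h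
  simp only [toLevel, Prod.mk.injEq] at h
  obtain ⟨rfl, h, rfl⟩ := h
  have : (ν : E) = ν' := congrArg (Subtype.val : D.lieK → E) (sub_left_injective (G := D.lieK) h)
  rw [Subtype.ext this]

theorem range_toLevel : Set.range D.toLevel = {q | D.muH q = 0} := by
  ext ⟨g, ν, x⟩
  constructor
  · rintro ⟨⟨g', ν', x'⟩, h⟩
    rw [← h]
    refine LinearMap.ext fun φ => ?_
    have h1 := D.BH_Q x' φ
    rw [BH_apply] at h1
    have h2 := ν'.2.2 φ
    change D.B ((ν' : E) - D.dι (D.Q x')) (D.dι φ) + D.linearMoment x' φ = 0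
    rw [linearMoment_apply, map_sub, LinearMap.sub_apply, h1, h2]
    ring
  · intro h
    have hm : (ν : E) + D.dι (D.Q x) ∈ D.kPerp := by
      refine ⟨D.lieK.add_mem ν.2 (D.dι_mem_lieK _), fun φ => ?_⟩
      have h0 : D.B ν (D.dι φ) + D.linearMoment x φ = 0 := DFunLike.congr_fun h φ
      have h1 := D.BH_Q x φ
      rw [BH_apply] at h1
      rw [map_add, LinearMap.add_apply, h1, ← linearMoment_apply, h0]
    refine ⟨(g, ⟨_, hm⟩, x), ?_⟩
    simp only [toLevel, Prod.mk.injEq, true_and, and_true]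
    ext
    simp

theorem Ad_mem_kPerp (h : H) {ν : E} (hν : ν ∈ D.kPerp) : Ad E (D.ι h) ν ∈ D.kPerp := by
  refine ⟨Ad_mem_lieOfSubgroup (D.β_fixed h) hν.1, fun φ => ?_⟩
  have e : φ = Ad F h (Ad F h⁻¹ φ) := by
    have := Ad_inv_apply (E := F) h⁻¹ φ
    rw [inv_inv] at this
    exact this.symm
  rw [e, dι_Ad, D.B_Ad]
  exact hν.2 _

/-- The action of `H` on `G × (𝔨/𝔥 ⊕ X)`: `h (g, ν, x) = (g h⁻¹, Ad_h ν, h x)`. -/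
def act (h : H) (q : D.Total) : D.Total :=
  (q.1 * (D.ι h)⁻¹, ⟨Ad E (D.ι h) q.2.1, D.Ad_mem_kPerp h q.2.1.2⟩, D.ρ h q.2.2)

theorem act_one (q : D.Total) : D.act 1 q = q := by
  obtain ⟨g, ν, x⟩ := q
  simp [act, Ad_one]

theorem act_mul (h k : H) (q : D.Total) : D.act (h * k) q = D.act h (D.act k q) := by
  obtain ⟨g, ν, x⟩ := q
  simp [act, Ad_mul, mul_assoc]

/-- The equivalence relation of lying in one orbit of `H`. -/
def orbitSetoid : Setoid D.Total where
  r q q' := ∃ h : H, D.act h q = q'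
  iseqv :=
    { refl := fun q => ⟨1, D.act_one q⟩
      symm := by
        rintro q q' ⟨h, rfl⟩
        exact ⟨h⁻¹, by rw [← act_mul, inv_mul_cancel, act_one]⟩
      trans := by
        rintro q q' q'' ⟨h, rfl⟩ ⟨k, rfl⟩
        exact ⟨k * h, D.act_mul k h q⟩ }

/-- The standard neighborhood `G ×_H (𝔨/𝔥 ⊕ X)`, with the quotient topology. -/
def Model : Type _ := Quotient D.orbitSetoid

instance : TopologicalSpace D.Model := inferInstanceAs (TopologicalSpace (Quotient D.orbitSetoid))

/-- The quotient map from `G × (𝔨/𝔥 ⊕ X)`: a point goes to its orbit under `H`.  The smooth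
structure of `G ×_H (𝔨/𝔥 ⊕ X)` is the one for which this is a smooth submersion. -/
def proj (q : D.Total) : D.Model := Quotient.mk D.orbitSetoid q

/-- The moment map of the action of `G` on `G ×_H (𝔨/𝔥 ⊕ X)`, induced by `muG`. -/
def mu : D.Model → E :=
  Quotient.lift (fun q => D.muG (D.toLevel q)) (by
    rintro ⟨g, ν, x⟩ q' ⟨h, rfl⟩
    have e : D.β + (Ad E (D.ι h) (ν : E) - D.dι (D.Q (D.ρ h x))) =
        Ad E (D.ι h) (D.β + (ν - D.dι (D.Q x))) := by
      rw [Q_ρ, dι_Ad, map_add (Ad E (D.ι h)), map_sub (Ad E (D.ι h)), D.β_fixed]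
    change Ad E g (D.β + ((ν : E) - D.dι (D.Q x))) =
      Ad E (g * (D.ι h)⁻¹) (D.β + (Ad E (D.ι h) (ν : E) - D.dι (D.Q (D.ρ h x))))
    rw [e, Ad_mul_apply, Ad_inv_apply])

/-- The function `|μ|²` on the model. -/
def normSqMu (m : D.Model) : ℝ := D.B (D.mu m) (D.mu m)

/-- The manifold structure used on `G × (𝔨/𝔥 ⊕ X)`. -/
abbrev totalModel : ModelWithCorners ℝ (E × (D.kPerp × X)) (ModelProd E (D.kPerp × X)) :=
  𝓘(ℝ, E).prod 𝓘(ℝ, D.kPerp × X)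

/-- The critical set of `|μ|²` on the model.  Since `proj` is a submersion, the differential at
`proj q` vanishes exactly when the differential of the composite with `proj` vanishes at `q`. -/
def criticalSet : Set D.Model :=
  {m | ∀ q : D.Total, D.proj q = m →
    HasMFDerivAt D.totalModel 𝓘(ℝ, ℝ) (fun q' => D.normSqMu (D.proj q')) q 0}

/-- The `H`-orbit of the point `(1, 0)`. -/
def base : D.Model := D.proj (1, 0, 0)

/-- The set of `x` in `X` with `β x = 0` and `Q_x = 0`; that `β` acts on `X` means that it is
in the Lie algebra of `H`. -/
def Z : Set X := {x | (∃ b : F, D.dι b = D.β ∧ D.dρ b x = 0) ∧ D.Q x = 0}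

/-- The set of the `H`-orbits of the points `(g, z)` with `g ∈ G` and `z ∈ Z`. -/
def assocZ : Set D.Model := {m | ∃ g : G, ∃ z ∈ D.Z, D.proj (g, 0, z) = m}

/-- The tangent space at `q` to the orbit of `q` under `H`. -/
def orbitTangent (q : D.Total) : Set (E × (D.kPerp × X)) :=
  Set.range (mfderiv 𝓘(ℝ, F) D.totalModel (fun h : H => D.act h q) 1)

/-- A subset `S` of the model is a real algebraic variety: for some smooth closed embedding of
the model in some `ℝ^N` (a closed topological embedding which is smooth and an immersion) the
image of `S` is the set of zeros of a set of polynomials. The immersion condition says that the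
differential of the composite with `proj` kills no vector outside the kernel of the differential
of `proj`, the tangent space of the orbit. -/
def IsRealAlgebraicVariety (S : Set D.Model) : Prop :=
  ∃ (N : ℕ) (Φ : D.Model → (Fin N → ℝ)),
    Topology.IsClosedEmbedding Φ ∧
    ContMDiff D.totalModel 𝓘(ℝ, Fin N → ℝ) ∞ (fun q => Φ (D.proj q)) ∧
    (∀ (q : D.Total) (v : E × (D.kPerp × X)),
      mfderiv D.totalModel 𝓘(ℝ, Fin N → ℝ) (fun q' => Φ (D.proj q')) q v = 0 →
        v ∈ D.orbitTangent q) ∧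
    ∃ I : Ideal (MvPolynomial (Fin N) ℝ), Φ '' S = MvPolynomial.zeroLocus ℝ I

end LocalData

end HamiltonianModel

end

/-! Critical set. The inner product is invariant, so |μ|² at [g, ν, x] equals |β + ν - Q_x|² and
depends only on (ν, x). Criticality of `base` says that β is orthogonal to 𝔨/𝔥; since β lies in 𝔨,
it lies in 𝔥. The differential then splits orthogonally, and [g, ν, x] is critical exactly when ν =
0 and β x = Q_x x (`isCritical_iff`).

For small Q_x this equation forces x ∈ Z (`exists_mem_Z_of_norm_Q_lt`). Indeed β acts on X by an
operator A that is skew for an H-invariant inner product, whence |A x| ≤ C |A² x|; and A commutes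
with 𝔥 because H fixes β, so A² x = Q_x (A x). If Q_x is small, A x = 0, and then |Q_x|² = ½ ω(Q_x
x, x) = ½ ω(A x, x) = 0. Hence G ×_H Z is closed and relatively open in the critical set. It is
connected, because Z is a cone and G/H is connected, so it is the component
(`connectedComponentIn_criticalSet`).

Algebraicity. Put V = 𝔨/𝔥 ⊕ X. By the Peter–Weyl theorem, functions whose left translates span a
finite-dimensional space are dense in C(G); averaging over H carries this to H-equivariant maps G →
V. Two objects result: an equivariant frame f_j (`exists_equivariant_frame`), and a
finite-dimensional left-invariant space 𝒜 of functions on G/H that separates cosets and tangent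
directions (`exists_isQuotientSpace_separating`). With a basis b_i of 𝒜, the map (g, v) ↦ (b_i(g),
⟨v, f_j(g)⟩) descends to a proper injective immersion of the model.

Its image of G ×_H Z is cut out by three kinds of polynomials. The points (b_i(g)) form one orbit of
a matrix representation of G, and orbits of compact groups are algebraic
(`exists_polynomial_separating_orbits`). The fibre coordinates satisfy linear equations with
coefficients in 𝒜, that is, linear in the b_i. Finally |ν|² + |β x|² + |Q_x|² is a polynomial in the
coordinates whose zero set is Z, provided 𝒜 was enlarged by its coefficients. -/

set_option linter.unusedSectionVars false

/-! ### The spectral theorem for compact self-adjoint operators -/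

section CompactSelfAdjoint

variable {𝓗 : Type*} [NormedAddCommGroup 𝓗] [InnerProductSpace ℝ 𝓗]

/-- The norm of a self-adjoint operator is its spectral radius, and by the Fredholm alternative
every nonzero spectral value of a compact operator is an eigenvalue. -/
theorem IsCompactOperator.eq_zero_of_forall_not_hasEigenvalue [CompleteSpace 𝓗] {T : 𝓗 →L[ℝ] 𝓗}
    (hT : IsCompactOperator T) (hs : IsSelfAdjoint T)
    (h : ∀ c : ℝ, c ≠ 0 → ¬ Module.End.HasEigenvalue (T : Module.End ℝ 𝓗) c) : T = 0 := by
  have hr := T.spectralRadius_eq_nnnorm hs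
  have h0 : spectralRadius ℝ T = 0 := by
    refine le_antisymm (iSup₂_le fun c hc => ?_) bot_le
    by_cases hc0 : c = 0
    · simp [hc0]
    · exact absurd ((hT.hasEigenvalue_or_mem_resolventSet hc0).resolve_left (h c hc0)) hc
  rw [h0] at hr
  simpa using hr.symm

/-- On the orthogonal complement of all eigenspaces the operator has no eigenvector, so it vanishes
there; the complement is then contained in the eigenspace for 0, to which it is orthogonal. -/
theorem IsCompactOperator.orthogonal_iSup_eigenspace_eq_bot [CompleteSpace 𝓗] {T : 𝓗 →L[ℝ] 𝓗}
    (hT : IsCompactOperator T) (hs : (T : 𝓗 →ₗ[ℝ] 𝓗).IsSymmetric) :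
    (⨆ c, Module.End.eigenspace (T : 𝓗 →ₗ[ℝ] 𝓗) c)ᗮ = ⊥ := by
  set U := (⨆ c, Module.End.eigenspace (T : 𝓗 →ₗ[ℝ] 𝓗) c)ᗮ with hU
  have hinv : ∀ v ∈ U, (T : 𝓗 →ₗ[ℝ] 𝓗) v ∈ U := hs.orthogonalComplement_iSup_eigenspaces_invariant
  have hc : IsClosed (U : Set 𝓗) := Submodule.isClosed_orthogonal _
  have : CompleteSpace U := hc.completeSpace_coe
  have hR : IsCompactOperator ((T : 𝓗 →ₗ[ℝ] 𝓗).restrict hinv) :=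
    IsCompactOperator.restrict (f := (T : 𝓗 →ₗ[ℝ] 𝓗)) hT hinv hc
  let R : U →L[ℝ] U := ⟨(T : 𝓗 →ₗ[ℝ] 𝓗).restrict hinv, hR.continuous⟩
  have hRs : IsSelfAdjoint R :=
    ContinuousLinearMap.isSelfAdjoint_iff_isSymmetric.2 (hs.restrict_invariant hinv)
  have h0 : R = 0 := by
    refine IsCompactOperator.eq_zero_of_forall_not_hasEigenvalue (T := R) hR hRs fun c _ => ?_
    rw [Module.End.hasEigenvalue_iff, not_not]
    exact hs.orthogonalComplement_iSup_eigenspaces c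
  rw [Submodule.eq_bot_iff]
  intro x hx
  have hx0 : T x = 0 := congrArg Subtype.val (show R ⟨x, hx⟩ = 0 by rw [h0]; rfl)
  have hx1 : x ∈ ⨆ c, Module.End.eigenspace (T : 𝓗 →ₗ[ℝ] 𝓗) c := by
    refine Submodule.mem_iSup_of_mem 0 ?_
    rw [Module.End.mem_eigenspace_iff, zero_smul]
    exact hx0
  exact inner_self_eq_zero.1 (Submodule.inner_right_of_mem_orthogonal hx1 hx)

/-- On the eigenspace, c⁻¹ T is the identity, which is therefore compact. -/
theorem IsCompactOperator.finiteDimensional_eigenspace {T : 𝓗 →L[ℝ] 𝓗}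
    (hT : IsCompactOperator T) {c : ℝ} (hc : c ≠ 0) :
    FiniteDimensional ℝ (Module.End.eigenspace (T : 𝓗 →ₗ[ℝ] 𝓗) c) := by
  set V := Module.End.eigenspace (T : 𝓗 →ₗ[ℝ] 𝓗) c
  have hcl : IsClosed (V : Set 𝓗) := by
    have : (V : Set 𝓗) = {x | T x = c • x} := by
      ext x
      exact Module.End.mem_eigenspace_iff
    rw [this]
    exact isClosed_eq T.continuous (continuous_const_smul c)
  have hinv : ∀ v ∈ V, (T : 𝓗 →ₗ[ℝ] 𝓗) v ∈ V := fun v hv => by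
    rw [Module.End.mem_eigenspace_iff.1 hv]
    exact V.smul_mem _ hv
  have hR := (IsCompactOperator.restrict (f := (T : 𝓗 →ₗ[ℝ] 𝓗)) hT hinv hcl).smul c⁻¹
  refine FiniteDimensional.of_isCompactOperator_id (𝕜 := ℝ) ?_
  have e : c⁻¹ • ⇑((T : 𝓗 →ₗ[ℝ] 𝓗).restrict hinv) = (id : V → V) := by
    refine funext fun v => Subtype.ext ?_
    have h : (T : 𝓗 →ₗ[ℝ] 𝓗) v = c • (v : 𝓗) := Module.End.mem_eigenspace_iff.1 v.2
    simp only [id, Pi.smul_apply, Submodule.coe_smul, LinearMap.coe_restrict_apply, h]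
    rw [smul_smul, inv_mul_cancel₀ hc, one_smul]
  rwa [e] at hR

end CompactSelfAdjoint

/-! ### Operators defined by continuous families of vectors of a Hilbert space -/

section Pairing

variable {𝓗 : Type*} [NormedAddCommGroup 𝓗] [InnerProductSpace ℝ 𝓗]
  {Y : Type*} [TopologicalSpace Y] [CompactSpace Y]

/-- The operator that sends a vector `v` to the function `y ↦ ⟪κ y, v⟫`. -/
noncomputable def ContinuousMap.pairing (κ : C(Y, 𝓗)) : 𝓗 →L[ℝ] C(Y, ℝ) :=
  LinearMap.mkContinuous
    { toFun := fun v => ⟨fun y => inner ℝ (κ y) v, by fun_prop⟩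
      map_add' := fun v w => by ext; simp [inner_add_right]
      map_smul' := fun c v => by ext; simp [inner_smul_right] } ‖κ‖ fun v => by
    rw [ContinuousMap.norm_le _ (by positivity)]
    intro y
    exact (norm_inner_le_norm _ _).trans
      (mul_le_mul_of_nonneg_right (κ.norm_coe_le_norm y) (norm_nonneg v))

@[simp] theorem ContinuousMap.pairing_apply (κ : C(Y, 𝓗)) (v : 𝓗) (y : Y) :
    κ.pairing v y = inner ℝ (κ y) v := rfl

/-- The range of `κ` is compact, hence within ε/2 of the span of a finite net. Projecting to that
span first approximates the operator in norm by operators of finite rank. -/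
theorem ContinuousMap.isCompactOperator_pairing (κ : C(Y, 𝓗)) : IsCompactOperator κ.pairing := by
  refine isClosed_setOfPred_isCompactOperator.closure_subset ?_
  change κ.pairing ∈ @closure _ PseudoMetricSpace.toUniformSpace.toTopologicalSpace _
  rw [Metric.mem_closure_iff]
  intro ε hε
  obtain ⟨t, htf, ht⟩ := Metric.totallyBounded_iff.1
    (isCompact_range κ.continuous).totallyBounded (ε / 2) (by positivity)
  let K := Submodule.span ℝ t
  have : FiniteDimensional ℝ K := FiniteDimensional.span_of_finite ℝ htf
  have hK : ∀ y, ‖κ y - K.starProjection (κ y)‖ ≤ ε / 2 := by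
    intro y
    obtain ⟨z, hz, hyz⟩ := Set.mem_iUnion₂.1 (ht ⟨y, rfl⟩)
    -- The projection is the nearest point of `K`, so it is no farther from `κ y` than the point `z`
    -- of the net.
    rw [Submodule.starProjection_minimal]
    refine (ciInf_le ⟨0, ?_⟩ (⟨z, Submodule.subset_span hz⟩ : K)).trans ?_
    · rintro _ ⟨w, rfl⟩
      exact norm_nonneg _
    · rw [Metric.mem_ball, dist_eq_norm] at hyz
      exact hyz.le
  refine ⟨κ.pairing.comp K.starProjection, ?_, ?_⟩
  · have h : IsCompactOperator (κ.pairing.comp K.subtypeL) :=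
      isCompactOperator_of_locallyCompactSpace_rng (κ.pairing.comp K.subtypeL)
    exact h.comp_clm K.orthogonalProjectionOnto
  · refine (dist_eq_norm (E := 𝓗 →L[ℝ] C(Y, ℝ)) _ _).trans_lt
      (lt_of_le_of_lt ?_ (half_lt_self hε))
    refine ContinuousLinearMap.opNorm_le_bound _ (by positivity) fun v => ?_
    rw [ContinuousMap.norm_le _ (by positivity)]
    intro y
    have : (κ.pairing - κ.pairing.comp K.starProjection) v y =
        inner ℝ (κ y - K.starProjection (κ y)) v := by
      simp [inner_sub_left, Submodule.inner_starProjection_left_eq_right]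
    rw [this]
    exact (norm_inner_le_norm _ _).trans (mul_le_mul_of_nonneg_right (hK y) (norm_nonneg v))

end Pairing

/-! ### Left-invariant spaces of continuous functions on a compact group -/

section LeftInvariant

variable {G : Type*} [TopologicalSpace G] [Group G] [IsTopologicalGroup G]
  {W : Type*} [NormedAddCommGroup W] [NormedSpace ℝ W]

/-- Left translation of a function: `g ↦ f (x * g)`. -/
def leftTranslate (x : G) : C(G, W) →ₗ[ℝ] C(G, W) where
  toFun f := f.comp (ContinuousMap.mulLeft x)
  map_add' _ _ := rfl
  map_smul' _ _ := rfl

@[simp] theorem leftTranslate_apply (x : G) (f : C(G, W)) (g : G) :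
    leftTranslate x f g = f (x * g) := rfl

theorem continuous_leftTranslate (f : C(G, W)) : Continuous fun x : G => leftTranslate x f :=
  ContinuousMap.continuous_of_continuous_uncurry _
    (f.continuous.comp continuous_mul)

/-- A space of functions on a group that is invariant under left translations. -/
def IsLeftInvariant (𝒲 : Submodule ℝ C(G, W)) : Prop :=
  ∀ x, ∀ f ∈ 𝒲, leftTranslate x f ∈ 𝒲

theorem IsLeftInvariant.sup {𝒲 𝒲' : Submodule ℝ C(G, W)} (h : IsLeftInvariant 𝒲)
    (h' : IsLeftInvariant 𝒲') : IsLeftInvariant (𝒲 ⊔ 𝒲') := by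
  intro x f hf
  obtain ⟨a, ha, b, hb, rfl⟩ := Submodule.mem_sup.1 hf
  rw [map_add]
  exact Submodule.add_mem_sup (h x a ha) (h' x b hb)

theorem isLeftInvariant_bot : IsLeftInvariant (⊥ : Submodule ℝ C(G, W)) := by
  intro x f hf
  rw [Submodule.mem_bot] at hf ⊢
  rw [hf, map_zero]

theorem IsLeftInvariant.map {W' : Type*} [NormedAddCommGroup W'] [NormedSpace ℝ W']
    {𝒲 : Submodule ℝ C(G, W)} (h : IsLeftInvariant 𝒲) (L : C(G, W) →ₗ[ℝ] C(G, W'))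
    (hL : ∀ x f, L (leftTranslate x f) = leftTranslate x (L f)) : IsLeftInvariant (𝒲.map L) := by
  rintro x _ ⟨f, hf, rfl⟩
  exact ⟨_, h x f hf, hL x f⟩

variable (G W) in
/-- The continuous functions whose left translates span a space of finite dimension. -/
def leftFinite : Submodule ℝ C(G, W) where
  carrier := {f | ∃ 𝒲 : Submodule ℝ C(G, W), FiniteDimensional ℝ 𝒲 ∧ IsLeftInvariant 𝒲 ∧ f ∈ 𝒲}
  add_mem' := by
    rintro a b ⟨𝒲, h1, h2, h3⟩ ⟨𝒱, k1, k2, k3⟩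
    exact ⟨𝒲 ⊔ 𝒱, inferInstance, h2.sup k2, Submodule.add_mem_sup h3 k3⟩
  zero_mem' := ⟨⊥, inferInstance, isLeftInvariant_bot, Submodule.zero_mem _⟩
  smul_mem' := by
    rintro c a ⟨𝒲, h1, h2, h3⟩
    exact ⟨𝒲, h1, h2, 𝒲.smul_mem c h3⟩

end LeftInvariant

/-! ### The Peter–Weyl theorem -/

section PeterWeyl

open MeasureTheory

theorem integrable_of_continuous {Y : Type*} [TopologicalSpace Y] [CompactSpace Y]
    [MeasurableSpace Y] [BorelSpace Y] (μ : Measure Y) [IsFiniteMeasureOnCompacts μ]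
    {W : Type*} [NormedAddCommGroup W] {f : Y → W} (hf : Continuous f) : Integrable f μ :=
  hf.integrable_of_hasCompactSupport (HasCompactSupport.of_compactSpace f)

variable {G : Type*} [TopologicalSpace G] [Group G] [IsTopologicalGroup G] [CompactSpace G]
  [MeasurableSpace G] [BorelSpace G] (μ : Measure G) [μ.IsHaarMeasure]

/-- The kernel `x ↦ k (x⁻¹ * ·)` of convolution with `k`. -/
noncomputable def convKernel (k : C(G, ℝ)) : C(G, Lp ℝ 2 μ) where
  toFun x := ContinuousMap.toLp 2 μ ℝ (leftTranslate x⁻¹ k)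
  continuous_toFun := (ContinuousMap.toLp 2 μ ℝ).continuous.comp
    ((continuous_leftTranslate k).comp continuous_inv)

theorem pairing_convKernel_toLp (k f : C(G, ℝ)) (x : G) :
    (convKernel μ k).pairing (ContinuousMap.toLp 2 μ ℝ f) x = ∫ y, f y * k (x⁻¹ * y) ∂μ := by
  rw [ContinuousMap.pairing_apply]
  exact ContinuousMap.inner_toLp μ _ _

/-- The substitution y = x z moves `x` from the kernel into `f`. In this form convolution visibly
commutes with left translations and is a mean of right translates of `f`. -/
theorem pairing_convKernel_toLp' (k f : C(G, ℝ)) (x : G) :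
    (convKernel μ k).pairing (ContinuousMap.toLp 2 μ ℝ f) x = ∫ z, f (x * z) * k z ∂μ := by
  rw [pairing_convKernel_toLp, ← integral_mul_left_eq_self _ x]
  simp

theorem pairing_convKernel_leftTranslate (k f : C(G, ℝ)) (a : G) :
    (convKernel μ k).pairing (ContinuousMap.toLp 2 μ ℝ (leftTranslate a f)) =
      leftTranslate a ((convKernel μ k).pairing (ContinuousMap.toLp 2 μ ℝ f)) := by
  ext x
  rw [leftTranslate_apply, pairing_convKernel_toLp', pairing_convKernel_toLp']
  simp [mul_assoc]

/-- Convolution with `k` as an operator on `L²`. -/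
noncomputable def convOperator (k : C(G, ℝ)) : Lp ℝ 2 μ →L[ℝ] Lp ℝ 2 μ :=
  (ContinuousMap.toLp 2 μ ℝ).comp (convKernel μ k).pairing

theorem isCompactOperator_convOperator (k : C(G, ℝ)) : IsCompactOperator (convOperator μ k) :=
  (convKernel μ k).isCompactOperator_pairing.clm_comp (ContinuousMap.toLp 2 μ ℝ)

/-- By density it suffices to treat continuous functions; there it is Fubini together with the
symmetry k(x⁻¹ y) = k(y⁻¹ x) of the kernel. -/
theorem isSymmetric_convOperator [μ.WeaklyRegular] [T2Space G] {k : C(G, ℝ)}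
    (hk : ∀ x, k x⁻¹ = k x) :
    (convOperator μ k : Lp ℝ 2 μ →ₗ[ℝ] Lp ℝ 2 μ).IsSymmetric := by
  intro u v
  refine (ContinuousMap.toLp_denseRange ℝ μ ℝ (p := 2) (by simp)).induction_on₂
    (p := fun u v => inner ℝ (convOperator μ k u) v = inner ℝ u (convOperator μ k v)) ?_ ?_ u v
  · exact isClosed_eq (by fun_prop) (by fun_prop)
  intro f g
  have h1 := ContinuousMap.inner_toLp (𝕜 := ℝ) μ
    ((convKernel μ k).pairing (ContinuousMap.toLp 2 μ ℝ f)) g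
  have h2 := ContinuousMap.inner_toLp (𝕜 := ℝ) μ f
    ((convKernel μ k).pairing (ContinuousMap.toLp 2 μ ℝ g))
  refine h1.trans (Eq.trans ?_ h2.symm)
  simp only [pairing_convKernel_toLp, conj_trivial, ← integral_const_mul, ← integral_mul_const]
  rw [integral_integral_swap_of_hasCompactSupport
    (by fun_prop) (HasCompactSupport.of_compactSpace _)]
  refine integral_congr_ae (Filter.Eventually.of_forall fun y => ?_)
  refine integral_congr_ae (Filter.Eventually.of_forall fun x => ?_)
  have : k (y⁻¹ * x) = k (x⁻¹ * y) := by rw [← hk]; simp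
  simp only [this]
  ring

/-- An eigenvector is only an L² class; its pairing is a continuous function that is again an
eigenvector. For c ≠ 0 the eigenspace within C(G) is left-invariant, since convolution commutes with
translations, and embeds in the finite-dimensional L² eigenspace. For c = 0 the pairing is zero. -/
theorem pairing_convKernel_mem_leftFinite {k : C(G, ℝ)} {c : ℝ} {u : Lp ℝ 2 μ}
    (hu : convOperator μ k u = c • u) :
    (convKernel μ k).pairing u ∈ leftFinite G ℝ := by
  have hinj : Function.Injective (ContinuousMap.toLp (E := ℝ) 2 μ ℝ : C(G, ℝ) → Lp ℝ 2 μ) :=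
    ContinuousMap.toLp_injective μ
  by_cases hc : c = 0
  · have : (convKernel μ k).pairing u = 0 := by
      apply hinj
      rw [map_zero]
      exact hu.trans (by rw [hc, zero_smul])
    rw [this]
    exact Submodule.zero_mem _
  let T : C(G, ℝ) →ₗ[ℝ] C(G, ℝ) :=
    ((convKernel μ k).pairing.comp (ContinuousMap.toLp 2 μ ℝ)).toLinearMap
  refine ⟨Module.End.eigenspace T c, ?_, ?_, ?_⟩
  · have := (isCompactOperator_convOperator μ k).finiteDimensional_eigenspace hc
    let L : Module.End.eigenspace T c →ₗ[ℝ]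
        Module.End.eigenspace (convOperator μ k : Lp ℝ 2 μ →ₗ[ℝ] Lp ℝ 2 μ) c :=
      (ContinuousMap.toLp (E := ℝ) 2 μ ℝ).toLinearMap.restrict fun f hf => by
        rw [Module.End.mem_eigenspace_iff] at hf ⊢
        exact (congrArg (ContinuousMap.toLp (E := ℝ) 2 μ ℝ) hf).trans (map_smul _ _ _)
    refine FiniteDimensional.of_injective L fun f g hfg => Subtype.ext (hinj ?_)
    exact congrArg Subtype.val hfg
  · intro x f hf
    rw [Module.End.mem_eigenspace_iff] at hf ⊢
    exact (pairing_convKernel_leftTranslate μ k f x).trans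
      ((congrArg (leftTranslate x) hf).trans (map_smul _ _ _))
  · rw [Module.End.mem_eigenspace_iff]
    have h : (convKernel μ k).pairing (convOperator μ k u) = c • (convKernel μ k).pairing u := by
      rw [hu, map_smul]
    exact h

theorem exists_even_bump [T2Space G] {U : Set G} (hU : U ∈ 𝓝 (1 : G)) :
    ∃ k : C(G, ℝ), (∀ x, 0 ≤ k x) ∧ (∀ x, k x⁻¹ = k x) ∧ (∀ x, k x ≠ 0 → x ∈ U) ∧
      ∫ x, k x ∂μ = 1 := by
  obtain ⟨V, hVU, hVo, h1V⟩ := mem_nhds_iff.1 (Filter.inter_mem hU (inv_mem_nhds_one G hU))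
  obtain ⟨χ, hχ0, hχ1, hχ⟩ := exists_continuous_zero_one_of_isClosed hVo.isClosed_compl
    (isClosed_singleton (x := (1 : G)))
    (Set.disjoint_left.2 fun x hx hx1 => hx (by rw [Set.mem_singleton_iff.1 hx1]; exact h1V))
  let k₀ : C(G, ℝ) := χ + χ.comp ⟨fun x => x⁻¹, continuous_inv⟩
  have hk₀ : ∀ x, k₀ x = χ x + χ x⁻¹ := fun x => rfl
  have hpos : 0 < ∫ x, k₀ x ∂μ := by
    refine k₀.continuous.integral_pos_of_hasCompactSupport_nonneg_nonzero
      (HasCompactSupport.of_compactSpace _)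
      (fun x => add_nonneg (hχ x).1 (hχ x⁻¹).1) (x := 1) ?_
    rw [hk₀, inv_one, hχ1 rfl]
    norm_num
  refine ⟨(∫ x, k₀ x ∂μ)⁻¹ • k₀, fun x => ?_, fun x => ?_, fun x hx => ?_, ?_⟩
  · exact mul_nonneg (inv_nonneg.2 hpos.le) (add_nonneg (hχ x).1 (hχ x⁻¹).1)
  · simp [hk₀, add_comm]
  · by_contra hxU
    refine hx ?_
    have h1 : χ x = 0 := hχ0 fun h => hxU (hVU h).1
    have h2 : χ x⁻¹ = 0 := hχ0 fun h => hxU (by simpa using (hVU h).2)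
    simp [hk₀, h1, h2]
  · simp only [ContinuousMap.smul_apply, smul_eq_mul, integral_const_mul]
    exact inv_mul_cancel₀ hpos.ne'

theorem norm_sub_pairing_convKernel_le {k f : C(G, ℝ)} {ε : ℝ} (hε : 0 ≤ ε) (hk : ∀ x, 0 ≤ k x)
    (hk1 : ∫ x, k x ∂μ = 1) (h : ∀ z, k z ≠ 0 → ∀ x, |f x - f (x * z)| ≤ ε) :
    ‖f - (convKernel μ k).pairing (ContinuousMap.toLp 2 μ ℝ f)‖ ≤ ε := by
  rw [ContinuousMap.norm_le _ hε]
  intro x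
  have e : f x = ∫ z, f x * k z ∂μ := by rw [integral_const_mul, hk1, mul_one]
  rw [ContinuousMap.sub_apply, pairing_convKernel_toLp', e, ← integral_sub
    (integrable_of_continuous μ (by fun_prop)) (integrable_of_continuous μ (by fun_prop))]
  refine (norm_integral_le_integral_norm _).trans ?_
  have e' : ε = ∫ z, ε * k z ∂μ := by rw [integral_const_mul, hk1, mul_one]
  rw [e']
  refine integral_mono (integrable_of_continuous μ (by fun_prop))
    (integrable_of_continuous μ (by fun_prop)) fun z => ?_
  simp only [← sub_mul, Real.norm_eq_abs, abs_mul, abs_of_nonneg (hk z)]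
  by_cases hz : k z = 0
  · simp [hz]
  · exact mul_le_mul_of_nonneg_right (h z hz x) (hk z)

end PeterWeyl

/-- Convolution with a bump near 1 changes `f` little in the uniform norm. Since `T` is continuous
from L² to C(G), an L² approximation by sums of eigenvectors becomes a uniform one after applying
`T`, which makes each summand left-finite. -/
theorem exists_mem_leftFinite_norm_sub_lt {G : Type*} [TopologicalSpace G] [Group G]
    [IsTopologicalGroup G] [CompactSpace G] [T2Space G] (f : C(G, ℝ)) {ε : ℝ} (hε : 0 < ε) :
    ∃ r ∈ leftFinite G ℝ, ‖f - r‖ < ε := by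
  borelize G
  let μ : MeasureTheory.Measure G := MeasureTheory.Measure.haar
  have hc : Continuous fun z : G => f.comp (ContinuousMap.mulRight z) :=
    ContinuousMap.continuous_of_continuous_uncurry _ (by
      simp only [Function.uncurry_def, ContinuousMap.comp_apply, ContinuousMap.coe_mulRight]
      fun_prop)
  have hU : {z : G | dist (f.comp (ContinuousMap.mulRight z)) f < ε / 2} ∈ 𝓝 (1 : G) := by
    have h := hc.continuousAt.preimage_mem_nhds (Metric.ball_mem_nhds _ (half_pos hε)) (x := 1)
    rwa [show f.comp (ContinuousMap.mulRight (1 : G)) = f by ext; simp] at h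
  obtain ⟨k, hk0, hke, hkU, hk1⟩ := exists_even_bump μ hU
  have hA := norm_sub_pairing_convKernel_le μ (f := f) (half_pos hε).le hk0 hk1 fun z hz x => by
    have h := (ContinuousMap.dist_apply_le_dist (f := f.comp (ContinuousMap.mulRight z)) (g := f)
      x).trans (hkU z hz).le
    rw [dist_comm, Real.dist_eq] at h
    exact h
  set T := (convKernel μ k).pairing
  have hdense : Dense ((⨆ c, Module.End.eigenspace
      (convOperator μ k : MeasureTheory.Lp ℝ 2 μ →ₗ[ℝ] MeasureTheory.Lp ℝ 2 μ) c :
        Submodule ℝ (MeasureTheory.Lp ℝ 2 μ)) : Set (MeasureTheory.Lp ℝ 2 μ)) := by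
    rw [Submodule.dense_iff_topologicalClosure_eq_top, Submodule.topologicalClosure_eq_top_iff]
    exact (isCompactOperator_convOperator μ k).orthogonal_iSup_eigenspace_eq_bot
      (isSymmetric_convOperator μ hke)
  have hopen : IsOpen {u : MeasureTheory.Lp ℝ 2 μ |
      ‖T (ContinuousMap.toLp 2 μ ℝ f) - T u‖ < ε / 2} :=
    isOpen_lt (by fun_prop) continuous_const
  obtain ⟨u, hu, hus⟩ := hdense.inter_open_nonempty _ hopen
    ⟨ContinuousMap.toLp 2 μ ℝ f, by simpa using hε⟩
  refine ⟨T u, ?_, ?_⟩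
  · refine Submodule.iSup_induction (motive := fun u => T u ∈ leftFinite G ℝ) _ hus ?_ ?_ ?_
    · intro c v hv
      exact pairing_convKernel_mem_leftFinite μ (Module.End.mem_eigenspace_iff.1 hv)
    · rw [map_zero]
      exact Submodule.zero_mem _
    · intro v w hv hw
      rw [map_add]
      exact Submodule.add_mem _ hv hw
  · calc ‖f - T u‖ = ‖(f - T (ContinuousMap.toLp 2 μ ℝ f)) +
          (T (ContinuousMap.toLp 2 μ ℝ f) - T u)‖ := by congr 1; abel
      _ ≤ _ := norm_add_le _ _
      _ < ε / 2 + ε / 2 := add_lt_add_of_le_of_lt hA hu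
      _ = ε := add_halves ε

/-! ### Invariant inner products and orthonormal bases -/

section InvariantForm

open MeasureTheory

theorem exists_isHaarMeasure_isProbabilityMeasure (H : Type*) [TopologicalSpace H] [Group H]
    [IsTopologicalGroup H] [CompactSpace H] [MeasurableSpace H] [BorelSpace H] :
    ∃ μ : Measure H, μ.IsHaarMeasure ∧ IsProbabilityMeasure μ :=
  ⟨Measure.haarMeasure ⊤, inferInstance, ⟨Measure.haarMeasure_self (K₀ := ⊤)⟩⟩

/-- A symmetric positive definite bilinear form. -/
structure IsInnerForm {W : Type*} [AddCommGroup W] [Module ℝ W] (B : W →ₗ[ℝ] W →ₗ[ℝ] ℝ) :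
    Prop where
  symm : ∀ x y, B x y = B y x
  pos : ∀ x, x ≠ 0 → 0 < B x x

theorem IsInnerForm.eq_zero {W : Type*} [AddCommGroup W] [Module ℝ W]
    {B : W →ₗ[ℝ] W →ₗ[ℝ] ℝ} (hB : IsInnerForm B) {x : W} (h : B x x = 0) : x = 0 := by
  by_contra hx
  exact (hB.pos x hx).ne' h

theorem IsInnerForm.nonneg {W : Type*} [AddCommGroup W] [Module ℝ W]
    {B : W →ₗ[ℝ] W →ₗ[ℝ] ℝ} (hB : IsInnerForm B) (x : W) : 0 ≤ B x x := by
  by_cases hx : x = 0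
  · simp [hx]
  · exact (hB.pos x hx).le

theorem IsInnerForm.exists_orthonormal_basis {W : Type*} [AddCommGroup W] [Module ℝ W]
    [FiniteDimensional ℝ W] {B : W →ₗ[ℝ] W →ₗ[ℝ] ℝ} (hB : IsInnerForm B) :
    ∃ e : Module.Basis (Fin (Module.finrank ℝ W)) ℝ W,
      ∀ i j, B (e i) (e j) = if i = j then 1 else 0 := by
  let c : InnerProductSpace.Core ℝ W :=
    { inner := fun x y => B x y
      conj_inner_symm := fun x y => by simp [hB.symm x y]
      re_inner_nonneg := fun x => by simpa using hB.nonneg x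
      add_left := fun x y z => by simp
      smul_left := fun x y r => by simp
      definite := fun x h => hB.eq_zero h }
  let _ : NormedAddCommGroup W := c.toNormedAddCommGroup
  let _ : InnerProductSpace ℝ W := InnerProductSpace.ofCore c.toCore
  exact ⟨(stdOrthonormalBasis ℝ W).toBasis, fun i j => by
    have h := orthonormal_iff_ite.1 (stdOrthonormalBasis ℝ W).orthonormal i j
    rw [OrthonormalBasis.coe_toBasis]
    exact h⟩

theorem IsInnerForm.sum_repr {W : Type*} [AddCommGroup W] [Module ℝ W] {n : Type*} [Fintype n]
    [DecidableEq n] {B : W →ₗ[ℝ] W →ₗ[ℝ] ℝ} {e : Module.Basis n ℝ W}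
    (he : ∀ i j, B (e i) (e j) = if i = j then 1 else 0) (x : W) :
    ∑ i, B x (e i) • e i = x := by
  have h : ∀ i, B x (e i) = e.repr x i := by
    intro i
    conv_lhs => rw [← e.sum_repr x]
    simp [he, -Module.Basis.sum_repr]
  simp only [h]
  exact e.sum_repr x

variable {H : Type*} [TopologicalSpace H] [Group H] [IsTopologicalGroup H] [CompactSpace H]
  {W : Type*} [NormedAddCommGroup W] [NormedSpace ℝ W] [FiniteDimensional ℝ W]

theorem exists_isInnerForm (W : Type*) [AddCommGroup W] [Module ℝ W] [FiniteDimensional ℝ W] :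
    ∃ B : W →ₗ[ℝ] W →ₗ[ℝ] ℝ, IsInnerForm B := by
  let b := Module.finBasis ℝ W
  refine ⟨∑ i, (LinearMap.mul ℝ ℝ).compl₁₂ (b.coord i) (b.coord i), ⟨fun x y => ?_, fun x hx => ?_⟩⟩
  · simp [mul_comm]
  · simp only [LinearMap.sum_apply, LinearMap.compl₁₂_apply, LinearMap.mul_apply']
    refine lt_of_le_of_ne (Finset.sum_nonneg fun i _ => mul_self_nonneg _) fun h => hx ?_
    have h' := (Finset.sum_eq_zero_iff_of_nonneg fun i _ => mul_self_nonneg _).1 h.symm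
    exact b.forall_coord_eq_zero_iff.1 fun i => mul_self_eq_zero.1 (h' i (Finset.mem_univ i))

theorem LinearMap.continuous_apply_apply (B : W →ₗ[ℝ] W →ₗ[ℝ] ℝ) {Y : Type*} [TopologicalSpace Y]
    {u v : Y → W} (hu : Continuous u) (hv : Continuous v) : Continuous fun y => B (u y) (v y) := by
  let B' : W →L[ℝ] W →L[ℝ] ℝ :=
    (LinearMap.toContinuousLinearMap.toLinearMap ∘ₗ B).toContinuousLinearMap
  have : Continuous fun y => B' (u y) (v y) := by fun_prop
  exact this

theorem exists_invariant_isInnerForm (τ : H →* (W →L[ℝ] W)) (hτ : Continuous τ) :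
    ∃ B : W →ₗ[ℝ] W →ₗ[ℝ] ℝ, IsInnerForm B ∧ ∀ h x y, B (τ h x) (τ h y) = B x y := by
  borelize H
  obtain ⟨μ, _, _⟩ := exists_isHaarMeasure_isProbabilityMeasure H
  obtain ⟨B₀, hB₀⟩ := exists_isInnerForm W
  have hc : ∀ x y, Continuous fun h : H => B₀ (τ h⁻¹ x) (τ h⁻¹ y) := fun x y =>
    B₀.continuous_apply_apply (by fun_prop) (by fun_prop)
  have hi := fun x y => integrable_of_continuous μ (hc x y)
  refine ⟨LinearMap.mk₂ ℝ (fun x y => ∫ h, B₀ (τ h⁻¹ x) (τ h⁻¹ y) ∂μ) ?_ ?_ ?_ ?_, ⟨?_, ?_⟩, ?_⟩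
  · intro x x' y
    rw [← integral_add (hi _ _) (hi _ _)]
    simp
  · intro c x y
    rw [smul_eq_mul, ← integral_const_mul]
    simp
  · intro x y y'
    rw [← integral_add (hi _ _) (hi _ _)]
    simp
  · intro c x y
    rw [smul_eq_mul, ← integral_const_mul]
    simp
  · intro x y
    simp only [LinearMap.mk₂_apply, hB₀.symm]
  · intro x hx
    refine (hc x x).integral_pos_of_hasCompactSupport_nonneg_nonzero
      (HasCompactSupport.of_compactSpace _) (fun h => hB₀.nonneg _) (x := 1) ?_
    simpa using (hB₀.pos x hx).ne'
  · intro k x y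
    simp only [LinearMap.mk₂_apply]
    -- The inverse in `τ h⁻¹` turns invariance of the form into left invariance of Haar measure:
    -- (k⁻¹ h)⁻¹ = h⁻¹ k.
    rw [← integral_mul_left_eq_self (fun h => B₀ (τ h⁻¹ x) (τ h⁻¹ y)) k⁻¹]
    simp

end InvariantForm

/-! ### Equivariant maps -/

section Equivariant

open MeasureTheory

variable {G : Type*} [TopologicalSpace G] [Group G] [IsTopologicalGroup G]
  {H : Type*} [Group H]
  {W : Type*} [NormedAddCommGroup W] [NormedSpace ℝ W]

/-- The continuous maps `f` from `G` to a representation of `H` with `f (g h⁻¹) = h f(g)`. -/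
def equivariantMaps (ι : H →* G) (τ : H →* (W →L[ℝ] W)) : Submodule ℝ C(G, W) where
  carrier := {f | ∀ g h, f (g * (ι h)⁻¹) = τ h (f g)}
  add_mem' := by
    intro a b ha hb g h
    rw [ContinuousMap.add_apply, ha, hb, ContinuousMap.add_apply, map_add]
  zero_mem' := fun g h => by simp
  smul_mem' := by
    intro c a ha g h
    rw [ContinuousMap.smul_apply, ha, ContinuousMap.smul_apply, map_smul]

variable {ι : H →* G} {τ : H →* (W →L[ℝ] W)}

theorem isLeftInvariant_equivariantMaps : IsLeftInvariant (equivariantMaps ι τ) := by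
  intro x f hf g h
  rw [leftTranslate_apply, leftTranslate_apply, ← mul_assoc]
  exact hf _ _

theorem IsLeftInvariant.inf {𝒲 𝒲' : Submodule ℝ C(G, W)} (h : IsLeftInvariant 𝒲)
    (h' : IsLeftInvariant 𝒲') : IsLeftInvariant (𝒲 ⊓ 𝒲') :=
  fun x f hf => ⟨h x f hf.1, h' x f hf.2⟩

theorem IsLeftInvariant.iSup {κ : Sort*} {𝒲 : κ → Submodule ℝ C(G, W)}
    (h : ∀ i, IsLeftInvariant (𝒲 i)) : IsLeftInvariant (⨆ i, 𝒲 i) := by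
  intro x f hf
  refine Submodule.iSup_induction (motive := fun f => leftTranslate x f ∈ ⨆ i, 𝒲 i) _ hf
    (fun i f hf => Submodule.mem_iSup_of_mem i (h i x f hf)) (by simp) fun f g hf hg => ?_
  rw [map_add]
  exact Submodule.add_mem _ hf hg

theorem map_mem_leftFinite {W' : Type*} [NormedAddCommGroup W'] [NormedSpace ℝ W']
    (L : C(G, W) →ₗ[ℝ] C(G, W')) (hL : ∀ x f, L (leftTranslate x f) = leftTranslate x (L f))
    {f : C(G, W)} (hf : f ∈ leftFinite G W) : L f ∈ leftFinite G W' := by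
  obtain ⟨𝒲, h1, h2, h3⟩ := hf
  exact ⟨𝒲.map L, inferInstance, h2.map L hL, Submodule.mem_map_of_mem h3⟩

theorem dense_leftFinite [CompactSpace G] [T2Space G] [FiniteDimensional ℝ W] :
    Dense (leftFinite G W : Set C(G, W)) := by
  have hℝ : Dense (leftFinite G ℝ : Set C(G, ℝ)) := fun f =>
    Metric.mem_closure_iff.2 fun ε hε => by
      obtain ⟨r, hr, h⟩ := exists_mem_leftFinite_norm_sub_lt f hε
      exact ⟨r, hr, by rwa [dist_eq_norm]⟩
  intro f
  let b := Module.finBasis ℝ W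
  let M : W → C(G, ℝ) →L[ℝ] C(G, W) := fun w =>
    (ContinuousLinearMap.toSpanSingleton ℝ w).compLeftContinuous ℝ G
  have hM : ∀ w, ∀ r : C(G, ℝ), M w r ∈ (leftFinite G W).topologicalClosure := by
    intro w r
    refine map_mem_closure (M w).continuous (hℝ r) fun s hs => ?_
    exact map_mem_leftFinite (M w).toLinearMap (fun x f => rfl) hs
  let c : Fin _ → C(G, ℝ) := fun i =>
    ⟨fun g => b.coord i (f g), (LinearMap.continuous_of_finiteDimensional _).comp f.continuous⟩
  have hf : f = ∑ i, M (b i) (c i) := by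
    ext g
    rw [ContinuousMap.sum_apply]
    exact (b.sum_repr (f g)).symm
  rw [hf]
  exact (leftFinite G W).topologicalClosure.sum_mem fun i _ => hM _ _

variable [TopologicalSpace H]

/-- The function `g ↦ h f(g h)`. -/
def twist (ι : H →* G) (τ : H →* (W →L[ℝ] W)) (h : H) : C(G, W) →ₗ[ℝ] C(G, W) where
  toFun f := ⟨fun g => τ h (f (g * ι h)), by fun_prop⟩
  map_add' a b := by ext; simp
  map_smul' c a := by ext; simp

theorem continuous_twist (hι : Continuous ι) (hτ : Continuous τ) (f : C(G, W)) :
    Continuous fun h => twist ι τ h f :=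
  ContinuousMap.continuous_of_continuous_uncurry _ (by
    have h1 : Continuous fun p : H × G => τ p.1 := hτ.comp continuous_fst
    have h2 : Continuous fun p : H × G => f (p.2 * ι p.1) := by fun_prop
    exact h1.clm_apply h2)

variable [CompactSpace H] [CompactSpace G] [MeasurableSpace H] [BorelSpace H]

/-- The mean of `twist ι τ h f` over `h`. -/
noncomputable def equivariantMean (μ : Measure H) (ι : H →* G) (τ : H →* (W →L[ℝ] W))
    (f : C(G, W)) : C(G, W) := ∫ h, twist ι τ h f ∂μ

variable {μ : Measure H} [μ.IsHaarMeasure] [FiniteDimensional ℝ W] [IsTopologicalGroup H]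

theorem equivariantMean_apply (hι : Continuous ι) (hτ : Continuous τ) (f : C(G, W)) (g : G) :
    equivariantMean μ ι τ f g = ∫ h, τ h (f (g * ι h)) ∂μ := by
  have := (ContinuousMap.evalCLM ℝ g : C(G, W) →L[ℝ] W).integral_comp_comm
    (integrable_of_continuous μ (continuous_twist hι hτ f))
  exact this.symm

theorem equivariantMean_mem (hι : Continuous ι) (hτ : Continuous τ) (f : C(G, W)) :
    equivariantMean μ ι τ f ∈ equivariantMaps ι τ := by
  intro g k
  rw [equivariantMean_apply hι hτ, equivariantMean_apply hι hτ, ← (τ k).integral_comp_comm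
    (integrable_of_continuous μ ((hτ.clm_apply (by fun_prop)))),
    ← integral_mul_left_eq_self _ k]
  refine integral_congr_ae (Filter.Eventually.of_forall fun h => ?_)
  simp only [map_mul]
  rw [mul_apply_eq_comp]
  congr 3
  group

theorem equivariantMean_of_mem [IsProbabilityMeasure μ] (hι : Continuous ι) (hτ : Continuous τ)
    {f : C(G, W)} (hf : f ∈ equivariantMaps ι τ) : equivariantMean μ ι τ f = f := by
  ext g
  rw [equivariantMean_apply hι hτ]
  have : ∀ h, τ h (f (g * ι h)) = f g := fun h => by
    rw [← hf]
    simp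
  simp [this]

variable (μ) in
/-- `equivariantMean` as a linear map. -/
noncomputable def equivariantMeanₗ (hι : Continuous ι) (hτ : Continuous τ) :
    C(G, W) →ₗ[ℝ] C(G, W) where
  toFun := equivariantMean μ ι τ
  map_add' a b := by
    rw [equivariantMean, equivariantMean, equivariantMean, ← integral_add
      (integrable_of_continuous μ (continuous_twist hι hτ a))
      (integrable_of_continuous μ (continuous_twist hι hτ b))]
    simp
  map_smul' c a := by
    rw [equivariantMean, equivariantMean, RingHom.id_apply, ← integral_smul]
    simp

theorem continuous_equivariantMean [IsProbabilityMeasure μ] (hι : Continuous ι)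
    (hτ : Continuous τ) : Continuous (equivariantMean μ ι τ : C(G, W) → C(G, W)) := by
  obtain ⟨C, hC⟩ := (isCompact_range hτ).isBounded.exists_norm_le
  have hC' : ∀ h, ‖τ h‖ ≤ C := fun h => hC _ ⟨h, rfl⟩
  have hC0 : 0 ≤ C := (norm_nonneg _).trans (hC' 1)
  refine AddMonoidHomClass.continuous_of_bound (equivariantMeanₗ μ hι hτ) C fun f => ?_
  refine (norm_integral_le_of_norm_le_const (C := C * ‖f‖)
    (Filter.Eventually.of_forall fun h => ?_)).trans (by simp)
  rw [ContinuousMap.norm_le _ (by positivity)]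
  intro g
  exact (τ h).le_of_opNorm_le_of_le (hC' h) (f.norm_coe_le_norm _)

end Equivariant

/-- Averaging over `H` is continuous and fixes `f`. It acts from the right, so it commutes with left
translations and preserves left-finiteness; applied to left-finite approximants it yields
equivariant ones. -/
theorem equivariantMaps_le_closure {G : Type*} [TopologicalSpace G] [Group G]
    [IsTopologicalGroup G] [CompactSpace G] [T2Space G]
    {H : Type*} [TopologicalSpace H] [Group H] [IsTopologicalGroup H] [CompactSpace H]
    {W : Type*} [NormedAddCommGroup W] [NormedSpace ℝ W] [FiniteDimensional ℝ W]
    {ι : H →* G} {τ : H →* (W →L[ℝ] W)} (hι : Continuous ι) (hτ : Continuous τ)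
    {f : C(G, W)} (hf : f ∈ equivariantMaps ι τ) :
    f ∈ closure ((equivariantMaps ι τ ⊓ leftFinite G W : Submodule ℝ C(G, W)) : Set C(G, W)) := by
  borelize H
  obtain ⟨μ, _, _⟩ := exists_isHaarMeasure_isProbabilityMeasure H
  rw [← equivariantMean_of_mem (μ := μ) hι hτ hf]
  refine map_mem_closure (continuous_equivariantMean hι hτ) (dense_leftFinite f) fun r hr =>
    ⟨equivariantMean_mem hι hτ r, ?_⟩
  refine map_mem_leftFinite (equivariantMeanₗ μ hι hτ) (fun x r => ?_) hr
  ext g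
  change equivariantMean μ ι τ _ g = equivariantMean μ ι τ r (x * g)
  rw [equivariantMean_apply hι hτ, equivariantMean_apply hι hτ]
  simp [mul_assoc]

theorem exists_leftInvariant_of_mem_inf {G : Type*} [TopologicalSpace G] [Group G]
    [IsTopologicalGroup G] {H : Type*} [Group H]
    {W : Type*} [NormedAddCommGroup W] [NormedSpace ℝ W]
    {ι : H →* G} {τ : H →* (W →L[ℝ] W)} {f : C(G, W)}
    (hf : f ∈ equivariantMaps ι τ ⊓ leftFinite G W) :
    ∃ 𝒲 ≤ equivariantMaps ι τ, FiniteDimensional ℝ 𝒲 ∧ IsLeftInvariant 𝒲 ∧ f ∈ 𝒲 := by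
  obtain ⟨hf, 𝒲, h1, h2, h3⟩ := hf
  exact ⟨𝒲 ⊓ equivariantMaps ι τ, inf_le_right, inferInstance,
    h2.inf isLeftInvariant_equivariantMaps, h3, hf⟩

/-! ### Equivariant frames -/

section Frame

open MeasureTheory

variable {G : Type*} [TopologicalSpace G] [Group G] [IsTopologicalGroup G] [CompactSpace G]
  [T2Space G] {H : Type*} [TopologicalSpace H] [Group H] [IsTopologicalGroup H] [CompactSpace H]
  {W : Type*} [NormedAddCommGroup W] [NormedSpace ℝ W] [FiniteDimensional ℝ W]
  {ι : H →* G} {τ : H →* (W →L[ℝ] W)}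

/-- Equivariance prescribes the values τ(h)⁻¹ v on the closed image of `H`. A Tietze extension is
then averaged; at 1 the average is over the constant `v`. -/
theorem exists_mem_equivariantMaps_apply_one_eq (hι : Continuous ι)
    (hinj : Function.Injective ι) (hτ : Continuous τ) (v : W) :
    ∃ f ∈ equivariantMaps ι τ, f 1 = v := by
  borelize H
  obtain ⟨μ, _, _⟩ := exists_isHaarMeasure_isProbabilityMeasure H
  have : T2Space H := T2Space.of_injective_continuous hinj hι
  obtain ⟨f, hf⟩ := ContinuousMap.exists_extension' (hι.isClosedEmbedding hinj)
    (⟨fun h => τ h⁻¹ v, by fun_prop⟩ : C(H, W))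
  refine ⟨_, equivariantMean_mem (μ := μ) hι hτ f, ?_⟩
  rw [equivariantMean_apply hι hτ]
  have h1 : ∀ h, τ h (f (1 * ι h)) = v := fun h => by
    rw [one_mul]
    have h2 : f (ι h) = τ h⁻¹ v := congrFun hf h
    rw [h2, ← mul_apply_eq_comp, ← map_mul]
    simp
  simp only [h1]
  simp

/-- The values at 1 of left-finite equivariant maps form a subspace of the finite-dimensional `W`.
Such a subspace is closed, so approximating `v` suffices to attain it. -/
theorem exists_leftFinite_apply_one_eq (hι : Continuous ι)
    (hinj : Function.Injective ι) (hτ : Continuous τ) (v : W) :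
    ∃ f ∈ equivariantMaps ι τ ⊓ leftFinite G W, f 1 = v := by
  obtain ⟨f, hf, hfv⟩ := exists_mem_equivariantMaps_apply_one_eq hι hinj hτ v
  let ev : C(G, W) →L[ℝ] W := ContinuousMap.evalCLM ℝ 1
  have h := map_mem_closure (t := ((equivariantMaps ι τ ⊓ leftFinite G W).map
    ev.toLinearMap : Set W)) ev.continuous (equivariantMaps_le_closure hι hτ hf)
    fun r hr => ⟨r, hr, rfl⟩
  have := FiniteDimensional.finiteDimensional_submodule
    ((equivariantMaps ι τ ⊓ leftFinite G W).map ev.toLinearMap)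
  rw [(Submodule.closed_of_finiteDimensional _).closure_eq] at h
  obtain ⟨r, hr, hrv⟩ := h
  exact ⟨r, hr, hrv.trans hfv⟩

/-- A Urysohn function that is 0 on the image of `H` and 1 on its coset by `g` averages to an
invariant function with values 0 and 1; equality of the values at `g` and 1 would pass to the
closure and contradict this. -/
theorem exists_leftFinite_apply_ne (hι : Continuous ι) {g : G} (hg : g ∉ ι.range) :
    ∃ a ∈ equivariantMaps ι (1 : H →* (ℝ →L[ℝ] ℝ)) ⊓ leftFinite G ℝ, a g ≠ a 1 := by
  borelize H
  obtain ⟨μ, _, _⟩ := exists_isHaarMeasure_isProbabilityMeasure H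
  by_contra! hcon
  have hc1 : IsClosed (Set.range ι) := (isCompact_range hι).isClosed
  have hc2 : IsClosed (Set.range fun h => g * ι h) :=
    (isCompact_range (continuous_const.mul hι)).isClosed
  obtain ⟨χ, hχ0, hχ1, -⟩ := exists_continuous_zero_one_of_isClosed hc1 hc2 (by
    rw [Set.disjoint_left]
    rintro _ ⟨h, rfl⟩ ⟨k, hk⟩
    refine hg ⟨h * k⁻¹, ?_⟩
    rw [map_mul, ← hk]
    simp)
  have h1 : Continuous (1 : H →* (ℝ →L[ℝ] ℝ)) := continuous_const
  have hcl : IsClosed {f : C(G, ℝ) | f g = f 1} :=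
    isClosed_eq (continuous_eval_const g) (continuous_eval_const 1)
  have h := hcl.closure_subset_iff.2 (fun r hr => hcon r hr)
    (equivariantMaps_le_closure hι h1 (equivariantMean_mem (μ := μ) hι h1 χ))
  simp only [Set.mem_ofPred_eq, equivariantMean_apply hι h1] at h
  have e0 : ∀ h, χ (ι h) = 0 := fun h => hχ0 ⟨h, rfl⟩
  have e1 : ∀ h, χ (g * ι h) = 1 := fun h => hχ1 ⟨h, rfl⟩
  simp [e0, e1] at h

theorem exists_leftInvariant_map_eval_eq_top (hι : Continuous ι)
    (hinj : Function.Injective ι) (hτ : Continuous τ) :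
    ∃ 𝒲 ≤ equivariantMaps ι τ, FiniteDimensional ℝ 𝒲 ∧ IsLeftInvariant 𝒲 ∧
      ∀ v, ∃ f ∈ 𝒲, f 1 = v := by
  let b := Module.finBasis ℝ W
  choose f hf hfb using fun i => exists_leftFinite_apply_one_eq hι hinj hτ (b i)
  choose 𝒲 h1 h2 h3 h4 using fun i => exists_leftInvariant_of_mem_inf (hf i)
  refine ⟨⨆ i, 𝒲 i, iSup_le h1, inferInstance, IsLeftInvariant.iSup h3, fun v => ?_⟩
  refine ⟨∑ i, b.repr v i • f i, Submodule.sum_mem _ fun i _ => Submodule.smul_mem _ _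
    (Submodule.mem_iSup_of_mem i (h4 i)), ?_⟩
  rw [ContinuousMap.sum_apply]
  simp only [ContinuousMap.smul_apply, hfb]
  exact b.sum_repr v

/-- The `L²` inner product of continuous functions. -/
theorem exists_leftInvariant_isInnerForm (B : W →ₗ[ℝ] W →ₗ[ℝ] ℝ) (hB : IsInnerForm B) :
    ∃ L : C(G, W) →ₗ[ℝ] C(G, W) →ₗ[ℝ] ℝ, IsInnerForm L ∧
      ∀ x f f', L (leftTranslate x f) (leftTranslate x f') = L f f' := by
  borelize G
  obtain ⟨μ, _, _⟩ := exists_isHaarMeasure_isProbabilityMeasure G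
  have hc : ∀ f f' : C(G, W), Continuous fun g => B (f g) (f' g) := fun f f' =>
    B.continuous_apply_apply f.continuous f'.continuous
  have hi := fun f f' => integrable_of_continuous μ (hc f f')
  refine ⟨LinearMap.mk₂ ℝ (fun f f' => ∫ g, B (f g) (f' g) ∂μ) ?_ ?_ ?_ ?_, ⟨?_, ?_⟩, ?_⟩
  · intro x x' y
    rw [← integral_add (hi _ _) (hi _ _)]
    simp
  · intro c x y
    rw [smul_eq_mul, ← integral_const_mul]
    simp
  · intro x y y'
    rw [← integral_add (hi _ _) (hi _ _)]
    simp
  · intro c x y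
    rw [smul_eq_mul, ← integral_const_mul]
    simp
  · intro x y
    simp only [LinearMap.mk₂_apply, hB.symm]
  · intro f hf
    obtain ⟨g, hg⟩ : ∃ g, f g ≠ 0 := by
      by_contra! h
      exact hf (ContinuousMap.ext h)
    exact (hc f f).integral_pos_of_hasCompactSupport_nonneg_nonzero
      (HasCompactSupport.of_compactSpace _) (fun h => hB.nonneg _) (x := g) (hB.pos _ hg).ne'
  · intro x f f'
    simp only [LinearMap.mk₂_apply, leftTranslate_apply]
    exact integral_mul_left_eq_self (fun g => B (f g) (f' g)) x

/-- An equivariant frame: every `v` is the combination of the vectors `S (f j g)` with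
coefficients `B v (f j g)`. -/
theorem exists_equivariant_frame (hι : Continuous ι) (hinj : Function.Injective ι)
    (hτ : Continuous τ) {B : W →ₗ[ℝ] W →ₗ[ℝ] ℝ} (hB : IsInnerForm B)
    (hBτ : ∀ h x y, B (τ h x) (τ h y) = B x y) :
    ∃ (m : ℕ) (f : Fin m → C(G, W)) (S : W →ₗ[ℝ] W),
      (∀ j, f j ∈ equivariantMaps ι τ) ∧ IsLeftInvariant (Submodule.span ℝ (Set.range f)) ∧
      (∀ h v, S (τ h v) = τ h (S v)) ∧ ∀ g v, ∑ j, B v (f j g) • S (f j g) = v := by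
  obtain ⟨𝒲, h𝒲, hfd, hinv, hev⟩ := exists_leftInvariant_map_eval_eq_top hι hinj hτ
  obtain ⟨L, hL, hLinv⟩ := exists_leftInvariant_isInnerForm (G := G) B hB
  have hL' : IsInnerForm (L.domRestrict₁₂ 𝒲 𝒲) :=
    ⟨fun x y => hL.symm x y, fun x hx => hL.pos x fun h => hx (Subtype.ext h)⟩
  obtain ⟨e, he⟩ := hL'.exists_orthonormal_basis
  have hsum : ∀ f ∈ 𝒲, ∑ j, L f (e j) • (e j : C(G, W)) = f := by
    intro f hf
    have h := congrArg Subtype.val (IsInnerForm.sum_repr he ⟨f, hf⟩)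
    rwa [AddSubmonoidClass.coe_finsetSum] at h
  -- `R g v` is the Riesz representative, within `𝒲` and for the L² product, of the functional f ↦ B
  -- v (f g).
  let R : G → W →ₗ[ℝ] C(G, W) := fun g =>
    ∑ j, (B.flip ((e j : C(G, W)) g)).smulRight (e j : C(G, W))
  have hR : ∀ g v, R g v = ∑ j, B v ((e j : C(G, W)) g) • (e j : C(G, W)) := fun g v => by
    simp [R]
  have hRmem : ∀ g v, R g v ∈ 𝒲 := fun g v => by
    rw [hR]
    exact Submodule.sum_mem _ fun j _ => Submodule.smul_mem _ _ (e j).2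
  have hRL : ∀ g v, ∀ f ∈ 𝒲, L (R g v) f = B v (f g) := by
    intro g v f hf
    conv_rhs => rw [← hsum f hf]
    rw [hR, ContinuousMap.sum_apply]
    simp only [map_sum, map_smul, LinearMap.sum_apply, LinearMap.smul_apply,
      ContinuousMap.smul_apply, smul_eq_mul]
    exact Finset.sum_congr rfl fun j _ => by rw [hL.symm, mul_comm]
  have hRuniq : ∀ g v, ∀ r ∈ 𝒲, (∀ f ∈ 𝒲, L r f = B v (f g)) → r = R g v := by
    intro g v r hr h
    refine sub_eq_zero.1 (hL.eq_zero ?_)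
    have hd : r - R g v ∈ 𝒲 := Submodule.sub_mem _ hr (hRmem g v)
    rw [LinearMap.map_sub₂, h _ hd, hRL g v _ hd, sub_self]
  -- Translating by `g` carries `R g v` to `R 1 v`, by uniqueness of the representative. This is why
  -- the frame operator `S₀` does not depend on the point of `G`.
  have hRx : ∀ g v, R g v g = R 1 v 1 := by
    intro g v
    have h : leftTranslate g (R g v) = R 1 v := by
      refine hRuniq 1 v _ (hinv _ _ (hRmem g v)) fun f hf => ?_
      have e1 : f = leftTranslate g (leftTranslate g⁻¹ f) := by
        ext x
        simp
      conv_lhs => rw [e1]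
      rw [hLinv, hRL g v _ (hinv _ _ hf)]
      simp
    rw [← h]
    simp
  let S₀ : W →ₗ[ℝ] W := (ContinuousMap.evalCLM ℝ (1 : G)).toLinearMap ∘ₗ R 1
  have hS₀ : ∀ g v, S₀ v = ∑ j, B v ((e j : C(G, W)) g) • (e j : C(G, W)) g := by
    intro g v
    have h : S₀ v = R g v g := (hRx g v).symm
    rw [h, hR, ContinuousMap.sum_apply]
    rfl
  -- B(v, S₀ v) is the sum of the squares B(v, e_j(1))², so `v` in the kernel is orthogonal to all
  -- values at 1 of `𝒲`, which exhaust `W`. The required `S` is the inverse of `S₀`.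
  have hS₀inj : Function.Injective S₀ := by
    rw [← LinearMap.ker_eq_bot, LinearMap.ker_eq_bot']
    intro v hv
    have h1 : ∑ j, B v ((e j : C(G, W)) 1) * B v ((e j : C(G, W)) 1) = 0 := by
      have := congrArg (B v) (hS₀ 1 v)
      rw [hv, map_zero, map_sum] at this
      simpa using this.symm
    have h2 := (Finset.sum_eq_zero_iff_of_nonneg fun j _ => mul_self_nonneg _).1 h1
    have h3 : ∀ f ∈ 𝒲, B v (f 1) = 0 := by
      intro f hf
      rw [← hsum f hf, ContinuousMap.sum_apply, map_sum]
      refine Finset.sum_eq_zero fun j _ => ?_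
      rw [ContinuousMap.smul_apply, map_smul, mul_self_eq_zero.1 (h2 j (Finset.mem_univ j)),
        smul_zero]
    obtain ⟨f, hf, hfv⟩ := hev v
    exact hB.eq_zero (by rw [← h3 f hf, hfv])
  have hS₀τ : ∀ h v, S₀ (τ h v) = τ h (S₀ v) := by
    intro h v
    rw [hS₀ (1 * (ι h)⁻¹) (τ h v), hS₀ 1 v, map_sum]
    refine Finset.sum_congr rfl fun j _ => ?_
    rw [h𝒲 (e j).2 1 h, hBτ, map_smul]
  let S₁ := LinearEquiv.ofInjectiveEndo S₀ hS₀inj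
  have hS₁ : ∀ v, S₁ v = S₀ v := fun v => rfl
  refine ⟨_, fun j => e j, S₁.symm.toLinearMap, fun j => h𝒲 (e j).2, ?_, fun h v => ?_,
    fun g v => ?_⟩
  · have : Submodule.span ℝ (Set.range fun j => (e j : C(G, W))) = 𝒲 := by
      refine le_antisymm (Submodule.span_le.2 ?_) fun f hf => ?_
      · rintro _ ⟨j, rfl⟩
        exact (e j).2
      · rw [← hsum f hf]
        exact Submodule.sum_mem _ fun j _ => Submodule.smul_mem _ _
          (Submodule.subset_span ⟨j, rfl⟩)
    rw [this]
    exact hinv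
  · apply S₁.injective
    change S₁ (S₁.symm _) = S₀ _
    rw [hS₀τ, ← hS₁ (S₁.symm.toLinearMap v)]
    simp
  · apply S₁.injective
    rw [hS₁ v, hS₀ g v, map_sum]
    simp

end Frame

/-! ### Smoothness of parametric integrals -/

section Smooth

open MeasureTheory

variable {E : Type*} [NormedAddCommGroup E] [NormedSpace ℝ E]
  {G : Type*} [TopologicalSpace G] [ChartedSpace E G]
  {W : Type*} [NormedAddCommGroup W] [NormedSpace ℝ W]

theorem contMDiffOn_partial_fderiv [IsManifold 𝓘(ℝ, E) ∞ G] {θ : E × G → ℝ} {U : Set E}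
    (hU : IsOpen U)
    (hθ : ContMDiffOn (𝓘(ℝ, E).prod 𝓘(ℝ, E)) 𝓘(ℝ, ℝ) ∞ θ (U ×ˢ Set.univ)) :
    ContMDiffOn (𝓘(ℝ, E).prod 𝓘(ℝ, E)) 𝓘(ℝ, E →L[ℝ] ℝ) ∞
      (fun p : E × G => fderiv ℝ (fun u => θ (u, p.2)) p.1) (U ×ˢ Set.univ) := by
  rintro ⟨u₀, z₀⟩ ⟨hu₀, -⟩
  have h1 : ContMDiffAt (𝓘(ℝ, E).prod 𝓘(ℝ, E)) 𝓘(ℝ, ℝ) ∞ θ (u₀, z₀) :=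
    hθ.contMDiffAt ((hU.prod isOpen_univ).mem_nhds ⟨hu₀, Set.mem_univ _⟩)
  have h2 : ContMDiffAt ((𝓘(ℝ, E).prod 𝓘(ℝ, E)).prod 𝓘(ℝ, E)) 𝓘(ℝ, ℝ) ∞
      (Function.uncurry fun (p : E × G) (u : E) => θ (u, p.2)) ((u₀, z₀), u₀) :=
    ContMDiffAt.comp (g := θ) (f := fun q : (E × G) × E => (q.2, q.1.2)) ((u₀, z₀), u₀) h1
      (contMDiffAt_snd.prodMk (contMDiffAt_snd.comp _ contMDiffAt_fst))
  have h3 := ContMDiffAt.mfderiv (m := ∞) (n := ∞) (fun (p : E × G) (u : E) => θ (u, p.2)) Prod.fst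
    h2 contMDiffAt_fst le_rfl
  have e := inTangentCoordinates_model_space (I := 𝓘(ℝ, E)) (I' := 𝓘(ℝ, ℝ))
    (Prod.fst : E × G → E) (fun p : E × G => θ p) (fun p : E × G =>
      (mfderiv 𝓘(ℝ, E) 𝓘(ℝ, ℝ) (fun u => θ (u, p.2)) p.1 : E →L[ℝ] ℝ)) (u₀, z₀)
  refine (h3.congr_of_eventuallyEq (Filter.Eventually.of_forall fun p => ?_)).contMDiffWithinAt
  rw [← mfderiv_eq_fderiv]
  exact (congrFun e p).symm

variable [FiniteDimensional ℝ E] [CompactSpace G] [MeasurableSpace G] [BorelSpace G]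
  (μ : Measure G) [IsFiniteMeasureOnCompacts μ]

/-- Differentiation under the integral. The dominating constant comes from compactness of `G`: a
bound on the partial derivative at `u₀` persists, up to 1, on a neighbourhood uniformly in `z`. -/
theorem hasFDerivAt_integral_smul [IsManifold 𝓘(ℝ, E) ∞ G] {θ : E × G → ℝ} {U : Set E}
    (hU : IsOpen U)
    (hθ : ContMDiffOn (𝓘(ℝ, E).prod 𝓘(ℝ, E)) 𝓘(ℝ, ℝ) ∞ θ (U ×ˢ Set.univ))
    (F : C(G, W)) {u₀ : E} (hu₀ : u₀ ∈ U) :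
    ∃ L : E →L[ℝ] W, HasFDerivAt (fun u => ∫ z, θ (u, z) • F z ∂μ) L u₀ ∧
      ∀ v, L v = ∫ z, fderiv ℝ (fun u => θ (u, z)) u₀ v • F z ∂μ := by
  let D : E × G → E →L[ℝ] ℝ := fun p => fderiv ℝ (fun u => θ (u, p.2)) p.1
  have hD : ContinuousOn D (U ×ˢ Set.univ) := (contMDiffOn_partial_fderiv hU hθ).continuousOn
  have hUz : ∀ u ∈ U, ∀ z : G, U ×ˢ (Set.univ : Set G) ∈ 𝓝 (u, z) := fun u hu z =>
    (hU.prod isOpen_univ).mem_nhds ⟨hu, Set.mem_univ _⟩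
  have hθc : ∀ u ∈ U, Continuous fun z => θ (u, z) := fun u hu =>
    hθ.continuousOn.comp_continuous (by fun_prop) fun z => ⟨hu, Set.mem_univ _⟩
  have hDc : ∀ u ∈ U, Continuous fun z => D (u, z) := fun u hu =>
    hD.comp_continuous (by fun_prop) fun z => ⟨hu, Set.mem_univ _⟩
  obtain ⟨C, hC⟩ := (isCompact_range (hDc u₀ hu₀)).isBounded.exists_norm_le
  have hev : ∀ᶠ u in 𝓝 u₀, ∀ z ∈ (Set.univ : Set G), ‖D (u, z)‖ < C + 1 := by
    refine isCompact_univ.eventually_forall_of_forall_eventually fun z _ => ?_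
    refine ((hD.continuousAt (hUz u₀ hu₀ z)).norm.eventually_lt_const ?_)
    exact (hC _ ⟨z, rfl⟩).trans_lt (lt_add_one C)
  let s := {u | (∀ z : G, ‖D (u, z)‖ < C + 1)} ∩ U
  have hs : s ∈ 𝓝 u₀ := Filter.inter_mem (hev.mono fun u hu z => hu z (Set.mem_univ z)) (hU.mem_nhds hu₀)
  have hmain := hasFDerivAt_integral_of_dominated_of_fderiv_le (μ := μ) (𝕜 := ℝ)
    (F := fun u z => θ (u, z) • F z) (F' := fun u z => (D (u, z)).smulRight (F z))
    (bound := fun _ => (C + 1) * ‖F‖) (x₀ := u₀) hs ?_ ?_ ?_ ?_ ?_ ?_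
  · refine ⟨_, hmain, fun v => ?_⟩
    rw [ContinuousLinearMap.integral_apply]
    · rfl
    · refine integrable_of_continuous μ ?_
      exact (ContinuousLinearMap.smulRightL ℝ E W).continuous₂.comp
        ((hDc u₀ hu₀).prodMk F.continuous)
  · filter_upwards [hU.mem_nhds hu₀] with u hu
    exact (integrable_of_continuous μ ((hθc u hu).smul F.continuous)).aestronglyMeasurable
  · exact integrable_of_continuous μ ((hθc u₀ hu₀).smul F.continuous)
  · refine (integrable_of_continuous μ ?_).aestronglyMeasurable
    exact (ContinuousLinearMap.smulRightL ℝ E W).continuous₂.comp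
        ((hDc u₀ hu₀).prodMk F.continuous)
  · refine Filter.Eventually.of_forall fun z u hu => ?_
    rw [ContinuousLinearMap.norm_smulRight_apply]
    exact mul_le_mul (hu.1 z).le (F.norm_coe_le_norm z) (norm_nonneg _)
      ((norm_nonneg _).trans (hu.1 z).le)
  · exact integrable_of_continuous μ continuous_const
  · refine Filter.Eventually.of_forall fun z u hu => ?_
    have h1 : ContMDiffAt 𝓘(ℝ, E) 𝓘(ℝ, ℝ) ∞ (fun u => θ (u, z)) u :=
      ContMDiffAt.comp (g := θ) (f := fun u : E => (u, z)) u
        (hθ.contMDiffAt (hUz u hu.2 z)) (contMDiffAt_id.prodMk contMDiffAt_const)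
    exact ((contMDiffAt_iff_contDiffAt.1 h1).differentiableAt (by simp)).hasFDerivAt.smul_const _

/-- A directional derivative of the integral is an integral of the same shape with a differentiated
kernel, so the induction runs over all kernels at once. -/
theorem contDiffOn_integral_smul [IsManifold 𝓘(ℝ, E) ∞ G] {θ : E × G → ℝ} {U : Set E}
    (hU : IsOpen U)
    (hθ : ContMDiffOn (𝓘(ℝ, E).prod 𝓘(ℝ, E)) 𝓘(ℝ, ℝ) ∞ θ (U ×ˢ Set.univ))
    (F : C(G, W)) : ContDiffOn ℝ ∞ (fun u => ∫ z, θ (u, z) • F z ∂μ) U := by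
  rw [contDiffOn_infty]
  intro n
  induction n generalizing θ with
  | zero =>
    rw [Nat.cast_zero, contDiffOn_zero]
    intro u hu
    obtain ⟨L, hL, -⟩ := hasFDerivAt_integral_smul μ hU hθ F hu
    exact hL.continuousAt.continuousWithinAt
  | succ n ih =>
    rw [Nat.cast_succ, contDiffOn_succ_iff_fderiv_apply hU.uniqueDiffOn]
    refine ⟨fun u hu => ?_, fun h => by simp at h, fun v => ?_⟩
    · obtain ⟨L, hL, -⟩ := hasFDerivAt_integral_smul μ hU hθ F hu
      exact hL.differentiableAt.differentiableWithinAt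
    · have h1 : ContMDiffOn (𝓘(ℝ, E).prod 𝓘(ℝ, E)) 𝓘(ℝ, ℝ) ∞
          (fun p : E × G => fderiv ℝ (fun u => θ (u, p.2)) p.1 v) (U ×ˢ Set.univ) :=
        (ContinuousLinearMap.apply ℝ ℝ v).contMDiff.comp_contMDiffOn
          (contMDiffOn_partial_fderiv hU hθ)
      refine (ih h1).congr fun u hu => ?_
      obtain ⟨L, hL, hLv⟩ := hasFDerivAt_integral_smul μ hU hθ F hu
      rw [fderivWithin_of_isOpen hU hu, hL.fderiv, hLv]

end Smooth

/-! ### Smoothness of elements of finite-dimensional left-invariant spaces -/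

section SmoothFinite

open MeasureTheory

variable {E : Type*} [NormedAddCommGroup E] [NormedSpace ℝ E] [FiniteDimensional ℝ E]
  {G : Type*} [TopologicalSpace G] [ChartedSpace E G] [Group G] [LieGroup 𝓘(ℝ, E) ∞ G]
  [CompactSpace G] [T2Space G]
  {W : Type*} [NormedAddCommGroup W] [NormedSpace ℝ W] [CompleteSpace W]

theorem exists_smooth_bump [MeasurableSpace G] [BorelSpace G] (μ : Measure G)
    [IsFiniteMeasureOnCompacts μ] [μ.IsOpenPosMeasure] {U : Set G} (hU : U ∈ 𝓝 (1 : G)) :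
    ∃ φ : G → ℝ, ContMDiff 𝓘(ℝ, E) 𝓘(ℝ, ℝ) ∞ φ ∧ (∀ x, 0 ≤ φ x) ∧ (∀ x, φ x ≠ 0 → x ∈ U) ∧
      ∫ x, φ x ∂μ = 1 := by
  obtain ⟨f, -, hf⟩ := (SmoothBumpFunction.nhds_basis_tsupport (I := 𝓘(ℝ, E))
    (1 : G)).mem_iff.1 hU
  have hpos : 0 < ∫ x, f x ∂μ :=
    f.continuous.integral_pos_of_hasCompactSupport_nonneg_nonzero
      (HasCompactSupport.of_compactSpace _) (fun x => f.nonneg) (x := 1) (by simp)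
  refine ⟨fun x => (∫ x, f x ∂μ)⁻¹ * f x, contMDiff_const.mul f.contMDiff,
    fun x => mul_nonneg (inv_nonneg.2 hpos.le) f.nonneg, fun x hx => ?_, ?_⟩
  · exact hf (subset_tsupport _ (right_ne_zero_of_mul hx))
  · rw [integral_const_mul]
    exact inv_mul_cancel₀ hpos.ne'

theorem contMDiff_integral_mul_left [MeasurableSpace G] [BorelSpace G] (μ : Measure G)
    [IsFiniteMeasureOnCompacts μ] {φ : G → ℝ} (hφ : ContMDiff 𝓘(ℝ, E) 𝓘(ℝ, ℝ) ∞ φ)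
    (F : C(G, W)) : ContMDiff 𝓘(ℝ, E) 𝓘(ℝ, W) ∞ fun x => ∫ z, φ (x * z) • F z ∂μ := by
  intro x₀
  let e := extChartAt 𝓘(ℝ, E) x₀
  have ht : IsOpen e.target := isOpen_extChartAt_target x₀
  have h1 : ContMDiffOn (𝓘(ℝ, E).prod 𝓘(ℝ, E)) 𝓘(ℝ, ℝ) ∞
      (fun p : E × G => φ (e.symm p.1 * p.2)) (e.target ×ˢ Set.univ) := by
    refine hφ.comp_contMDiffOn (ContMDiffOn.mul ?_ contMDiffOn_snd)
    exact (contMDiffOn_extChartAt_symm x₀).comp contMDiffOn_fst fun p hp => hp.1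
  have h2 := contDiffOn_integral_smul μ ht h1 F
  have h3 : ContMDiffOn 𝓘(ℝ, E) 𝓘(ℝ, W) ∞
      (fun x => ∫ z, φ (e.symm (e x) * z) • F z ∂μ) e.source :=
    (contMDiffOn_iff_contDiffOn.2 h2).comp
      ((contMDiffOn_extChartAt (x := x₀)).mono (by rw [← extChartAt_source 𝓘(ℝ, E)]))
      fun x hx => e.map_source hx
  refine (h3.congr fun x hx => ?_).contMDiffAt
    ((isOpen_extChartAt_source x₀).mem_nhds (mem_extChartAt_source x₀))
  rw [e.left_inv hx]

/-- The smooth elements of `𝒲` form a finite-dimensional, hence closed, subspace, so it is enough to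
approximate `f` by them. The means of the translates of `f` against a smooth bump at 1 do so: they
stay in `𝒲` by invariance. -/
theorem IsLeftInvariant.contMDiff [IsTopologicalGroup G] {𝒲 : Submodule ℝ C(G, W)}
    [FiniteDimensional ℝ 𝒲] (h𝒲 : IsLeftInvariant 𝒲) {f : C(G, W)} (hf : f ∈ 𝒲) :
    ContMDiff 𝓘(ℝ, E) 𝓘(ℝ, W) ∞ f := by
  borelize G
  obtain ⟨μ, _, _⟩ := exists_isHaarMeasure_isProbabilityMeasure G
  let 𝒮 : Submodule ℝ C(G, W) :=
    { carrier := {f | f ∈ 𝒲 ∧ ContMDiff 𝓘(ℝ, E) 𝓘(ℝ, W) ∞ f}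
      add_mem' := fun ha hb => ⟨𝒲.add_mem ha.1 hb.1, ha.2.add hb.2⟩
      zero_mem' := ⟨𝒲.zero_mem, contMDiff_const⟩
      smul_mem' := fun c a ha => ⟨𝒲.smul_mem c ha.1, (c • ContinuousLinearMap.id ℝ W).contMDiff.comp ha.2⟩ }
  have : FiniteDimensional ℝ 𝒮 :=
    Submodule.finiteDimensional_of_le (show 𝒮 ≤ 𝒲 from fun a ha => ha.1)
  have hcl : IsClosed (𝒮 : Set C(G, W)) := Submodule.closed_of_finiteDimensional _
  suffices h : f ∈ 𝒮 from h.2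
  refine hcl.closure_subset (Metric.mem_closure_iff.2 fun ε hε => ?_)
  have hc : Continuous fun z : G => leftTranslate z⁻¹ f :=
    (continuous_leftTranslate f).comp continuous_inv
  have hU : {z : G | dist (leftTranslate z⁻¹ f) f < ε / 2} ∈ 𝓝 (1 : G) := by
    have h := hc.continuousAt.preimage_mem_nhds (Metric.ball_mem_nhds _ (half_pos hε)) (x := 1)
    rwa [show leftTranslate (1 : G)⁻¹ f = f by ext; simp] at h
  obtain ⟨φ, hφ, hφ0, hφU, hφ1⟩ := exists_smooth_bump (E := E) μ hU
  have hint : Integrable (fun z => φ z • leftTranslate z⁻¹ f) μ :=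
    integrable_of_continuous μ (hφ.continuous.smul hc)
  refine ⟨∫ z, φ z • leftTranslate z⁻¹ f ∂μ, ⟨?_, ?_⟩, ?_⟩
  · let g : G → 𝒲 := fun z => φ z • ⟨leftTranslate z⁻¹ f, h𝒲 _ f hf⟩
    have hg : Continuous g := hφ.continuous.smul (hc.subtype_mk _)
    have h := 𝒲.subtypeL.integral_comp_comm (integrable_of_continuous μ hg)
    have h' : ∫ z, φ z • leftTranslate z⁻¹ f ∂μ = 𝒲.subtypeL (∫ z, g z ∂μ) := h
    rw [h']
    exact (∫ z, g z ∂μ).2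
  · have h : ∀ x, (∫ z, φ z • leftTranslate z⁻¹ f ∂μ) x = ∫ z, φ (x * z) • f z⁻¹ ∂μ := by
      intro x
      have h1 := (ContinuousMap.evalCLM ℝ x : C(G, W) →L[ℝ] W).integral_comp_comm hint
      refine h1.symm.trans ?_
      rw [← integral_mul_left_eq_self _ x]
      simp
    rw [show ⇑(∫ z, φ z • leftTranslate z⁻¹ f ∂μ) = fun x => ∫ z, φ (x * z) • f z⁻¹ ∂μ from
      funext h]
    exact contMDiff_integral_mul_left μ hφ ⟨fun z => f z⁻¹, by fun_prop⟩
  · refine lt_of_le_of_lt ?_ (half_lt_self hε)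
    have e1 : f = ∫ z, φ z • f ∂μ := by rw [integral_smul_const, hφ1, one_smul]
    have e2 : ε / 2 = ∫ z, φ z * (ε / 2) ∂μ := by rw [integral_mul_const, hφ1, one_mul]
    have hint' : Integrable (fun z => φ z • f) μ :=
      integrable_of_continuous μ (hφ.continuous.smul continuous_const)
    have e3 : dist f (∫ z, φ z • leftTranslate z⁻¹ f ∂μ) =
        ‖∫ z, (φ z • leftTranslate z⁻¹ f - φ z • f) ∂μ‖ := by
      rw [integral_sub hint hint', ← e1, dist_comm, dist_eq_norm]
    rw [e3, e2]
    refine (norm_integral_le_integral_norm _).trans (integral_mono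
      (integrable_of_continuous μ
        ((hφ.continuous.smul hc).sub (hφ.continuous.smul continuous_const)).norm)
      (integrable_of_continuous μ (hφ.continuous.mul continuous_const)) fun z => ?_)
    simp only [← smul_sub, norm_smul, Real.norm_eq_abs, abs_of_nonneg (hφ0 z)]
    by_cases hz : φ z = 0
    · simp [hz]
    · refine mul_le_mul_of_nonneg_left ?_ (hφ0 z)
      rw [← dist_eq_norm]
      exact (hφU z hz).le

end SmoothFinite

/-! ### One-parameter curves in a Lie group -/

section OneParameter

/-- Bootstrapping: if `u` is of class Cⁿ, so is its derivative `V ∘ u`, and `u` gains one order. -/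
theorem contDiffAt_of_hasDerivAt_comp {E : Type*} [NormedAddCommGroup E] [NormedSpace ℝ E]
    {u : ℝ → E} {V : E → E} {t₀ : ℝ} (hV : ContDiffAt ℝ ∞ V (u t₀))
    (hu : ∀ᶠ t in 𝓝 t₀, HasDerivAt u (V (u t)) t) : ContDiffAt ℝ ∞ u t₀ := by
  rw [contDiffAt_infty]
  intro n
  induction n with
  | zero =>
    rw [Nat.cast_zero, contDiffAt_zero]
    exact ⟨_, hu, fun t ht => HasDerivAt.continuousAt ht |>.continuousWithinAt⟩
  | succ n ih =>
    rw [Nat.cast_succ, contDiffAt_succ_iff_hasFDerivAt]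
    refine ⟨fun t => ContinuousLinearMap.toSpanSingleton ℝ (V (u t)),
      ⟨_, hu, fun t ht => HasDerivAt.hasFDerivAt ht⟩, ?_⟩
    have h1 : ContDiffAt ℝ n (fun t => V (u t)) t₀ :=
      (hV.of_le (by exact_mod_cast le_top)).comp t₀ ih
    have h2 := (ContinuousLinearMap.smulRightL ℝ ℝ E
      (ContinuousLinearMap.id ℝ ℝ)).contDiff.contDiffAt.comp t₀ h1 (n := n)
    refine h2.congr_of_eventuallyEq (Filter.Eventually.of_forall fun t => ?_)
    ext
    simp

variable {E : Type*} [NormedAddCommGroup E] [NormedSpace ℝ E]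
  {G : Type*} [TopologicalSpace G] [ChartedSpace E G] [Group G] [LieGroup 𝓘(ℝ, E) ∞ G]

/-- With constant base points no change of chart occurs. This lets the general theorem on smooth
dependence of differentials be read as smoothness of `Ad`, since conjugation fixes 1. -/
theorem inTangentCoordinates_of_const {N : Type*} {p : G} {a b : N → G} (ha : a = fun _ => p)
    (hb : b = fun _ => p) (ϕ : N → E →L[ℝ] E) (x₀ : N) :
    inTangentCoordinates 𝓘(ℝ, E) 𝓘(ℝ, E) a b ϕ x₀ = ϕ := by
  have : IsManifold 𝓘(ℝ, E) 1 G := IsManifold.of_le (n := ∞) (by simp)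
  subst ha hb
  funext x
  rw [inTangentCoordinates_eq _ _ _ (mem_chart_source E p) (mem_chart_source E p)]
  ext v
  have h : ∀ w : E, (tangentBundleCore 𝓘(ℝ, E) G).coordChange (achart E p) (achart E p) p w = w :=
    fun w => (tangentBundleCore 𝓘(ℝ, E) G).coordChange_self _ _ (mem_chart_source E p) _
  simp only [ContinuousLinearMap.comp_apply, h]

open HamiltonianModel in
theorem contMDiff_Ad : ContMDiff 𝓘(ℝ, E) 𝓘(ℝ, E →L[ℝ] E) ∞ (fun g : G => Ad E g) := by
  intro g₀
  have h1 : ContMDiffAt (𝓘(ℝ, E).prod 𝓘(ℝ, E)) 𝓘(ℝ, E) ∞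
      (Function.uncurry fun (g x : G) => g * x * g⁻¹) (g₀, 1) :=
    ((contMDiffAt_fst.mul contMDiffAt_snd).mul contMDiffAt_fst.inv)
  have h2 := ContMDiffAt.mfderiv (m := ∞) (n := ∞) (fun (g x : G) => g * x * g⁻¹) (fun _ => 1)
    h1 contMDiffAt_const le_rfl
  have e := inTangentCoordinates_of_const (E := E) (p := (1 : G)) (a := fun _ : G => 1)
    (b := fun g : G => g * 1 * g⁻¹) rfl (by funext g; simp) (fun g => Ad E g) g₀
  exact h2.congr_of_eventuallyEq (Filter.Eventually.of_forall fun g => (congrFun e g).symm)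

theorem hasMFDerivAt_mul_left_of_one {g : G} {a : G} (ha : a = 1) :
    HasMFDerivAt 𝓘(ℝ, E) 𝓘(ℝ, E) (fun x : G => g * x) a
      (mfderiv 𝓘(ℝ, E) 𝓘(ℝ, E) (fun x : G => g * x) 1 : E →L[ℝ] E) := by
  subst ha
  exact ((contMDiff_mul_left (I := 𝓘(ℝ, E)) (n := ∞)).mdifferentiableAt (by simp)).hasMFDerivAt

theorem mfderiv_mul_left_mul (g h : G) (ξ : E) :
    (mfderiv 𝓘(ℝ, E) 𝓘(ℝ, E) (fun x : G => g * x) h : E →L[ℝ] E)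
      ((mfderiv 𝓘(ℝ, E) 𝓘(ℝ, E) (fun x : G => h * x) 1 : E →L[ℝ] E) ξ) =
      (mfderiv 𝓘(ℝ, E) 𝓘(ℝ, E) (fun x : G => g * h * x) 1 : E →L[ℝ] E) ξ := by
  have h1 : HasMFDerivAt 𝓘(ℝ, E) 𝓘(ℝ, E) (fun x : G => g * x) (h * 1)
      (mfderiv 𝓘(ℝ, E) 𝓘(ℝ, E) (fun x : G => g * x) h : E →L[ℝ] E) := by
    rw [mul_one]
    exact ((contMDiff_mul_left (I := 𝓘(ℝ, E)) (n := ∞)).mdifferentiableAt (by simp)).hasMFDerivAt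
  have h2 := HasMFDerivAt.comp (1 : G) h1 (hasMFDerivAt_mul_left_of_one (E := E) (g := h) rfl)
  have h3 : (fun x : G => g * x) ∘ (fun x => h * x) = fun x => g * h * x := by
    funext x
    simp [mul_assoc]
  rw [h3] at h2
  exact (DFunLike.congr_fun (hasMFDerivAt_unique h2
    (hasMFDerivAt_mul_left_of_one (E := E) (g := g * h) rfl)) ξ)

variable [CompleteSpace E] [T2Space G]

/-- The curve is an integral curve of the left-invariant field of `ξ`. Both t ↦ γ(t + s) and t ↦
γ(s) γ(t) are integral curves with the value γ(s) at 0, so they agree. Local existence suffices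
below, hence no completeness of the field is needed. -/
theorem exists_local_oneParameter_curve (ξ : E) :
    ∃ γ : ℝ → G, γ 0 = 1 ∧
      HasMFDerivAt 𝓘(ℝ, ℝ) 𝓘(ℝ, E) γ 0 (ContinuousLinearMap.toSpanSingleton ℝ ξ) ∧
      ∃ ε > 0, ∀ s t, |s| < ε → |t| < ε → γ (t + s) = γ s * γ t := by
  have : LieGroup 𝓘(ℝ, E) (minSmoothness ℝ 3) G := LieGroup.of_le (n := ∞) (by
    rw [minSmoothness_of_isRCLikeNormedField]
    exact WithTop.coe_le_coe.2 (le_top : (3 : ℕ∞) ≤ ⊤))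
  have : IsManifold 𝓘(ℝ, E) 1 G := IsManifold.of_le (n := ∞) (by simp)
  let v : (g : G) → TangentSpace 𝓘(ℝ, E) g := mulInvariantVectorField (I := 𝓘(ℝ, E)) (G := G) ξ
  have hv : ContMDiff 𝓘(ℝ, E) 𝓘(ℝ, E).tangent 1
      (fun g => (⟨g, v g⟩ : TangentBundle 𝓘(ℝ, E) G)) :=
    (contMDiff_mulInvariantVectorField (I := 𝓘(ℝ, E)) (G := G) ξ).of_le (by
      simp [minSmoothness_of_isRCLikeNormedField])
  have hv1 : v 1 = ξ := by
    have h : (fun x : G => (1 : G) * x) = id := by funext x; simp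
    change mfderiv 𝓘(ℝ, E) 𝓘(ℝ, E) (fun x : G => (1 : G) * x) 1 ξ = ξ
    rw [h, mfderiv_id]
    rfl
  obtain ⟨γ, hγ0, hγ⟩ := exists_isMIntegralCurveAt_of_contMDiffAt_boundaryless 0
    (x₀ := (1 : G)) hv.contMDiffAt
  refine ⟨γ, hγ0, ?_, ?_⟩
  · have h := hγ.hasMFDerivAt
    have e : ((1 : ℝ →L[ℝ] ℝ).smulRight (v (γ 0)) : ℝ →L[ℝ] E) =
        ContinuousLinearMap.toSpanSingleton ℝ ξ := by
      rw [hγ0, hv1]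
      ext
      simp
    exact e ▸ h
  obtain ⟨ε, hε, hγε⟩ := isMIntegralCurveAt_iff'.1 hγ
  -- Half the radius keeps `t + s` within the interval of existence.
  refine ⟨ε / 2, half_pos hε, fun s t hs ht => ?_⟩
  have hsub : Set.Ioo (-(ε / 2)) (ε / 2) ⊆ {t | t + s ∈ Metric.ball 0 ε} := by
    intro t ht
    have ht' := abs_lt.2 ht
    simp only [Set.mem_ofPred_eq, Metric.mem_ball, dist_zero_right, Real.norm_eq_abs]
    linarith [abs_add_le t s]
  have h1 := (hγε.comp_add s).mono hsub
  have h2 : IsMIntegralCurveOn (fun t => γ s * γ t) v (Set.Ioo (-(ε / 2)) (ε / 2)) := by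
    intro t ht
    have ht' := abs_lt.2 ht
    have h3 : HasMFDerivAt 𝓘(ℝ, ℝ) 𝓘(ℝ, E) γ t ((1 : ℝ →L[ℝ] ℝ).smulRight (v (γ t))) :=
      (hγε t (by simp only [Metric.mem_ball, dist_zero_right, Real.norm_eq_abs]; linarith)).hasMFDerivAt
        (Metric.isOpen_ball.mem_nhds
          (by simp only [Metric.mem_ball, dist_zero_right, Real.norm_eq_abs]; linarith))
    have h4 := HasMFDerivAt.comp t (((contMDiff_mul_left (I := 𝓘(ℝ, E)) (n := ∞)
      (a := γ s)).mdifferentiableAt (x := γ t) (by simp)).hasMFDerivAt) h3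
    refine HasMFDerivAt.hasMFDerivWithinAt ?_
    have e : ((mfderiv 𝓘(ℝ, E) 𝓘(ℝ, E) (fun x : G => γ s * x) (γ t) : E →L[ℝ] E).comp
        ((1 : ℝ →L[ℝ] ℝ).smulRight (v (γ t)) : ℝ →L[ℝ] E)) =
        ((1 : ℝ →L[ℝ] ℝ).smulRight (v (γ s * γ t)) : ℝ →L[ℝ] E) := by
      refine ContinuousLinearMap.ext fun r => ?_
      refine (map_smul (mfderiv 𝓘(ℝ, E) 𝓘(ℝ, E) (fun x : G => γ s * x) (γ t) : E →L[ℝ] E) r _).trans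
        (congrArg (r • ·) ?_)
      exact mfderiv_mul_left_mul (γ s) (γ t) ξ
    exact e ▸ h4
  have h0 : (0 : ℝ) ∈ Set.Ioo (-(ε / 2)) (ε / 2) := ⟨by linarith, by linarith⟩
  exact isMIntegralCurveOn_Ioo_eqOn_of_contMDiff_boundaryless h0 hv h1 h2
    (by simp [hγ0]) (abs_lt.1 ht)

end OneParameter

/-! ### Velocities of curves in a Lie group -/

section Velocity

open Asymptotics

variable {E : Type*} [NormedAddCommGroup E] [NormedSpace ℝ E]
  {G : Type*} [TopologicalSpace G] [ChartedSpace E G]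

theorem HasMFDerivAt.hasDerivAt_extChartAt {γ : ℝ → G} {p : G} (h0 : γ 0 = p) {ξ : E}
    (h : HasMFDerivAt 𝓘(ℝ, ℝ) 𝓘(ℝ, E) γ 0 (ContinuousLinearMap.toSpanSingleton ℝ ξ)) :
    HasDerivAt (fun t => extChartAt 𝓘(ℝ, E) p (γ t)) ξ 0 := by
  subst h0
  have h2 := h.2
  rw [ModelWithCorners.range_eq_univ] at h2
  have h3 : HasFDerivWithinAt (fun t => extChartAt 𝓘(ℝ, E) (γ 0) (γ t))
    (ContinuousLinearMap.toSpanSingleton ℝ ξ) Set.univ 0 := h2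
  simpa using (hasFDerivWithinAt_univ.1 h3).hasDerivAt

theorem HasMFDerivAt.hasFDerivAt_extChartAt {F : Type*} [NormedAddCommGroup F] [NormedSpace ℝ F]
    {H : Type*} [TopologicalSpace H] [ChartedSpace F H] {f : H → G} {q : H} {p : G}
    (h0 : f q = p) {A : F →L[ℝ] E} (h : HasMFDerivAt 𝓘(ℝ, F) 𝓘(ℝ, E) f q A) :
    HasFDerivAt (fun u => extChartAt 𝓘(ℝ, E) p (f ((extChartAt 𝓘(ℝ, F) q).symm u))) A
      (extChartAt 𝓘(ℝ, F) q q) := by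
  subst h0
  have h2 := h.2
  rw [ModelWithCorners.range_eq_univ] at h2
  exact hasFDerivWithinAt_univ.1 h2

variable [Group G] [LieGroup 𝓘(ℝ, E) ∞ G]

/-- Multiplication in the chart at `1`. -/
theorem contDiffAt_mul_extChartAt :
    ContDiffAt ℝ ∞ (Function.uncurry fun u w : E => extChartAt 𝓘(ℝ, E) (1 : G)
      ((extChartAt 𝓘(ℝ, E) (1 : G)).symm u * (extChartAt 𝓘(ℝ, E) (1 : G)).symm w))
      (extChartAt 𝓘(ℝ, E) (1 : G) 1, extChartAt 𝓘(ℝ, E) (1 : G) 1) := by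
  set e := extChartAt 𝓘(ℝ, E) (1 : G) with he
  have h1 : e.symm (e 1) = 1 := extChartAt_to_inv (I := 𝓘(ℝ, E)) (1 : G)
  have hs : ContMDiffAt 𝓘(ℝ, E) 𝓘(ℝ, E) ∞ e.symm (e 1) :=
    (contMDiffOn_extChartAt_symm (I := 𝓘(ℝ, E)) (n := ∞) (1 : G)).contMDiffAt
      (extChartAt_target_mem_nhds (I := 𝓘(ℝ, E)) (1 : G))
  have h2 : ContMDiffAt 𝓘(ℝ, E × E) 𝓘(ℝ, E) ∞ (fun p : E × E => e.symm p.1 * e.symm p.2)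
      (e 1, e 1) :=
    ContMDiffAt.mul
      (ContMDiffAt.comp (g := e.symm) (f := Prod.fst) (e 1, e 1) hs
        contDiff_fst.contMDiff.contMDiffAt)
      (ContMDiffAt.comp (g := e.symm) (f := Prod.snd) (e 1, e 1) hs
        contDiff_snd.contMDiff.contMDiffAt)
  have h3 : ContMDiffAt 𝓘(ℝ, E) 𝓘(ℝ, E) ∞ e (e.symm (e 1) * e.symm (e 1)) := by
    rw [h1, one_mul]
    exact contMDiffAt_extChartAt
  exact contMDiffAt_iff_contDiffAt.1 (ContMDiffAt.comp (g := e) (e 1, e 1) h3 h2)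

/-- Differentiating γ(t + s) = γ(t) γ(s) at s = 0 shows that `γ`, read in a chart, solves an
autonomous equation with smooth right side. Smoothness is needed because `lieOfSubgroup` admits only
curves smooth at 0. -/
theorem contMDiffAt_of_local_oneParameter {γ : ℝ → G} (h0 : γ 0 = 1) {ξ : E}
    (h : HasMFDerivAt 𝓘(ℝ, ℝ) 𝓘(ℝ, E) γ 0 (ContinuousLinearMap.toSpanSingleton ℝ ξ)) {ε : ℝ}
    (hε : 0 < ε) (hmul : ∀ s t, |s| < ε → |t| < ε → γ (t + s) = γ s * γ t) :
    ContMDiffAt 𝓘(ℝ, ℝ) 𝓘(ℝ, E) ∞ γ 0 := by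
  let e := extChartAt 𝓘(ℝ, E) (1 : G)
  have hc := h.continuousAt
  have hu0 : HasDerivAt (fun t => e (γ t)) ξ 0 := h.hasDerivAt_extChartAt h0
  have hsrc : ∀ᶠ t in 𝓝 (0 : ℝ), γ t ∈ e.source := by
    refine hc.eventually_mem ?_
    rw [h0]
    exact extChartAt_source_mem_nhds (I := 𝓘(ℝ, E)) (1 : G)
  have hsmall : ∀ᶠ t in 𝓝 (0 : ℝ), |t| < ε := by
    filter_upwards [Metric.ball_mem_nhds (0 : ℝ) hε] with t ht
    simpa using ht
  let M : E → E → E := fun u w => e (e.symm u * e.symm w)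
  have hM : ContDiffAt ℝ ∞ (Function.uncurry M) (e 1, e 1) := contDiffAt_mul_extChartAt
  let V : E → E := fun u => fderiv ℝ (M u) (e 1) ξ
  have hV : ContDiffAt ℝ ∞ V (e 1) :=
    (ContDiffAt.fderiv (m := ∞) (n := ∞) (f := M) (g := fun _ => e 1) hM contDiffAt_const
      le_rfl).clm_apply contDiffAt_const
  have hMd : ∀ᶠ u in 𝓝 (e 1), DifferentiableAt ℝ (M u) (e 1) := by
    have h1 : ∀ᶠ p in 𝓝 (e 1, e 1), ContDiffAt ℝ 1 (Function.uncurry M) p :=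
      (hM.of_le (by simp)).eventually (by simp)
    have h2 : ContinuousAt (fun u : E => (u, e 1)) (e 1) := by fun_prop
    filter_upwards [h2.eventually h1] with u hu
    have h3 : ContDiffAt ℝ 1 (fun w => Function.uncurry M (u, w)) (e 1) :=
      hu.comp (e 1) (by fun_prop)
    exact h3.differentiableAt (by simp)
  have hu : ContinuousAt (fun t => e (γ t)) 0 := hu0.continuousAt
  have hMd' : ∀ᶠ t in 𝓝 (0 : ℝ), DifferentiableAt ℝ (M (e (γ t))) (e 1) :=
    hu.eventually (by simpa only [h0] using hMd)
  have hode : ∀ᶠ t in 𝓝 (0 : ℝ), HasDerivAt (fun t => e (γ t)) (V (e (γ t))) t := by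
    filter_upwards [hsrc, hsmall, hMd'] with t hts ht htd
    have h1 : HasDerivAt (fun s => M (e (γ t)) (e (γ s))) (V (e (γ t))) 0 := by
      have htd' : HasFDerivAt (M (e (γ t))) (fderiv ℝ (M (e (γ t))) (e 1)) (e (γ 0)) := by
        rw [h0]
        exact htd.hasFDerivAt
      exact htd'.comp_hasDerivAt (0 : ℝ) hu0
    have h2 : HasDerivAt (fun s => e (γ (t + s))) (V (e (γ t))) 0 := by
      refine h1.congr_of_eventuallyEq ?_
      filter_upwards [hsrc, hsmall] with s hss hs
      simp only [M]
      rw [e.left_inv hts, e.left_inv hss, add_comm, hmul t s ht hs]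
    have h3 : HasDerivAt (fun x => e (γ (t + (x - t)))) (V (e (γ t))) t :=
      HasDerivAt.comp_sub_const (f := fun s => e (γ (t + s))) t t (by rwa [sub_self])
    simpa using h3
  have hsm : ContDiffAt ℝ ∞ (fun t => e (γ t)) 0 :=
    contDiffAt_of_hasDerivAt_comp (V := V) (by rw [h0]; exact hV) hode
  have hes : ContMDiffAt 𝓘(ℝ, E) 𝓘(ℝ, E) ∞ e.symm (e (γ 0)) := by
    rw [h0]
    exact (contMDiffOn_extChartAt_symm (I := 𝓘(ℝ, E)) (n := ∞) (1 : G)).contMDiffAt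
      (extChartAt_target_mem_nhds (I := 𝓘(ℝ, E)) (1 : G))
  refine (ContMDiffAt.comp (g := e.symm) (0 : ℝ) hes hsm.contMDiffAt).congr_of_eventuallyEq ?_
  filter_upwards [hsrc] with t ht
  exact (e.left_inv ht).symm

variable {F : Type*} [NormedAddCommGroup F] [NormedSpace ℝ F] [FiniteDimensional ℝ F]
  {H : Type*} [TopologicalSpace H] [ChartedSpace F H] [Group H] [LieGroup 𝓘(ℝ, F) ∞ H]

/-- Lifted to `H`, the curve is continuous because `ι` is a closed embedding. Injectivity of `A`
upgrades this to an O(t) bound in a chart, so t ξ differs from a vector of the range of `A` by o(t).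
-/
theorem velocity_mem_range [FiniteDimensional ℝ E] [CompactSpace H] [T2Space G] {ι : H →* G}
    (hι : Continuous ι)
    (hinj : Function.Injective ι) {A : F →L[ℝ] E} (hA : HasMFDerivAt 𝓘(ℝ, F) 𝓘(ℝ, E) ι 1 A)
    (hAinj : Function.Injective A) {γ : ℝ → G} (h0 : γ 0 = 1) {ξ : E}
    (h : HasMFDerivAt 𝓘(ℝ, ℝ) 𝓘(ℝ, E) γ 0 (ContinuousLinearMap.toSpanSingleton ℝ ξ))
    (hmem : ∀ᶠ t in 𝓝 0, γ t ∈ ι.range) : ∃ φ, A φ = ξ := by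
  let e := extChartAt 𝓘(ℝ, E) (1 : G)
  let e' := extChartAt 𝓘(ℝ, F) (1 : H)
  have hu : HasDerivAt (fun t => e (γ t)) ξ 0 := h.hasDerivAt_extChartAt h0
  have hA' : HasFDerivAt (fun u => e (ι (e'.symm u))) A (e' 1) :=
    hA.hasFDerivAt_extChartAt (map_one ι)
  have he'1 : e'.symm (e' 1) = 1 := extChartAt_to_inv (I := 𝓘(ℝ, F)) (1 : H)
  let k : ℝ → H := fun t => Function.invFun ι (γ t)
  have hk : ∀ᶠ t in 𝓝 0, ι (k t) = γ t := hmem.mono fun t ⟨x, hx⟩ => Function.invFun_eq ⟨x, hx⟩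
  have hkt : Filter.Tendsto k (𝓝 0) (𝓝 1) := by
    rw [(hι.isClosedEmbedding hinj).isEmbedding.tendsto_nhds_iff, map_one, ← h0]
    refine h.continuousAt.congr' ?_
    filter_upwards [hk] with t ht
    exact ht.symm
  have hat : Filter.Tendsto (fun t => e' (k t)) (𝓝 0) (𝓝 (e' 1)) :=
    (continuousAt_extChartAt (I := 𝓘(ℝ, F)) (1 : H)).tendsto.comp hkt
  have hks : ∀ᶠ t in 𝓝 0, e'.symm (e' (k t)) = k t := by
    filter_upwards [hkt (extChartAt_source_mem_nhds (I := 𝓘(ℝ, F)) (1 : H))] with t ht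
    exact e'.left_inv ht
  obtain ⟨C, -, hC⟩ := A.toLinearMap.exists_antilipschitzWith (LinearMap.ker_eq_bot.2 hAinj)
  have hval : (fun t => e (γ t) - e (γ 0)) =ᶠ[𝓝 0]
      fun t => e (ι (e'.symm (e' (k t)))) - e (ι (e'.symm (e' 1))) := by
    filter_upwards [hk, hks] with t h1 h2
    rw [h2, h1, he'1, map_one, h0]
  have hO : (fun t => e' (k t) - e' 1) =O[𝓝 0] fun t : ℝ => t := by
    have hrev : (fun u => u - e' 1) =O[𝓝 (e' 1)] fun u => A (u - e' 1) := by
      refine .of_bound C (Filter.Eventually.of_forall fun u => ?_)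
      simpa using hC.le_mul_dist (u - e' 1) 0
    have hlo : (fun u => e (ι (e'.symm u)) - e (ι (e'.symm (e' 1))) - A (u - e' 1))
        =o[𝓝 (e' 1)] fun u => A (u - e' 1) := hA'.isLittleO.trans_isBigO hrev
    have hrev2 : (fun u => u - e' 1) =O[𝓝 (e' 1)]
        fun u => e (ι (e'.symm u)) - e (ι (e'.symm (e' 1))) :=
      hrev.trans (IsEquivalent.isBigO_symm hlo)
    have h1 := (hrev2.comp_tendsto hat).trans_eventuallyEq hval.symm
    refine h1.trans ?_
    simpa using hu.isBigO_sub
  have ho : (fun t => e (γ t) - e (γ 0) - A (e' (k t) - e' 1)) =o[𝓝 0] fun t : ℝ => t := by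
    have h1 := (hA'.isLittleO.comp_tendsto hat).trans_isBigO hO
    refine h1.congr' ?_ Filter.EventuallyEq.rfl
    filter_upwards [hval] with t ht
    rw [ht]
    rfl
  have ho2 : (fun t => e (γ t) - e (γ 0) - t • ξ) =o[𝓝 0] fun t : ℝ => t := by
    have h1 := hu.isLittleO
    simpa using h1
  have ho3 : (fun t => A (e' (k t) - e' 1) - t • ξ) =o[𝓝 0] fun t : ℝ => t := by
    refine (ho2.sub ho).congr_left fun t => ?_
    abel
  by_contra! hcon
  -- A functional that kills the range of `A` but not `ξ` would give t ℓ(ξ) = o(t).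
  obtain ⟨ℓ, hℓξ, hℓ⟩ := Submodule.exists_le_ker_of_notMem (p := LinearMap.range A.toLinearMap)
    (v := ξ) fun ⟨φ, hφ⟩ => hcon φ hφ
  let ℓ' : E →L[ℝ] ℝ := ℓ.toContinuousLinearMap
  have h4 : (fun t : ℝ => t * ℓ ξ) =o[𝓝 0] fun t : ℝ => t := by
    have h5 := (ℓ'.isBigO_comp (fun t => A (e' (k t) - e' 1) - t • ξ) (𝓝 0)).trans_isLittleO ho3
    refine h5.neg_left.congr_left fun t => ?_
    have h6 : ℓ (A (e' (k t) - e' 1)) = 0 := hℓ ⟨_, rfl⟩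
    change -ℓ (A (e' (k t) - e' 1) - t • ξ) = _
    rw [map_sub, h6, map_smul]
    simp
  have h7 : (fun t : ℝ => t) =o[𝓝 0] fun t : ℝ => t :=
    (isLittleO_const_mul_left_iff hℓξ).1 (h4.congr_left fun t => mul_comm _ _)
  refine isLittleO_irrefl ?_ h7
  exact (Filter.Eventually.frequently (f := 𝓝[≠] (0 : ℝ)) eventually_mem_nhdsWithin).filter_mono
    nhdsWithin_le_nhds

end Velocity

/-! ### Functions on a group that separate the cosets of a subgroup -/

section Separation

open Filter

/-- A finite-dimensional space of functions on `G`, invariant under left translations, whose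
elements are invariant under right translations by the image of `ι`. -/
structure IsQuotientSpace {G : Type*} [TopologicalSpace G] [Group G] [IsTopologicalGroup G]
    {H : Type*} [Group H] (ι : H →* G) (𝒜 : Submodule ℝ C(G, ℝ)) : Prop where
  finite : FiniteDimensional ℝ 𝒜
  inv : IsLeftInvariant 𝒜
  apply_mul : ∀ a ∈ 𝒜, ∀ g h, a (g * ι h) = a g

namespace IsQuotientSpace

variable {G : Type*} [TopologicalSpace G] [Group G] [IsTopologicalGroup G]
    {H : Type*} [Group H] {ι : H →* G} {𝒜 𝒜' : Submodule ℝ C(G, ℝ)}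

theorem bot (ι : H →* G) : IsQuotientSpace ι ⊥ where
  finite := inferInstance
  inv := isLeftInvariant_bot
  apply_mul a ha g h := by
    rw [(Submodule.mem_bot ℝ).1 ha]
    rfl

theorem sup (h : IsQuotientSpace ι 𝒜) (h' : IsQuotientSpace ι 𝒜') :
    IsQuotientSpace ι (𝒜 ⊔ 𝒜') where
  finite := by
    have := h.finite
    have := h'.finite
    infer_instance
  inv := h.inv.sup h'.inv
  apply_mul a ha g k := by
    obtain ⟨b, hb, c, hc, rfl⟩ := Submodule.mem_sup.1 ha
    rw [ContinuousMap.add_apply, h.apply_mul b hb, h'.apply_mul c hc, ContinuousMap.add_apply]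

theorem exists_apply_ne [CompactSpace G] [T2Space G] [TopologicalSpace H] [IsTopologicalGroup H]
    [CompactSpace H] (hι : Continuous ι) {g : G} (hg : g ∉ ι.range) :
    ∃ 𝒜 : Submodule ℝ C(G, ℝ), IsQuotientSpace ι 𝒜 ∧ ∃ a ∈ 𝒜, a g ≠ a 1 := by
  obtain ⟨a, ha, hne⟩ := exists_leftFinite_apply_ne hι hg
  obtain ⟨𝒜, hle, hfin, hinv, ha⟩ := exists_leftInvariant_of_mem_inf ha
  refine ⟨𝒜, ⟨hfin, hinv, fun b hb g h => ?_⟩, a, ha, hne⟩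
  have := hle hb g h⁻¹
  rwa [map_inv, inv_inv] at this

variable {E : Type*} [NormedAddCommGroup E] [NormedSpace ℝ E] [FiniteDimensional ℝ E]
  [ChartedSpace E G] [LieGroup 𝓘(ℝ, E) ∞ G] [CompactSpace G] [T2Space G]

theorem contMDiff (h : IsQuotientSpace ι 𝒜) {a : C(G, ℝ)} (ha : a ∈ 𝒜) :
    ContMDiff 𝓘(ℝ, E) 𝓘(ℝ, ℝ) ∞ a := by
  have := h.finite
  exact h.inv.contMDiff ha

theorem hasMFDerivAt (h : IsQuotientSpace ι 𝒜) {a : C(G, ℝ)} (ha : a ∈ 𝒜) (g : G) :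
    HasMFDerivAt 𝓘(ℝ, E) 𝓘(ℝ, ℝ) a g (mfderiv 𝓘(ℝ, E) 𝓘(ℝ, ℝ) a g) :=
  ((h.contMDiff ha).mdifferentiableAt (by simp)).hasMFDerivAt

end IsQuotientSpace

variable {E : Type*} [NormedAddCommGroup E] [NormedSpace ℝ E] [FiniteDimensional ℝ E]
  {G : Type*} [TopologicalSpace G] [ChartedSpace E G] [Group G] [LieGroup 𝓘(ℝ, E) ∞ G]
  [IsTopologicalGroup G]
  {F : Type*} [NormedAddCommGroup F] [NormedSpace ℝ F] [FiniteDimensional ℝ F]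
  {H : Type*} [TopologicalSpace H] [ChartedSpace F H] [Group H] [LieGroup 𝓘(ℝ, F) ∞ H]
  [IsTopologicalGroup H] [CompactSpace G] [T2Space G] [CompactSpace H]
  {ι : H →* G} {A : F →L[ℝ] E}

variable (E) in
/-- The velocities at `1` annihilated by the differentials of all functions in `𝒜`. -/
noncomputable def annihilator (𝒜 : Submodule ℝ C(G, ℝ)) : Submodule ℝ E :=
  ⨅ a ∈ 𝒜, LinearMap.ker (mfderiv 𝓘(ℝ, E) 𝓘(ℝ, ℝ) a 1 : E →L[ℝ] ℝ).toLinearMap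

theorem mem_annihilator {𝒜 : Submodule ℝ C(G, ℝ)} {ξ : E} :
    ξ ∈ annihilator E 𝒜 ↔ ∀ a ∈ 𝒜, (mfderiv 𝓘(ℝ, E) 𝓘(ℝ, ℝ) a 1 : E →L[ℝ] ℝ) ξ = 0 := by
  simp only [annihilator, Submodule.mem_iInf]
  rfl

theorem mfderiv_apply_eq_zero_of_basis {𝒜 : Submodule ℝ C(G, ℝ)} (h𝒜 : IsQuotientSpace ι 𝒜)
    {n : ℕ} (b : Module.Basis (Fin n) ℝ 𝒜) {g : G} {ξ : E}
    (h : ∀ i, (mfderiv 𝓘(ℝ, E) 𝓘(ℝ, ℝ) (b i : C(G, ℝ)) g : E →L[ℝ] ℝ) ξ = 0) :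
    ∀ a ∈ 𝒜, (mfderiv 𝓘(ℝ, E) 𝓘(ℝ, ℝ) a g : E →L[ℝ] ℝ) ξ = 0 := by
  intro a ha
  have h3 : (⟨a, ha⟩ : 𝒜) ∈ Submodule.span ℝ (Set.range b) := by
    rw [b.span_eq]
    trivial
  refine Submodule.span_induction (p := fun (a : 𝒜) _ =>
    (mfderiv 𝓘(ℝ, E) 𝓘(ℝ, ℝ) (a : C(G, ℝ)) g : E →L[ℝ] ℝ) ξ = 0) ?_ ?_ ?_ ?_ h3
  · rintro _ ⟨i, rfl⟩
    exact h i
  · exact congrArg (fun L : E →L[ℝ] ℝ => L ξ)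
      (mfderiv_const (I := 𝓘(ℝ, E)) (I' := 𝓘(ℝ, ℝ)) (x := g) (c := (0 : ℝ)))
  · intro x y _ _ hx hy
    have h4 : HasMFDerivAt 𝓘(ℝ, E) 𝓘(ℝ, ℝ) (⇑((x + y : 𝒜) : C(G, ℝ))) g (_ : E →L[ℝ] ℝ) :=
      (h𝒜.hasMFDerivAt (E := E) x.2 g).add (h𝒜.hasMFDerivAt (E := E) y.2 g)
    refine (congrArg (fun L : E →L[ℝ] ℝ => L ξ) h4.mfderiv).trans ?_
    exact (congrArg₂ (fun a b : ℝ => a + b) hx hy).trans (add_zero (0 : ℝ))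
  · intro c x _ hx
    have h4 : HasMFDerivAt 𝓘(ℝ, E) 𝓘(ℝ, ℝ) (⇑((c • x : 𝒜) : C(G, ℝ))) g (_ : E →L[ℝ] ℝ) :=
      (h𝒜.hasMFDerivAt (E := E) x.2 g).const_smul c
    refine (congrArg (fun L : E →L[ℝ] ℝ => L ξ) h4.mfderiv).trans ?_
    exact (congrArg (fun a : ℝ => c * a) hx).trans (mul_zero c)

/-- The derivative of `a` along the curve at time t is that of the translate of `a` by γ(t) at time
0. The translate is in `𝒜`, so the derivative vanishes. -/
theorem apply_eq_of_mem_annihilator {𝒜 : Submodule ℝ C(G, ℝ)} (h𝒜 : IsQuotientSpace ι 𝒜) {ξ : E}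
    (hξ : ξ ∈ annihilator E 𝒜) {γ : ℝ → G} (h0 : γ 0 = 1)
    (hγ : HasMFDerivAt 𝓘(ℝ, ℝ) 𝓘(ℝ, E) γ 0 (ContinuousLinearMap.toSpanSingleton ℝ ξ)) {ε : ℝ}
    (hε : 0 < ε) (hmul : ∀ s t, |s| < ε → |t| < ε → γ (t + s) = γ s * γ t)
    {t : ℝ} (ht : |t| < ε) {a : C(G, ℝ)} (ha : a ∈ 𝒜) : a (γ t) = a 1 := by
  have hder : ∀ t, |t| < ε → HasDerivAt (fun s => a (γ s)) 0 t := by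
    intro t ht
    have h1 := h𝒜.hasMFDerivAt (E := E) (h𝒜.inv (γ t) a ha) 1
    rw [← h0] at h1
    have h2 := HasMFDerivAt.comp (0 : ℝ) h1 hγ
    have h3 : HasFDerivAt (fun s => leftTranslate (γ t) a (γ s)) (_ : ℝ →L[ℝ] ℝ) 0 :=
      hasMFDerivAt_iff_hasFDerivAt.1 h2
    have h4 : HasDerivAt (fun s => leftTranslate (γ t) a (γ s)) 0 0 := by
      refine h3.hasDerivAt.congr_deriv ?_
      refine Eq.trans ?_ (mem_annihilator.1 hξ _ (h𝒜.inv (γ t) a ha))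
      rw [← h0]
      change (mfderiv 𝓘(ℝ, E) 𝓘(ℝ, ℝ) (leftTranslate (γ t) a) (γ 0) : E →L[ℝ] ℝ) ((1 : ℝ) • ξ) = _
      rw [one_smul]
    have h5 : HasDerivAt (fun s => a (γ (t + s))) 0 0 := by
      refine h4.congr_of_eventuallyEq ?_
      filter_upwards [Metric.ball_mem_nhds (0 : ℝ) hε] with s hs
      rw [leftTranslate_apply, add_comm, hmul t s ht (by simpa using hs)]
    have h3 : HasDerivAt (fun x => a (γ (t + (x - t)))) 0 t :=
      HasDerivAt.comp_sub_const (f := fun s => a (γ (t + s))) t t (by rwa [sub_self])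
    simpa using h3
  have hball : ∀ {t : ℝ}, t ∈ Metric.ball (0 : ℝ) ε ↔ |t| < ε := by simp
  have := Metric.isOpen_ball.is_const_of_fderiv_eq_zero (𝕜 := ℝ) (s := Metric.ball (0 : ℝ) ε)
    (f := fun s => a (γ s)) (convex_ball _ _).isPreconnected
    (fun s hs => (hder s (hball.1 hs)).differentiableAt.differentiableWithinAt)
    (fun s hs => by
      ext
      simpa using (hder s (hball.1 hs)).deriv) (hball.2 ht) (Metric.mem_ball_self hε)
  rw [this, h0]

/-- Take `𝒜` with annihilator of least dimension. Adjoining any other space cannot shrink the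
annihilator, so a direction in it is killed by all left-finite functions on the quotient. These are
then constant along its local one-parameter curve; as they separate 1 from points outside the image
of `H`, the curve lies in that image and its velocity in 𝔥. -/
theorem exists_annihilator_le_range (hι : Continuous ι) (hinj : Function.Injective ι)
    (hA : HasMFDerivAt 𝓘(ℝ, F) 𝓘(ℝ, E) ι 1 A) (hAinj : Function.Injective A) :
    ∃ 𝒜 : Submodule ℝ C(G, ℝ), IsQuotientSpace ι 𝒜 ∧
      annihilator E 𝒜 ≤ LinearMap.range A.toLinearMap := by
  let s : Set ℕ := {n | ∃ 𝒜 : Submodule ℝ C(G, ℝ), IsQuotientSpace ι 𝒜 ∧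
    Module.finrank ℝ (annihilator E 𝒜) = n}
  obtain ⟨𝒜, h𝒜, hmin⟩ : sInf s ∈ s := Nat.sInf_mem ⟨_, ⊥, .bot ι, rfl⟩
  have hall : ∀ 𝒜', IsQuotientSpace ι 𝒜' → annihilator E 𝒜 ≤ annihilator E 𝒜' := by
    intro 𝒜' h𝒜'
    have hle : annihilator E (𝒜 ⊔ 𝒜') ≤ annihilator E 𝒜 := fun ξ hξ =>
      mem_annihilator.2 fun a ha => mem_annihilator.1 hξ a (Submodule.mem_sup_left ha)
    rw [← Submodule.eq_of_le_of_finrank_le hle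
      (hmin ▸ Nat.sInf_le ⟨_, h𝒜.sup h𝒜', rfl⟩)]
    exact fun ξ hξ => mem_annihilator.2 fun a ha =>
      mem_annihilator.1 hξ a (Submodule.mem_sup_right ha)
  refine ⟨𝒜, h𝒜, fun ξ hξ => ?_⟩
  have : CompleteSpace E := FiniteDimensional.complete ℝ E
  obtain ⟨γ, h0, hγ, ε, hε, hmul⟩ := exists_local_oneParameter_curve (G := G) ξ
  refine velocity_mem_range hι hinj hA hAinj h0 hγ ?_
  filter_upwards [Metric.ball_mem_nhds (0 : ℝ) hε] with t ht
  by_contra hcon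
  obtain ⟨𝒜', h𝒜', a, ha, hne⟩ := IsQuotientSpace.exists_apply_ne hι hcon
  exact hne (apply_eq_of_mem_annihilator h𝒜' (hall 𝒜' h𝒜' hξ) h0 hγ hε hmul (by simpa using ht) ha)

/-- Near `1`, every element of `G` is a product of a point of a slice and an element of the image
of `ι`. -/
theorem eventually_exists_slice_mul (hA : HasMFDerivAt 𝓘(ℝ, F) 𝓘(ℝ, E) ι 1 A)
    (hιs : ContMDiff 𝓘(ℝ, F) 𝓘(ℝ, E) ∞ ι) {𝔪 : Submodule ℝ E}
    (h𝔪 : IsCompl (LinearMap.range A.toLinearMap) 𝔪) {U : Set 𝔪} (hU : U ∈ 𝓝 0) :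
    ∀ᶠ g in 𝓝 (1 : G), ∃ m ∈ U, ∃ h,
      g = (extChartAt 𝓘(ℝ, E) (1 : G)).symm (extChartAt 𝓘(ℝ, E) (1 : G) 1 + m) * ι h := by
  let e := extChartAt 𝓘(ℝ, E) (1 : G)
  let e' := extChartAt 𝓘(ℝ, F) (1 : H)
  have he1 : e.symm (e 1) = 1 := extChartAt_to_inv (I := 𝓘(ℝ, E)) (1 : G)
  have he'1 : e'.symm (e' 1) = 1 := extChartAt_to_inv (I := 𝓘(ℝ, F)) (1 : H)
  let N : 𝔪 × F → E × E := fun p => (e 1 + p.1, e (ι (e'.symm (e' 1 + p.2))))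
  let M : E × E → E := fun p => e (e.symm p.1 * e.symm p.2)
  have hN0 : N 0 = (e 1, e 1) := by
    simp only [N, Prod.fst_zero, Prod.snd_zero, Submodule.coe_zero, add_zero, he'1, map_one]
  have hM : ContDiffAt ℝ ∞ M (N 0) := by
    rw [hN0]
    exact contDiffAt_mul_extChartAt
  have hιe : ContDiffAt ℝ ∞ (fun u => e (ι (e'.symm u))) (e' 1) := by
    have hs : ContMDiffAt 𝓘(ℝ, F) 𝓘(ℝ, F) ∞ e'.symm (e' 1) :=
      (contMDiffOn_extChartAt_symm (I := 𝓘(ℝ, F)) (n := ∞) (1 : H)).contMDiffAt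
        (extChartAt_target_mem_nhds (I := 𝓘(ℝ, F)) (1 : H))
    have h2 : ContMDiffAt 𝓘(ℝ, F) 𝓘(ℝ, E) ∞ (fun u => ι (e'.symm u)) (e' 1) :=
      ContMDiffAt.comp (g := ι) (e' 1) hιs.contMDiffAt hs
    have h3 : ContMDiffAt 𝓘(ℝ, E) 𝓘(ℝ, E) ∞ e (ι (e'.symm (e' 1))) := by
      rw [he'1, map_one]
      exact contMDiffAt_extChartAt
    exact contMDiffAt_iff_contDiffAt.1 (ContMDiffAt.comp (g := e) (e' 1) h3 h2)
  have hNs : ContDiffAt ℝ ∞ N 0 := by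
    refine (contDiffAt_const.add (𝔪.subtypeL.comp
      (ContinuousLinearMap.fst ℝ 𝔪 F)).contDiff.contDiffAt).prodMk ?_
    refine ContDiffAt.comp (g := fun u => e (ι (e'.symm u))) (f := fun p : 𝔪 × F => e' 1 + p.2)
      0 ?_ (contDiffAt_const.add (by fun_prop))
    simpa using hιe
  have hMd : HasFDerivAt M (ContinuousLinearMap.fst ℝ E E + ContinuousLinearMap.snd ℝ E E)
      (N 0) := by
    obtain ⟨M', hM'⟩ : ∃ M', HasFDerivAt M M' (N 0) :=
      ⟨_, (hM.differentiableAt (by simp)).hasFDerivAt⟩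
    rw [hN0] at hM' ⊢
    have hev : ∀ᶠ u in 𝓝 (e 1), u ∈ e.target :=
      extChartAt_target_mem_nhds (I := 𝓘(ℝ, E)) (1 : G)
    have h1 : M'.comp (ContinuousLinearMap.inl ℝ E E) = .id ℝ E := by
      refine HasFDerivAt.unique (f := fun u => M (u, e 1)) (x := e 1)
        (HasFDerivAt.comp (f := fun u => (u, e 1)) (e 1) hM'
          (hasFDerivAt_prodMk_left (e 1) (e 1))) ?_
      refine (hasFDerivAt_id (e 1)).congr_of_eventuallyEq ?_
      filter_upwards [hev] with u hu
      simp only [M, he1, mul_one]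
      exact e.right_inv hu
    have h2 : M'.comp (ContinuousLinearMap.inr ℝ E E) = .id ℝ E := by
      refine HasFDerivAt.unique (f := fun u => M (e 1, u)) (x := e 1)
        (HasFDerivAt.comp (f := fun u => (e 1, u)) (e 1) hM'
          (hasFDerivAt_prodMk_right (e 1) (e 1))) ?_
      refine (hasFDerivAt_id (e 1)).congr_of_eventuallyEq ?_
      filter_upwards [hev] with u hu
      simp only [M, he1, one_mul]
      exact e.right_inv hu
    have h3 : ContinuousLinearMap.fst ℝ E E + ContinuousLinearMap.snd ℝ E E = M' := by
      refine ContinuousLinearMap.ext fun p => ?_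
      have h4 : M' p = M' (p.1, 0) + M' (0, p.2) := by
        rw [← map_add]
        simp
      rw [h4]
      exact congrArg₂ (· + ·) (DFunLike.congr_fun h1 p.1).symm (DFunLike.congr_fun h2 p.2).symm
    exact h3 ▸ hM'
  have hNd : HasFDerivAt N (𝔪.subtypeL.prodMap A) 0 := by
    refine HasFDerivAt.prodMk ?_ ?_
    · exact (𝔪.subtypeL.comp (ContinuousLinearMap.fst ℝ 𝔪 F)).hasFDerivAt.const_add (e 1)
    · have h1 : HasFDerivAt (fun u => e (ι (e'.symm u))) A (e' 1 + (0 : 𝔪 × F).2) := by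
        rw [Prod.snd_zero, add_zero]
        exact hA.hasFDerivAt_extChartAt (map_one ι)
      exact HasFDerivAt.comp (0 : 𝔪 × F) h1
        ((ContinuousLinearMap.snd ℝ 𝔪 F).hasFDerivAt.const_add (e' 1))
  have hd := hMd.comp (0 : 𝔪 × F) hNd
  have hstrict := ((hM.comp (0 : 𝔪 × F) hNs).hasStrictFDerivAt' hd (by simp))
  have : CompleteSpace E := FiniteDimensional.complete ℝ E
  have : CompleteSpace F := FiniteDimensional.complete ℝ F
  have : CompleteSpace 𝔪 := FiniteDimensional.complete ℝ 𝔪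
  -- In charts the product map has differential (m, φ) ↦ m + A φ, onto because `𝔪` complements the
  -- range of `A`; a submersion maps neighbourhoods onto neighbourhoods.
  have hmap := hstrict.map_nhds_eq_of_surj (by
    rw [eq_top_iff]
    intro ξ _
    obtain ⟨_, ⟨φ, rfl⟩, m, hm, hs⟩ := Submodule.mem_sup.1
      (h𝔪.sup_eq_top ▸ Submodule.mem_top (x := ξ))
    refine ⟨(⟨m, hm⟩, φ), ?_⟩
    rw [← hs]
    exact add_comm _ _)
  have hval : (M ∘ N) 0 = e 1 := by
    simp only [Function.comp, hN0, M, he1, one_mul]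
  rw [hval] at hmap
  have hιc : ContinuousAt (fun p : 𝔪 × F => ι (e'.symm (e' 1 + p.2))) 0 := by
    refine hιs.continuous.continuousAt.comp ?_
    have : ContinuousAt e'.symm (e' 1 + (0 : 𝔪 × F).2) := by
      rw [Prod.snd_zero, add_zero]
      exact continuousAt_extChartAt_symm (I := 𝓘(ℝ, F)) (1 : H)
    exact ContinuousAt.comp (f := fun p : 𝔪 × F => e' 1 + p.2) this (by fun_prop)
  have hsc : ContinuousAt (fun p : 𝔪 × F => e.symm (e 1 + p.1)) 0 := by
    have : ContinuousAt e.symm (e 1 + ((0 : 𝔪 × F).1 : E)) := by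
      rw [Prod.fst_zero, Submodule.coe_zero, add_zero]
      exact continuousAt_extChartAt_symm (I := 𝓘(ℝ, E)) (1 : G)
    exact ContinuousAt.comp (f := fun p : 𝔪 × F => e 1 + (p.1 : E)) this (by fun_prop)
  have hs1 : e.source ∈ 𝓝 (1 : G) := extChartAt_source_mem_nhds (I := 𝓘(ℝ, E)) (1 : G)
  have hw : ∀ᶠ p in 𝓝 (0 : 𝔪 × F), p.1 ∈ U ∧ ι (e'.symm (e' 1 + p.2)) ∈ e.source ∧
      e.symm (e 1 + p.1) * ι (e'.symm (e' 1 + p.2)) ∈ e.source := by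
    refine (continuousAt_fst.eventually_mem hU).and ((hιc.eventually_mem ?_).and
      ((hsc.mul hιc).eventually_mem ?_))
    · simpa [he'1] using hs1
    · simpa [he'1, he1] using hs1
  have h1 : ∀ᶠ u in 𝓝 (e 1), ∃ p : 𝔪 × F, (M ∘ N) p = u ∧ p.1 ∈ U ∧
      ι (e'.symm (e' 1 + p.2)) ∈ e.source ∧
      e.symm (e 1 + p.1) * ι (e'.symm (e' 1 + p.2)) ∈ e.source := by
    rw [← hmap]
    exact Filter.eventually_map.2 (hw.mono fun p hp => ⟨p, rfl, hp⟩)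
  filter_upwards [(continuousAt_extChartAt (I := 𝓘(ℝ, E)) (1 : G)).eventually h1, hs1]
    with g ⟨p, hp, hpU, hp1, hp2⟩ hg
  refine ⟨p.1, hpU, e'.symm (e' 1 + p.2), e.injOn hg hp2 ?_⟩
  rw [← show (M ∘ N) p = e g from hp]
  simp only [M, N, Function.comp]
  rw [e.left_inv hp1]

/-- Near the image of `H` a space with small annihilator already separates: restricted to a slice
transverse to 𝔥 its functions form an immersion at 0. The remaining set is compact, and finitely
many further spaces separate its points from 1. -/
theorem exists_isQuotientSpace_separating (hιs : ContMDiff 𝓘(ℝ, F) 𝓘(ℝ, E) ∞ ι)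
    (hinj : Function.Injective ι)
    (hA : HasMFDerivAt 𝓘(ℝ, F) 𝓘(ℝ, E) ι 1 A) (hAinj : Function.Injective A) :
    ∃ 𝒜 : Submodule ℝ C(G, ℝ), IsQuotientSpace ι 𝒜 ∧
      annihilator E 𝒜 ≤ LinearMap.range A.toLinearMap ∧
      ∀ g, (∀ a ∈ 𝒜, a g = a 1) → g ∈ ι.range := by
  have hι := hιs.continuous
  obtain ⟨𝒜, h𝒜, hann⟩ := exists_annihilator_le_range hι hinj hA hAinj
  obtain ⟨𝔪, h𝔪⟩ := Submodule.exists_isCompl (LinearMap.range A.toLinearMap)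
  let e := extChartAt 𝓘(ℝ, E) (1 : G)
  have he1 : e.symm (e 1) = 1 := extChartAt_to_inv (I := 𝓘(ℝ, E)) (1 : G)
  have := h𝒜.finite
  let b := Module.finBasis ℝ 𝒜
  let α : G → Fin (Module.finrank ℝ 𝒜) → ℝ := fun g i => (b i : C(G, ℝ)) g
  let α' : E →L[ℝ] (Fin (Module.finrank ℝ 𝒜) → ℝ) := ContinuousLinearMap.pi fun i =>
    (mfderiv 𝓘(ℝ, E) 𝓘(ℝ, ℝ) (b i : C(G, ℝ)) 1 : E →L[ℝ] ℝ)
  have hα : HasFDerivAt (fun m : 𝔪 => α (e.symm (e 1 + m))) (α'.comp 𝔪.subtypeL) 0 := by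
    refine hasFDerivAt_pi'' fun i => ?_
    have h1 := (h𝒜.hasMFDerivAt (E := E) (b i).2 1).hasFDerivAt_extChartAt rfl
    simp only [extChartAt_model_space_eq_id] at h1
    have h2 : HasFDerivAt (fun u => (b i : C(G, ℝ)) (e.symm u))
        (mfderiv 𝓘(ℝ, E) 𝓘(ℝ, ℝ) (b i : C(G, ℝ)) 1 : E →L[ℝ] ℝ) (e 1 + ((0 : 𝔪) : E)) := by
      rw [Submodule.coe_zero, add_zero]
      exact h1
    exact HasFDerivAt.comp (0 : 𝔪) h2 (𝔪.subtypeL.hasFDerivAt.const_add (e 1))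
  have hinj' : LinearMap.ker (α'.comp 𝔪.subtypeL).toLinearMap = ⊥ := by
    refine LinearMap.ker_eq_bot'.2 fun m hm => ?_
    have h1 : (m : E) ∈ annihilator E 𝒜 := mem_annihilator.2 fun a ha =>
      mfderiv_apply_eq_zero_of_basis h𝒜 b (fun i => congrFun hm i) a ha
    exact Subtype.ext ((Submodule.disjoint_def.1 h𝔪.disjoint) _ (hann h1) m.2)
  have hne : ∀ᶠ m : 𝔪 in 𝓝[≠] 0, α (e.symm (e 1 + m)) ≠ α 1 := by
    obtain ⟨C, -, hC⟩ := (α'.comp 𝔪.subtypeL).toLinearMap.exists_antilipschitzWith hinj'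
    exact hα.eventually_ne ⟨C, hC⟩
  have hU := eventually_exists_slice_mul hA hιs h𝔪 (eventually_nhdsWithin_iff.1 hne)
  obtain ⟨U, hU, hUo, hU1⟩ := eventually_nhds_iff.1 hU
  -- Right saturation by `H` is harmless, since the functions in `𝒜` are invariant under it.
  let Ω : Set G := ⋃ h, (fun g => g * ι h) ⁻¹' U
  have hΩo : IsOpen Ω := isOpen_iUnion fun h => hUo.preimage (continuous_mul_const _)
  have hΩ : ∀ g ∈ Ω, (∀ a ∈ 𝒜, a g = a 1) → g ∈ ι.range := by
    intro g hg ha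
    obtain ⟨h, hg⟩ := Set.mem_iUnion.1 hg
    obtain ⟨m, hm, k, hk⟩ := hU _ hg
    have h1 : α (e.symm (e 1 + m)) = α 1 := by
      funext i
      change (b i : C(G, ℝ)) (e.symm (e 1 + m)) = (b i : C(G, ℝ)) 1
      rw [← ha (b i) (b i).2, ← h𝒜.apply_mul _ (b i).2 g h, show g * ι h = _ from hk,
        h𝒜.apply_mul _ (b i).2]
    have hm0 : m = 0 := by
      by_contra hm0
      exact hm hm0 h1
    rw [hm0, Submodule.coe_zero, add_zero, he1, one_mul] at hk
    refine ⟨k * h⁻¹, ?_⟩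
    rw [map_mul, ← show g * ι h = _ from hk, map_inv, mul_inv_cancel_right]
  have hcpt : IsCompact Ωᶜ := hΩo.isClosed_compl.isCompact
  obtain ⟨𝒜', h𝒜', hsep⟩ : ∃ 𝒜' : Submodule ℝ C(G, ℝ), IsQuotientSpace ι 𝒜' ∧
      ∀ g ∈ Ωᶜ, ∃ a ∈ 𝒜', a g ≠ a 1 := by
    refine hcpt.induction_on (p := fun s => ∃ 𝒜' : Submodule ℝ C(G, ℝ), IsQuotientSpace ι 𝒜' ∧
      ∀ g ∈ s, ∃ a ∈ 𝒜', a g ≠ a 1) ⟨⊥, .bot ι, by simp⟩ ?_ ?_ ?_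
    · rintro s t hst ⟨𝒜', h1, h2⟩
      exact ⟨𝒜', h1, fun g hg => h2 g (hst hg)⟩
    · rintro s t ⟨𝒜₁, h1, h2⟩ ⟨𝒜₂, h3, h4⟩
      refine ⟨𝒜₁ ⊔ 𝒜₂, h1.sup h3, fun g hg => ?_⟩
      rcases hg with hg | hg
      · obtain ⟨a, ha, h⟩ := h2 g hg
        exact ⟨a, Submodule.mem_sup_left ha, h⟩
      · obtain ⟨a, ha, h⟩ := h4 g hg
        exact ⟨a, Submodule.mem_sup_right ha, h⟩
    · intro g hg
      have hg' : g ∉ ι.range := by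
        rintro ⟨h, rfl⟩
        refine hg (Set.mem_iUnion.2 ⟨h⁻¹, ?_⟩)
        simpa using hU1
      obtain ⟨𝒜', h1, a, ha, hne⟩ := IsQuotientSpace.exists_apply_ne hι hg'
      exact ⟨_, mem_nhdsWithin_of_mem_nhds (a.continuous.continuousAt.eventually_ne hne), 𝒜', h1,
        fun g' hg' => ⟨a, ha, hg'⟩⟩
  refine ⟨𝒜 ⊔ 𝒜', h𝒜.sup h𝒜', fun ξ hξ => hann (mem_annihilator.2 fun a ha =>
    mem_annihilator.1 hξ a (Submodule.mem_sup_left ha)), fun g hg => ?_⟩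
  by_cases hgΩ : g ∈ Ω
  · exact hΩ g hgΩ fun a ha => hg a (Submodule.mem_sup_left ha)
  · obtain ⟨a, ha, hne⟩ := hsep g hgΩ
    exact absurd (hg a (Submodule.mem_sup_right ha)) hne

end Separation

/-! ### Bilinear operations on equivariant maps -/

section Bilinear

variable {G : Type*} [TopologicalSpace G] [Group G] [IsTopologicalGroup G]
  {W W' W'' : Type*} [NormedAddCommGroup W] [NormedSpace ℝ W] [FiniteDimensional ℝ W]
  [NormedAddCommGroup W'] [NormedSpace ℝ W'] [FiniteDimensional ℝ W']
  [NormedAddCommGroup W''] [NormedSpace ℝ W'']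

/-- The pointwise application of a bilinear map to two functions. -/
noncomputable def ContinuousMap.bilin (T : W →ₗ[ℝ] W' →ₗ[ℝ] W'') :
    C(G, W) →ₗ[ℝ] C(G, W') →ₗ[ℝ] C(G, W'') :=
  LinearMap.mk₂ ℝ (fun f f' => ⟨fun g => T.toContinuousBilinearMap (f g) (f' g), by fun_prop⟩)
    (fun _ _ _ => by ext; simp) (fun _ _ _ => by ext; simp) (fun _ _ _ => by ext; simp)
    (fun _ _ _ => by ext; simp)

@[simp] theorem ContinuousMap.bilin_apply (T : W →ₗ[ℝ] W' →ₗ[ℝ] W'') (f : C(G, W))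
    (f' : C(G, W')) (g : G) : ContinuousMap.bilin T f f' g = T (f g) (f' g) := rfl

theorem bilin_mem_leftFinite (T : W →ₗ[ℝ] W' →ₗ[ℝ] W'') {f : C(G, W)} {f' : C(G, W')}
    (hf : f ∈ leftFinite G W) (hf' : f' ∈ leftFinite G W') :
    ContinuousMap.bilin T f f' ∈ leftFinite G W'' := by
  obtain ⟨𝒲, h1, h2, h3⟩ := hf
  obtain ⟨𝒲', h1', h2', h3'⟩ := hf'
  refine ⟨Submodule.map₂ (ContinuousMap.bilin T) 𝒲 𝒲', ?_, fun x => ?_,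
    Submodule.apply_mem_map₂ _ h3 h3'⟩
  · rw [← Submodule.fg_iff_finiteDimensional] at h1 h1' ⊢
    exact h1.map₂ _ h1'
  · change Submodule.map₂ _ _ _ ≤ (Submodule.map₂ _ _ _).comap (leftTranslate x)
    exact Submodule.map₂_le.2 fun a ha b hb =>
      Submodule.apply_mem_map₂ (ContinuousMap.bilin T) (h2 x a ha) (h2' x b hb)

theorem bilin_mem_equivariantMaps {H : Type*} [Group H] {ι : H →* G} {τ : H →* (W →L[ℝ] W)}
    {τ' : H →* (W' →L[ℝ] W')} {τ'' : H →* (W'' →L[ℝ] W'')} (T : W →ₗ[ℝ] W' →ₗ[ℝ] W'')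
    (hT : ∀ h v w, T (τ h v) (τ' h w) = τ'' h (T v w)) {f : C(G, W)} {f' : C(G, W')}
    (hf : f ∈ equivariantMaps ι τ) (hf' : f' ∈ equivariantMaps ι τ') :
    ContinuousMap.bilin T f f' ∈ equivariantMaps ι τ'' := by
  intro g h
  rw [ContinuousMap.bilin_apply, hf, hf', hT, ContinuousMap.bilin_apply]

theorem exists_isQuotientSpace_forall_mem {H : Type*} [TopologicalSpace H] [Group H]
    [IsTopologicalGroup H] [CompactSpace H] [CompactSpace G] [T2Space G] {ι : H →* G}
    {κ : Type*} [Finite κ] (c : κ → C(G, ℝ))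
    (hc : ∀ r, c r ∈ equivariantMaps ι (1 : H →* (ℝ →L[ℝ] ℝ)) ⊓ leftFinite G ℝ) :
    ∃ 𝒜 : Submodule ℝ C(G, ℝ), IsQuotientSpace ι 𝒜 ∧ ∀ r, c r ∈ 𝒜 := by
  choose 𝒜 hle hfin hinv hmem using fun r => exists_leftInvariant_of_mem_inf (hc r)
  refine ⟨⨆ r, 𝒜 r, ⟨Submodule.finiteDimensional_iSup _, IsLeftInvariant.iSup hinv,
    fun b hb g h => ?_⟩, fun r => Submodule.mem_iSup_of_mem r (hmem r)⟩
  have := (iSup_le hle : ⨆ r, 𝒜 r ≤ _) hb g h⁻¹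
  rwa [map_inv, inv_inv] at this

end Bilinear

/-! ### Orbits of compact groups are real algebraic -/

section PolynomialOrbit

open MeasureTheory MvPolynomial
open scoped Matrix

variable {G : Type*} [TopologicalSpace G] [Group G] [IsTopologicalGroup G] [CompactSpace G]
  [T2Space G] {n : ℕ}

/-- Substituting A(g) w into `p` gives a polynomial in `w` with coefficients continuous in `g`,
namely `P`; its coefficients are integrated. -/
theorem exists_polynomial_mean [MeasurableSpace G] [BorelSpace G] (μ : Measure G)
    [IsFiniteMeasure μ] {A : G → Matrix (Fin n) (Fin n) ℝ}
    (hA : Continuous A) (p : MvPolynomial (Fin n) ℝ) :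
    ∃ q : MvPolynomial (Fin n) ℝ, ∀ w, eval w q = ∫ g, eval (A g *ᵥ w) p ∂μ := by
  let a : Fin n → Fin n → C(G, ℝ) := fun i k => ⟨fun g => A g i k, by fun_prop⟩
  let P : MvPolynomial (Fin n) C(G, ℝ) := aeval (fun i => ∑ k, C (a i k) * X k) p
  have hP : ∀ g w, eval (A g *ᵥ w) p =
      ∑ d ∈ P.support, (P.coeff d) g * ∏ i, w i ^ d i := by
    intro g w
    let ev : C(G, ℝ) →+* ℝ := (ContinuousMap.evalAlgHom ℝ ℝ g : C(G, ℝ) →ₐ[ℝ] ℝ)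
    have h1 : eval₂ ev w P = ∑ d ∈ P.support, (P.coeff d) g * ∏ i, w i ^ d i := by
      rw [eval₂_eq']
      rfl
    rw [← h1]
    have h2 : ∀ p : MvPolynomial (Fin n) ℝ,
        eval (A g *ᵥ w) p = eval₂ ev w (aeval (fun i => ∑ k, C (a i k) * X k) p) := by
      intro p
      induction p using MvPolynomial.induction_on with
      | C r =>
        rw [algHom_C, IsScalarTower.algebraMap_apply ℝ C(G, ℝ) (MvPolynomial (Fin n) C(G, ℝ)),
          MvPolynomial.algebraMap_eq, eval₂_C, eval_C]
        rfl
      | add p q hp hq => rw [map_add, map_add, eval₂_add, hp, hq]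
      | mul_X p i hp =>
        rw [map_mul, map_mul, eval₂_mul, aeval_X, eval_X, hp, eval₂_sum]
        simp only [eval₂_mul, eval₂_C, eval₂_X]
        rfl
    exact h2 p
  refine ⟨∑ d ∈ P.support, monomial d (∫ g, (P.coeff d) g ∂μ), fun w => ?_⟩
  simp only [hP, map_sum, eval_monomial]
  rw [integral_finsetSum _ fun d _ => integrable_of_continuous μ (by fun_prop)]
  refine Finset.sum_congr rfl fun d _ => ?_
  rw [integral_mul_const, Finsupp.prod_fintype _ _ (by simp)]

/-- The orbit of a vector under a continuous matrix representation of a compact group is a real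
algebraic set. -/
theorem exists_polynomial_separating_orbits {A : G → Matrix (Fin n) (Fin n) ℝ}
    (hA : Continuous A) (hmul : ∀ x y, A (x * y) = A x * A y) (hone : A 1 = 1)
    {u w : Fin n → ℝ} (hu : ∀ g, A g *ᵥ w ≠ u) :
    ∃ p : MvPolynomial (Fin n) ℝ, (∀ g, eval (A g *ᵥ w) p = 0) ∧ eval u p ≠ 0 := by
  borelize G
  obtain ⟨μ, _, _⟩ := exists_isHaarMeasure_isProbabilityMeasure G
  have hcw : Continuous fun g => A g *ᵥ w := by fun_prop
  have hcu : Continuous fun g => A g *ᵥ u := by fun_prop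
  have hAinv : ∀ g, A g⁻¹ * A g = 1 := fun g => by rw [← hmul, inv_mul_cancel, hone]
  -- A continuous function separating the two disjoint compact orbits is replaced by a polynomial
  -- within 1/4 (Stone–Weierstrass), then averaged over `G`. The mean is invariant, at most 1/4 on
  -- the first orbit and at least 3/4 on the second.
  obtain ⟨χ, hχ0, hχ1, -⟩ := exists_continuous_zero_one_of_isClosed
    (isCompact_range hcw).isClosed (isCompact_range hcu).isClosed (by
      rw [Set.disjoint_left]
      rintro _ ⟨g, rfl⟩ ⟨k, hk⟩
      refine hu (k⁻¹ * g) ?_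
      rw [hmul, ← Matrix.mulVec_mulVec, ← show A k *ᵥ u = A g *ᵥ w from hk, Matrix.mulVec_mulVec,
        hAinv, Matrix.one_mulVec])
  let coord : Fin n → C(Fin n → ℝ, ℝ) := fun i => ⟨fun v => v i, by fun_prop⟩
  let pol : MvPolynomial (Fin n) ℝ →ₐ[ℝ] C(Fin n → ℝ, ℝ) := aeval coord
  have hpol : ∀ p v, pol p v = eval v p := by
    intro p v
    induction p using MvPolynomial.induction_on with
    | C r => simp [pol]
    | add p q hp hq => simp [hp, hq]
    | mul_X p i hp => simp [hp, pol, coord]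
  obtain ⟨_, ⟨p, rfl⟩, hp⟩ :=
    ContinuousMap.exists_mem_subalgebra_near_continuous_of_isCompact_of_separatesPoints
    (A := pol.range) (by
      intro x y hxy
      obtain ⟨i, hi⟩ := Function.ne_iff.1 hxy
      exact ⟨coord i, ⟨coord i, ⟨X i, by simp [pol]⟩, rfl⟩, hi⟩) χ
    ((isCompact_range hcw).union (isCompact_range hcu)) (ε := 1 / 4) (by norm_num)
  obtain ⟨q, hq⟩ := exists_polynomial_mean μ (A := fun g => A g⁻¹) (by fun_prop) p
  have hqinv : ∀ x v, eval (A x *ᵥ v) q = eval v q := by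
    intro x v
    rw [hq, hq, ← integral_mul_left_eq_self _ x]
    refine integral_congr_ae (Filter.Eventually.of_forall fun g => ?_)
    simp only [mul_inv_rev, Matrix.mulVec_mulVec, ← hmul, inv_mul_cancel_right]
  have hle : ∀ v c, (∀ g, |eval (A g⁻¹ *ᵥ v) p - c| ≤ 1 / 4) → |eval v q - c| ≤ 1 / 4 := by
    intro v c h
    have h1 : eval v q - c = ∫ g, (eval (A g⁻¹ *ᵥ v) p - c) ∂μ := by
      rw [integral_sub (integrable_of_continuous μ ?_) (integrable_const c), hq]
      · simp
      · simp only [← hpol]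
        fun_prop
    rw [h1, ← Real.norm_eq_abs]
    refine (norm_integral_le_of_norm_le_const (Filter.Eventually.of_forall h)).trans ?_
    simp
  have h0 := hle w 0 fun g => by
    have := hp _ (Or.inl ⟨g⁻¹, rfl⟩)
    rw [show pol.toRingHom p = pol p from rfl, hpol, hχ0 ⟨g⁻¹, rfl⟩] at this
    exact this.le
  have h1 := hle u 1 fun g => by
    have := hp _ (Or.inr ⟨g⁻¹, rfl⟩)
    rw [show pol.toRingHom p = pol p from rfl, hpol, hχ1 ⟨g⁻¹, rfl⟩] at this
    exact this.le
  refine ⟨q - C (eval w q), fun g => by simp [hqinv], ?_⟩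
  rw [map_sub, eval_C, sub_ne_zero]
  intro h
  rw [abs_le] at h0 h1
  linarith [h0.2, h1.1]

/-- The points (a_i(g)) form the orbit of (a_i(1)) under the matrices of left translation in the
basis `a`. -/
theorem exists_polynomial_separating {a : Fin n → C(G, ℝ)} (hlin : LinearIndependent ℝ a)
    (hinv : IsLeftInvariant (Submodule.span ℝ (Set.range a))) {u : Fin n → ℝ}
    (hu : ∀ g, (fun i => a i g) ≠ u) :
    ∃ p : MvPolynomial (Fin n) ℝ, (∀ g, eval (fun i => a i g) p = 0) ∧ eval u p ≠ 0 := by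
  let b := Module.Basis.span hlin
  have hb : ∀ i, (b i : C(G, ℝ)) = a i := fun i =>
    congrArg Subtype.val (Module.Basis.span_apply hlin i)
  have ha : ∀ i, a i ∈ Submodule.span ℝ (Set.range a) := fun i => Submodule.subset_span ⟨i, rfl⟩
  let L : G → Fin n → Submodule.span ℝ (Set.range a) := fun x i =>
    ⟨leftTranslate x (a i), hinv x _ (ha i)⟩
  let A : G → Matrix (Fin n) (Fin n) ℝ := fun x => .of fun i k => b.repr (L x i) k
  have hfd : FiniteDimensional ℝ (Submodule.span ℝ (Set.range a)) :=
    FiniteDimensional.span_of_finite ℝ (Set.finite_range a)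
  have hA : Continuous A := by
    refine continuous_matrix fun i k => ?_
    have h1 : Continuous (b.coord k) := LinearMap.continuous_of_finiteDimensional _
    exact h1.comp ((continuous_leftTranslate (a i)).subtype_mk _)
  have hL : ∀ x i, leftTranslate x (a i) = ∑ k, A x i k • a k := by
    intro x i
    have := congrArg Subtype.val (b.sum_repr (L x i))
    rw [AddSubmonoidClass.coe_finsetSum] at this
    simp only [Submodule.coe_smul, hb] at this
    exact this.symm
  have huniq : ∀ c c' : Fin n → ℝ, ∑ k, c k • a k = ∑ k, c' k • a k → c = c' := by
    intro c c' h
    have h1 : ∑ k, (c k - c' k) • a k = 0 := by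
      simp only [sub_smul, Finset.sum_sub_distrib, h, sub_self]
    funext k
    exact sub_eq_zero.1 (Fintype.linearIndependent_iff.1 hlin _ h1 k)
  have hone : A 1 = 1 := by
    ext i k
    refine congrFun (huniq (A 1 i) ((1 : Matrix (Fin n) (Fin n) ℝ) i) ?_) k
    rw [← hL]
    ext g
    simp [Matrix.one_apply]
  -- Left translation reverses products; writing the coefficients as rows reverses them again.
  have hmul : ∀ x y, A (x * y) = A x * A y := by
    intro x y
    ext i k
    refine congrFun (huniq (A (x * y) i) ((A x * A y) i) ?_) k
    rw [← hL]
    have h1 : leftTranslate (x * y) (a i) = leftTranslate y (leftTranslate x (a i)) := by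
      ext g
      simp [mul_assoc]
    rw [h1, hL, map_sum]
    simp only [map_smul, hL, Matrix.mul_apply, Finset.sum_smul, Finset.smul_sum, smul_smul]
    exact Finset.sum_comm
  have horb : ∀ g, (fun i => a i g) = A g *ᵥ fun i => a i 1 := by
    intro g
    funext i
    have := DFunLike.congr_fun (hL g i) 1
    rw [leftTranslate_apply, mul_one] at this
    rw [this]
    simp [Matrix.mulVec, dotProduct]
  obtain ⟨p, h1, h2⟩ := exists_polynomial_separating_orbits hA hmul hone
    (w := fun i => a i 1) (u := u) fun g => by
      rw [← horb]
      exact hu g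
  refine ⟨p, fun g => ?_, h2⟩
  rw [horb]
  exact h1 g

end PolynomialOrbit

/-! ### The embedding defined by an equivariant frame -/

section FrameMap

variable {G : Type*} [TopologicalSpace G] [Group G] [IsTopologicalGroup G] [CompactSpace G]
  [T2Space G] {H : Type*} [Group H]
  {V : Type*} [NormedAddCommGroup V] [NormedSpace ℝ V] [FiniteDimensional ℝ V]
  {ι : H →* G} {τ : H →* (V →L[ℝ] V)} {n m : ℕ}
  {𝒜 : Submodule ℝ C(G, ℝ)} (b : Module.Basis (Fin n) ℝ 𝒜)
  (B : V →ₗ[ℝ] V →ₗ[ℝ] ℝ) (f : Fin m → C(G, V)) {S : V →ₗ[ℝ] V}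

/-- The map of `G × V` to Euclidean space whose components are the functions of a basis of `𝒜`
and the inner products with the members of an equivariant frame. -/
noncomputable def frameMap (p : G × V) : Fin n ⊕ Fin m → ℝ :=
  Sum.elim (fun i => (b i : C(G, ℝ)) p.1) (fun j => B p.2 (f j p.1))

theorem frameMap_inl (p : G × V) (i : Fin n) :
    frameMap b B f p (Sum.inl i) = (b i : C(G, ℝ)) p.1 := rfl

theorem frameMap_inr (p : G × V) (j : Fin m) :
    frameMap b B f p (Sum.inr j) = B p.2 (f j p.1) := rfl

theorem continuous_frameMap : Continuous (frameMap b B f) := by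
  refine continuous_pi fun s => ?_
  rcases s with i | j
  · exact (b i : C(G, ℝ)).continuous.comp continuous_fst
  · exact B.continuous_apply_apply continuous_snd ((f j).continuous.comp continuous_fst)

variable {b B f}

theorem eq_of_forall_frame (hS : ∀ g v, ∑ j, B v (f j g) • S (f j g) = v) {g : G} {v w : V}
    (h : ∀ j, B v (f j g) = B w (f j g)) : v = w := by
  rw [← hS g v, ← hS g w]
  simp only [h]

/-- The frame recovers `v` continuously from `g` and the coordinates, and `g` ranges over a compact
group; so preimages of compact sets are compact. -/
theorem isClosedMap_frameMap (hS : ∀ g v, ∑ j, B v (f j g) • S (f j g) = v) :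
    IsClosedMap (frameMap b B f) := by
  refine IsProperMap.isClosedMap (isProperMap_iff_isCompact_preimage.2
    ⟨continuous_frameMap b B f, fun K hK => ?_⟩)
  let r : G × (Fin n ⊕ Fin m → ℝ) → G × V := fun p =>
    (p.1, ∑ j, p.2 (Sum.inr j) • S (f j p.1))
  have hr : Continuous r := by
    have : Continuous S := LinearMap.continuous_of_finiteDimensional S
    fun_prop
  refine ((isCompact_univ.prod hK).image hr).of_isClosed_subset
    (hK.isClosed.preimage (continuous_frameMap b B f)) fun p hp => ?_
  exact ⟨(p.1, frameMap b B f p), ⟨Set.mem_univ _, hp⟩, Prod.ext rfl (hS p.1 p.2)⟩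

theorem frameMap_act (h𝒜 : IsQuotientSpace ι 𝒜) (hBτ : ∀ h x y, B (τ h x) (τ h y) = B x y)
    (hf : ∀ j, f j ∈ equivariantMaps ι τ) (h : H) (g : G) (v : V) :
    frameMap b B f (g * (ι h)⁻¹, τ h v) = frameMap b B f (g, v) := by
  funext s
  rcases s with i | j
  · rw [frameMap_inl, frameMap_inl, ← map_inv]
    exact h𝒜.apply_mul _ (b i).2 _ _
  · rw [frameMap_inr, frameMap_inr]
    dsimp only
    rw [hf j, hBτ]

/-- Equality of the base coordinates, translated by g⁻¹, puts g⁻¹ g' in the image of `H`. After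
moving by that element both points lie over g', where the frame determines the vector. -/
theorem exists_eq_of_frameMap_eq (h𝒜 : IsQuotientSpace ι 𝒜)
    (hBτ : ∀ h x y, B (τ h x) (τ h y) = B x y)
    (hf : ∀ j, f j ∈ equivariantMaps ι τ) (hsep : ∀ g, (∀ a ∈ 𝒜, a g = a 1) → g ∈ ι.range)
    (hS : ∀ g v, ∑ j, B v (f j g) • S (f j g) = v) {g g' : G} {v v' : V}
    (h : frameMap b B f (g, v) = frameMap b B f (g', v')) :
    ∃ h : H, (g * (ι h)⁻¹, τ h v) = (g', v') := by
  have h1 : ∀ a ∈ 𝒜, a g = a g' := by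
    intro a ha
    have h2 := congrArg Subtype.val (b.sum_repr ⟨a, ha⟩)
    rw [AddSubmonoidClass.coe_finsetSum] at h2
    dsimp only at h2
    rw [← h2]
    simp only [Submodule.coe_smul, ContinuousMap.sum_apply, ContinuousMap.smul_apply]
    exact Finset.sum_congr rfl fun i _ => congrArg _ (congrFun h (Sum.inl i))
  obtain ⟨k, hk⟩ := hsep (g⁻¹ * g') fun a ha => by
    have := h1 _ (h𝒜.inv g⁻¹ a ha)
    rw [leftTranslate_apply, leftTranslate_apply, inv_mul_cancel] at this
    exact this.symm
  have hg : g * (ι k⁻¹)⁻¹ = g' := by simp [hk]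
  refine ⟨k⁻¹, Prod.ext hg (eq_of_forall_frame hS (g := g') fun j => ?_)⟩
  dsimp only
  conv_lhs => rw [← hg, hf j, hBτ]
  exact congrFun h (Sum.inr j)

open MvPolynomial in
theorem exists_linear_polynomial (b : Module.Basis (Fin n) ℝ 𝒜) {c : C(G, ℝ)} (hc : c ∈ 𝒜) :
    ∃ ℓ : MvPolynomial (Fin n) ℝ, ∀ g, eval (fun i => (b i : C(G, ℝ)) g) ℓ = c g := by
  refine ⟨∑ i, C (b.repr ⟨c, hc⟩ i) * X i, fun g => ?_⟩
  have h2 := congrArg Subtype.val (b.sum_repr ⟨c, hc⟩)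
  rw [AddSubmonoidClass.coe_finsetSum] at h2
  dsimp only at h2
  conv_rhs => rw [← h2]
  simp

open MvPolynomial in
/-- The image of `G × C` is a real algebraic set if `C` is defined by a polynomial on the image
of `G × V`. -/
theorem exists_polynomial_separating_frameMap (h𝒜 : IsQuotientSpace ι 𝒜)
    (hS : ∀ g v, ∑ j, B v (f j g) • S (f j g) = v)
    {P : Fin m → Fin m → C(G, ℝ)} (hP𝒜 : ∀ j k, P j k ∈ 𝒜)
    (hP : ∀ j k g, P j k g = B (S (f k g)) (f j g))
    {C : Set V} {R : MvPolynomial (Fin n ⊕ Fin m) ℝ}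
    (hR : ∀ g v, eval (frameMap b B f (g, v)) R = 0 ↔ v ∈ C)
    {w : Fin n ⊕ Fin m → ℝ} (hw : ∀ g, ∀ v ∈ C, frameMap b B f (g, v) ≠ w) :
    ∃ p, (∀ g, ∀ v ∈ C, eval (frameMap b B f (g, v)) p = 0) ∧ eval w p ≠ 0 := by
  -- A point outside the image can fail in three ways: its base part is not in the orbit; its fibre
  -- part is not the coordinate vector of an element of `V`; or that element is not in `C`.
  by_cases h1 : ∀ g, (fun i => (b i : C(G, ℝ)) g) ≠ fun i => w (Sum.inl i)
  · have hspan : Submodule.span ℝ (Set.range fun i => (b i : C(G, ℝ))) = 𝒜 := by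
      have := congrArg (Submodule.map 𝒜.subtype) b.span_eq
      rw [Submodule.map_span, Submodule.map_top, Submodule.range_subtype, ← Set.range_comp] at this
      exact this
    obtain ⟨p, hp, hpw⟩ := exists_polynomial_separating (a := fun i => (b i : C(G, ℝ)))
      (b.linearIndependent.map' 𝒜.subtype 𝒜.ker_subtype) (by rw [hspan]; exact h𝒜.inv) h1
    refine ⟨rename Sum.inl p, fun g v _ => ?_, ?_⟩
    · rw [eval_rename]
      exact hp g
    · rw [eval_rename]
      exact hpw
  push Not at h1
  obtain ⟨g, hg⟩ := h1
  choose ℓ hℓ using fun j k => exists_linear_polynomial b (hP𝒜 j k)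
  -- Expanding v = Σ y_k S f_k(g) gives y = P(g) y for the frame coordinates y of `v`. The entries
  -- of `P` are in `𝒜`, hence linear in the base coordinates, so these equations are polynomial.
  let r : Fin m → MvPolynomial (Fin n ⊕ Fin m) ℝ := fun j =>
    X (Sum.inr j) - ∑ k, rename Sum.inl (ℓ j k) * X (Sum.inr k)
  have hr : ∀ g v j, eval (frameMap b B f (g, v)) (r j) = 0 := by
    intro g v j
    simp only [r, map_sub, map_sum, map_mul, eval_X, eval_rename, frameMap_inr]
    rw [sub_eq_zero]
    conv_lhs => rw [← hS g v]
    rw [map_sum, LinearMap.sum_apply]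
    refine Finset.sum_congr rfl fun k _ => ?_
    have h2 : eval (frameMap b B f (g, v) ∘ Sum.inl) (ℓ j k) = P j k g := hℓ j k g
    rw [h2, hP, map_smul, LinearMap.smul_apply, smul_eq_mul, mul_comm]
  by_cases h2 : ∃ j, eval w (r j) ≠ 0
  · obtain ⟨j, hj⟩ := h2
    exact ⟨r j, fun g v _ => hr g v j, hj⟩
  push Not at h2
  let v := ∑ k, w (Sum.inr k) • S (f k g)
  have hv : frameMap b B f (g, v) = w := by
    funext s
    rcases s with i | j
    · exact congrFun hg i
    · have h3 := h2 j
      simp only [r, map_sub, map_sum, map_mul, eval_X, eval_rename] at h3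
      rw [sub_eq_zero] at h3
      rw [frameMap_inr, h3, map_sum, LinearMap.sum_apply]
      refine Finset.sum_congr rfl fun k _ => ?_
      have h4 : eval (w ∘ Sum.inl) (ℓ j k) = P j k g := by
        rw [← hℓ j k g, hg]
        rfl
      rw [h4, hP, map_smul, LinearMap.smul_apply, smul_eq_mul, mul_comm]
  refine ⟨R, fun g v hv => (hR g v).2 hv, fun h => hw g v ?_ hv⟩
  rwa [← hv, hR] at h

end FrameMap

/-! ### Smoothness of the frame map and the kernel of its differential. -/

section FrameMapSmooth

variable {E : Type*} [NormedAddCommGroup E] [NormedSpace ℝ E] [FiniteDimensional ℝ E]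
  {G : Type*} [TopologicalSpace G] [ChartedSpace E G] [Group G] [LieGroup 𝓘(ℝ, E) ∞ G]
  [IsTopologicalGroup G] [CompactSpace G] [T2Space G]
  {F : Type*} [NormedAddCommGroup F] [NormedSpace ℝ F]
  {H : Type*} [TopologicalSpace H] [ChartedSpace F H] [Group H] [LieGroup 𝓘(ℝ, F) ∞ H]
  [FiniteDimensional ℝ F] [IsTopologicalGroup H] [CompactSpace H]
  {V : Type*} [NormedAddCommGroup V] [NormedSpace ℝ V] [FiniteDimensional ℝ V]
  {ι : H →* G} {τ : H →* (V →L[ℝ] V)} {n m : ℕ} {A : F →L[ℝ] E}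
  {𝒜 : Submodule ℝ C(G, ℝ)} {b : Module.Basis (Fin n) ℝ 𝒜}
  {B : V →ₗ[ℝ] V →ₗ[ℝ] ℝ} {f : Fin m → C(G, V)} {S : V →ₗ[ℝ] V}

theorem contMDiff_frameMap (h𝒜 : IsQuotientSpace ι 𝒜)
    (hf : IsLeftInvariant (Submodule.span ℝ (Set.range f))) :
    ContMDiff (𝓘(ℝ, E).prod 𝓘(ℝ, V)) 𝓘(ℝ, Fin n ⊕ Fin m → ℝ) ∞ (frameMap b B f) := by
  refine contMDiff_pi_space.2 fun s => ?_
  rcases s with i | j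
  · exact (h𝒜.contMDiff (b i).2).comp contMDiff_fst
  · have hfd : FiniteDimensional ℝ (Submodule.span ℝ (Set.range f)) :=
      FiniteDimensional.span_of_finite ℝ (Set.finite_range f)
    have : CompleteSpace V := FiniteDimensional.complete ℝ V
    have h1 : ContMDiff 𝓘(ℝ, E) 𝓘(ℝ, V) ∞ (f j) :=
      hf.contMDiff (Submodule.subset_span ⟨j, rfl⟩)
    exact ContMDiff.clm_apply (B.toContinuousBilinearMap.contMDiff.comp contMDiff_snd)
      (h1.comp contMDiff_fst)

/-- The base part of a kernel vector, translated to 1, is annihilated by `𝒜` and so comes from 𝔥.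
The orbit direction with the same base part is also in the kernel; the difference is vertical, and
on vertical vectors the frame is injective. -/
theorem mem_range_mfderiv_orbit (h𝒜 : IsQuotientSpace ι 𝒜)
    (hann : annihilator E 𝒜 ≤ LinearMap.range A.toLinearMap)
    (hA : HasMFDerivAt 𝓘(ℝ, F) 𝓘(ℝ, E) ι 1 A)
    (hBτ : ∀ h x y, B (τ h x) (τ h y) = B x y)
    (hf : ∀ j, f j ∈ equivariantMaps ι τ)
    (hfinv : IsLeftInvariant (Submodule.span ℝ (Set.range f)))
    (hS : ∀ g v, ∑ j, B v (f j g) • S (f j g) = v) {g : G} {v : V}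
    (ho : MDifferentiableAt 𝓘(ℝ, F) (𝓘(ℝ, E).prod 𝓘(ℝ, V))
      (fun h => ((g * (ι h)⁻¹, τ h v) : G × V)) 1) (η : E × V)
    (hη : mfderiv (𝓘(ℝ, E).prod 𝓘(ℝ, V)) 𝓘(ℝ, Fin n ⊕ Fin m → ℝ) (frameMap b B f) (g, v) η = 0) :
    η ∈ Set.range (mfderiv 𝓘(ℝ, F) (𝓘(ℝ, E).prod 𝓘(ℝ, V))
      (fun h => ((g * (ι h)⁻¹, τ h v) : G × V)) 1) := by
  obtain ⟨ξ, w⟩ := η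
  let o : H → G × V := fun h => (g * (ι h)⁻¹, τ h v)
  obtain ⟨o', ho'⟩ : ∃ o' : F →L[ℝ] E × V, HasMFDerivAt 𝓘(ℝ, F) (𝓘(ℝ, E).prod 𝓘(ℝ, V)) o 1 o' :=
    ⟨_, ho.hasMFDerivAt⟩
  obtain ⟨Ψ', hΨ'⟩ : ∃ Ψ' : E × V →L[ℝ] (Fin n ⊕ Fin m → ℝ), HasMFDerivAt
      (𝓘(ℝ, E).prod 𝓘(ℝ, V)) 𝓘(ℝ, Fin n ⊕ Fin m → ℝ) (frameMap b B f) (g, v) Ψ' :=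
    ⟨_, ((contMDiff_frameMap h𝒜 hfinv).mdifferentiableAt (by simp)).hasMFDerivAt⟩
  have hη' : Ψ' (ξ, w) = 0 := by
    rw [hΨ'.mfderiv] at hη
    exact hη
  have ho1 : o 1 = (g, v) := by simp [o]
  have hΨo : ∀ φ, Ψ' (o' φ) = 0 := by
    intro φ
    have h1 := HasMFDerivAt.comp (1 : H) (ho1.symm ▸ hΨ') ho'
    have h2 : frameMap b B f ∘ o = fun _ => frameMap b B f (g, v) :=
      funext fun h => frameMap_act h𝒜 hBτ hf h g v
    rw [h2] at h1
    exact DFunLike.congr_fun (hasMFDerivAt_unique h1 (hasMFDerivAt_const _ _)) φ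
  have hfib : ∀ (u : V) (j : Fin m), Ψ' (0, u) (Sum.inr j) = B u (f j g) := by
    intro u j
    have h1 : HasMFDerivAt 𝓘(ℝ, V) (𝓘(ℝ, E).prod 𝓘(ℝ, V)) (fun x : V => (g, x)) v
        ((0 : V →L[ℝ] E).prod (.id ℝ V)) :=
      (hasMFDerivAt_const g v).prodMk (hasMFDerivAt_id (I := 𝓘(ℝ, V)) v)
    have h2 := HasMFDerivAt.comp v hΨ' h1
    have h3 := HasMFDerivAt.comp v ((ContinuousLinearMap.proj (R := ℝ)
      (φ := fun _ : Fin n ⊕ Fin m => ℝ) (Sum.inr j)).hasMFDerivAt) h2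
    have h4 : HasMFDerivAt 𝓘(ℝ, V) 𝓘(ℝ, ℝ) (B.flip (f j g)).toContinuousLinearMap v
        (B.flip (f j g)).toContinuousLinearMap := ContinuousLinearMap.hasMFDerivAt _
    exact DFunLike.congr_fun (hasMFDerivAt_unique h3 h4) u
  have hbase : ∀ i, (mfderiv 𝓘(ℝ, E) 𝓘(ℝ, ℝ) (b i : C(G, ℝ)) g : E →L[ℝ] ℝ) ξ = 0 := by
    intro i
    have h3 := HasMFDerivAt.comp (g, v) ((ContinuousLinearMap.proj (R := ℝ)
      (φ := fun _ : Fin n ⊕ Fin m => ℝ) (Sum.inl i)).hasMFDerivAt) hΨ'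
    have h4 := HasMFDerivAt.comp (g, v) (h𝒜.hasMFDerivAt (E := E) (b i).2 g)
      (hasMFDerivAt_fst (I := 𝓘(ℝ, E)) (I' := 𝓘(ℝ, V)) (x := (g, v)))
    exact (DFunLike.congr_fun (hasMFDerivAt_unique h4 h3) (ξ, w)).trans
      (congrFun hη' (Sum.inl i))
  let ξ₀ : E := (mfderiv 𝓘(ℝ, E) 𝓘(ℝ, E) (fun x : G => g⁻¹ * x) g : E →L[ℝ] E) ξ
  have hL : HasMFDerivAt 𝓘(ℝ, E) 𝓘(ℝ, E) (fun x : G => g⁻¹ * x) g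
      (mfderiv 𝓘(ℝ, E) 𝓘(ℝ, E) (fun x : G => g⁻¹ * x) g) :=
    ((contMDiff_mul_left (I := 𝓘(ℝ, E)) (n := ∞)).mdifferentiableAt (by simp)).hasMFDerivAt
  have hξ₀ : ξ₀ ∈ annihilator E 𝒜 := by
    refine mem_annihilator.2 fun a ha => ?_
    have h1 := mfderiv_apply_eq_zero_of_basis h𝒜 b hbase _ (h𝒜.inv g⁻¹ a ha)
    have h2 := HasMFDerivAt.comp (I' := 𝓘(ℝ, E)) (g := a) g
      (h𝒜.hasMFDerivAt (E := E) ha (g⁻¹ * g)) hL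
    rw [show (leftTranslate g⁻¹ a : G → ℝ) = a ∘ fun x => g⁻¹ * x from rfl, h2.mfderiv] at h1
    rw [inv_mul_cancel] at h1
    exact h1
  obtain ⟨φ₀, hφ₀⟩ := hann hξ₀
  -- The orbit moves `g` by the inverse of ι(h), so the differential of inversion corrects the sign.
  obtain ⟨i', hi'⟩ : ∃ i' : F →L[ℝ] F, HasMFDerivAt 𝓘(ℝ, F) 𝓘(ℝ, F) (fun h : H => h⁻¹) 1 i' :=
    ⟨_, ((contMDiff_inv 𝓘(ℝ, F) ∞).mdifferentiableAt (by simp)).hasMFDerivAt⟩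
  have hfst : (o' (i' φ₀)).1 = ξ := by
    have h1 := HasMFDerivAt.comp (1 : H) (hasMFDerivAt_fst (I := 𝓘(ℝ, E)) (I' := 𝓘(ℝ, V)) _)
      (HasMFDerivAt.comp (1 : H) (inv_one (G := H).symm ▸ ho') hi')
    have h2 : Prod.fst ∘ o ∘ (fun h : H => h⁻¹) = (fun x => g * x) ∘ ι := by
      funext h
      simp [o]
    rw [h2] at h1
    have h3 := HasMFDerivAt.comp (1 : H) (hasMFDerivAt_mul_left_of_one (g := g) (map_one ι)) hA
    have h4 : (o' (i' φ₀)).1 = _ := DFunLike.congr_fun (hasMFDerivAt_unique h1 h3) φ₀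
    rw [h4]
    have h5 := HasMFDerivAt.comp g
      (hasMFDerivAt_mul_left_of_one (E := E) (g := g) (inv_mul_cancel g)) hL
    have h6 : (fun x => g * x) ∘ (fun x => g⁻¹ * x) = (id : G → G) := by
      funext x
      simp
    rw [h6] at h5
    refine Eq.trans ?_ (DFunLike.congr_fun (hasMFDerivAt_unique h5 (hasMFDerivAt_id g)) ξ)
    exact congrArg (mfderiv 𝓘(ℝ, E) 𝓘(ℝ, E) (fun x : G => g * x) 1 : E →L[ℝ] E) hφ₀
  have hsnd : (o' (i' φ₀)).2 = w := by
    refine eq_of_forall_frame hS (g := g) fun j => ?_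
    rw [← hfib, ← hfib, ← sub_eq_zero]
    have h1 : Ψ' (0, (o' (i' φ₀)).2) - Ψ' (0, w) = 0 := by
      have h2 : ((0, (o' (i' φ₀)).2) : E × V) - (0, w) = o' (i' φ₀) - (ξ, w) := by
        refine Prod.ext ?_ rfl
        simp [hfst]
      rw [← map_sub, h2, map_sub, hΨo, hη', sub_zero]
    exact congrFun h1 (Sum.inr j)
  refine ⟨i' φ₀, ?_⟩
  rw [show mfderiv 𝓘(ℝ, F) (𝓘(ℝ, E).prod 𝓘(ℝ, V)) (fun h => ((g * (ι h)⁻¹, τ h v) : G × V)) 1 = o'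
    from ho'.mfderiv]
  exact Prod.ext hfst hsnd

end FrameMapSmooth

/-! ### The embedding of the model -/

namespace HamiltonianModel

theorem continuous_Ad {E : Type*} [NormedAddCommGroup E] [NormedSpace ℝ E]
    {G : Type*} [TopologicalSpace G] [ChartedSpace E G] [Group G] [LieGroup 𝓘(ℝ, E) ∞ G] :
    Continuous fun g : G => Ad E g := contMDiff_Ad.continuous

/-- The adjoint representation. -/
noncomputable def adHom (E : Type*) [NormedAddCommGroup E] [NormedSpace ℝ E] (G : Type*)
    [TopologicalSpace G] [ChartedSpace E G] [Group G] [LieGroup 𝓘(ℝ, E) ∞ G] :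
    G →* (E →L[ℝ] E) where
  toFun := Ad E
  map_one' := Ad_one
  map_mul' := Ad_mul

namespace LocalData

variable {E F X G H : Type*}
  [NormedAddCommGroup E] [NormedSpace ℝ E] [FiniteDimensional ℝ E]
  [NormedAddCommGroup F] [NormedSpace ℝ F] [FiniteDimensional ℝ F]
  [NormedAddCommGroup X] [NormedSpace ℝ X] [FiniteDimensional ℝ X]
  [TopologicalSpace G] [ChartedSpace E G] [Group G] [LieGroup 𝓘(ℝ, E) ∞ G]
  [TopologicalSpace H] [ChartedSpace F H] [Group H] [LieGroup 𝓘(ℝ, F) ∞ H]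
  (D : LocalData E F X G H)

/-- The action of `H` on `𝔨/𝔥 ⊕ X`. -/
noncomputable def fibreAction : H →* ((D.kPerp × X) →L[ℝ] (D.kPerp × X)) where
  toFun h := (((Ad E (D.ι h)).comp D.kPerp.subtypeL).codRestrict D.kPerp
    fun ν => D.Ad_mem_kPerp h ν.2).prodMap (D.ρ h)
  map_one' := by
    ext v
    · simp [Ad_one]
    · simp
    · simp [Ad_one]
    · simp
  map_mul' h k := by
    ext v
    · simp [Ad_mul]
      rfl
    · simp
    · simp
    · simp

theorem act_eq (h : H) (g : G) (v : D.kPerp × X) :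
    D.act h (g, v) = (g * (D.ι h)⁻¹, D.fibreAction h v) := rfl

theorem exists_projection_kPerp : ∃ π : E →L[ℝ] D.kPerp, ∀ ν : D.kPerp, π ν = ν := by
  obtain ⟨π, hπ⟩ := D.kPerp.subtype.exists_leftInverse_of_injective D.kPerp.ker_subtype
  exact ⟨π.toContinuousLinearMap, fun ν => DFunLike.congr_fun hπ ν⟩

/-- A linear projection to `kPerp` replaces the restriction of codomain by a composition, so that
continuity and smoothness in `h` can be read off. -/
theorem exists_fibreAction_eq : ∃ π : E →L[ℝ] D.kPerp, ∀ h, D.fibreAction h =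
    (π.comp ((Ad E (D.ι h)).comp D.kPerp.subtypeL)).prodMap (D.ρ h) := by
  obtain ⟨π, hπ⟩ := D.exists_projection_kPerp
  refine ⟨π, fun h => ?_⟩
  have : ((Ad E (D.ι h)).comp D.kPerp.subtypeL).codRestrict D.kPerp
      (fun ν => D.Ad_mem_kPerp h ν.2) = π.comp ((Ad E (D.ι h)).comp D.kPerp.subtypeL) :=
    ContinuousLinearMap.ext fun ν =>
      (hπ (((Ad E (D.ι h)).comp D.kPerp.subtypeL).codRestrict D.kPerp
        (fun ν => D.Ad_mem_kPerp h ν.2) ν)).symm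
  change ContinuousLinearMap.prodMap _ _ = _
  rw [this]

theorem continuous_fibreAction : Continuous D.fibreAction := by
  obtain ⟨π, hπ⟩ := D.exists_fibreAction_eq
  have h1 : Continuous fun h => Ad E (D.ι h) := continuous_Ad.comp D.ι_smooth.continuous
  have h2 : Continuous D.ρ := D.ρ_smooth.continuous
  have h3 : (D.fibreAction : H → _) = fun h =>
      (π.comp ((Ad E (D.ι h)).comp D.kPerp.subtypeL)).prodMap (D.ρ h) := funext hπ
  rw [h3]
  exact (ContinuousLinearMap.prodMapL ℝ D.kPerp D.kPerp X X).continuous.comp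
    (f := fun h => (π.comp ((Ad E (D.ι h)).comp D.kPerp.subtypeL), D.ρ h)) (by fun_prop)

theorem contMDiff_act (q : D.Total) :
    ContMDiff 𝓘(ℝ, F) D.totalModel ∞ (fun h => D.act h q) := by
  obtain ⟨g, v⟩ := q
  obtain ⟨π, hπ⟩ := D.exists_fibreAction_eq
  have h0 : (fun h => D.act h (g, v)) = fun h => (g * (D.ι h)⁻¹,
      (π (Ad E (D.ι h) v.1), D.ρ h v.2)) := by
    funext h
    rw [act_eq, hπ]
    rfl
  rw [h0]
  have h1 : ContMDiff 𝓘(ℝ, F) 𝓘(ℝ, E →L[ℝ] E) ∞ fun h => Ad E (D.ι h) :=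
    contMDiff_Ad.comp D.ι_smooth
  refine (contMDiff_const.mul D.ι_smooth.inv).prodMk
    (ContMDiff.prodMk_space (π.contMDiff.comp (h1.clm_apply contMDiff_const))
      (D.ρ_smooth.clm_apply contMDiff_const))

/-- The bilinear form with values in the Lie algebra of `H` whose quadratic form is `Q`. -/
noncomputable def Qbilin : X →ₗ[ℝ] X →ₗ[ℝ] F :=
  LinearMap.mk₂ ℝ (fun x y => (D.BH.toDual D.BH_nondegenerate).symm ((1 / 2 : ℝ) •
    ((D.ωX.flip y).comp ((ContinuousLinearMap.apply ℝ X x).toLinearMap.comp D.dρ.toLinearMap))))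
    (fun x x' y => by
      rw [← map_add]
      congr 1
      ext φ
      simp [mul_add])
    (fun c x y => by
      rw [← map_smul]
      congr 1
      ext φ
      change 1 / 2 * D.ωX (D.dρ φ (c • x)) y = c * (1 / 2 * D.ωX (D.dρ φ x) y)
      rw [map_smul, map_smul, LinearMap.smul_apply, smul_eq_mul]
      ring)
    (fun x y y' => by
      rw [← map_add]
      congr 1
      ext φ
      simp [mul_add])
    (fun c x y => by
      rw [← map_smul]
      congr 1
      ext φ
      change 1 / 2 * D.ωX (D.dρ φ x) (c • y) = c * (1 / 2 * D.ωX (D.dρ φ x) y)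
      rw [map_smul, smul_eq_mul]
      ring)

theorem BH_Qbilin (x y : X) (φ : F) : D.BH (D.Qbilin x y) φ = 1 / 2 * D.ωX (D.dρ φ x) y :=
  LinearMap.BilinForm.apply_toDual_symm_apply (hB := D.BH_nondegenerate) _ _

theorem Qbilin_self (x : X) : D.Qbilin x x = D.Q x := D.eq_Q fun φ => D.BH_Qbilin x x φ

theorem BH_left_injective {φ ψ : F} (h : ∀ χ, D.BH φ χ = D.BH ψ χ) : φ = ψ := by
  refine (D.BH.toDual D.BH_nondegenerate).injective ?_
  ext χ
  rw [LinearMap.BilinForm.toDual_def, LinearMap.BilinForm.toDual_def, h]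

theorem BH_Ad (h : H) (φ ψ : F) : D.BH (Ad F h φ) (Ad F h ψ) = D.BH φ ψ := by
  rw [BH_apply, BH_apply, dι_Ad, dι_Ad, D.B_Ad]

theorem Ad_Ad_inv (h : H) (φ : F) : Ad F h (Ad F h⁻¹ φ) = φ := by
  have := Ad_inv_apply (E := F) h⁻¹ φ
  rwa [inv_inv] at this

theorem Qbilin_ρ (h : H) (x y : X) :
    D.Qbilin (D.ρ h x) (D.ρ h y) = Ad F h (D.Qbilin x y) := by
  refine D.BH_left_injective fun φ => ?_
  rw [← Ad_Ad_inv h φ, BH_Ad, BH_Qbilin, BH_Qbilin, dρ_Ad, ρ_symplectic]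

theorem dι_injective : Function.Injective D.dι := D.ι_immersion

theorem Ad_eq_self {b : F} (hb : D.dι b = D.β) (h : H) : Ad F h b = b :=
  D.dι_injective (by rw [dι_Ad, hb, β_fixed])

theorem dρ_ρ {b : F} (hb : D.dι b = D.β) (h : H) (x : X) :
    D.dρ b (D.ρ h x) = D.ρ h (D.dρ b x) := by
  rw [← dρ_Ad, D.Ad_eq_self hb]

theorem mem_Z_iff {b : F} (hb : D.dι b = D.β) {x : X} :
    x ∈ D.Z ↔ D.dρ b x = 0 ∧ D.Q x = 0 := by
  refine ⟨?_, fun h => ⟨⟨b, hb, h.1⟩, h.2⟩⟩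
  rintro ⟨⟨b', hb', h1⟩, h2⟩
  rw [← D.dι_injective (hb'.trans hb.symm)]
  exact ⟨h1, h2⟩

theorem BH_pos {φ : F} (h : φ ≠ 0) : 0 < D.BH φ φ :=
  D.B_pos _ fun h0 => h (D.dι_injective (h0.trans (map_zero D.dι).symm))

/-- Used with `y` the frame coordinates of `v`: it makes T(v, v) a quadratic polynomial in them. -/
theorem sum_smul_apply_apply {V W : Type*} [AddCommGroup V] [Module ℝ V] [AddCommGroup W] [Module ℝ W]
    (T : V →ₗ[ℝ] V →ₗ[ℝ] W) {κ : Type*} [Fintype κ] {y : κ → ℝ} {s : κ → V} {v : V}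
    (hv : ∑ j, y j • s j = v) :
    ∑ r : κ × κ, (y r.1 * y r.2) • T (s r.1) (s r.2) = T v v := by
  rw [← hv, map_sum T, LinearMap.sum_apply, Fintype.sum_prod_type]
  refine Finset.sum_congr rfl fun j _ => ?_
  rw [map_smul T, LinearMap.smul_apply, map_sum, Finset.smul_sum]
  refine Finset.sum_congr rfl fun k _ => ?_
  rw [map_smul, smul_smul]

end LocalData

end HamiltonianModel

/-! ### Polynomial equations for the embedded set. -/

namespace HamiltonianModel.LocalData

variable {E F X G H : Type*}
  [NormedAddCommGroup E] [NormedSpace ℝ E] [FiniteDimensional ℝ E]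
  [NormedAddCommGroup F] [NormedSpace ℝ F] [FiniteDimensional ℝ F]
  [NormedAddCommGroup X] [NormedSpace ℝ X] [FiniteDimensional ℝ X]
  [TopologicalSpace G] [ChartedSpace E G] [Group G] [LieGroup 𝓘(ℝ, E) ∞ G]
  [T2Space G] [CompactSpace G]
  [TopologicalSpace H] [ChartedSpace F H] [Group H] [LieGroup 𝓘(ℝ, F) ∞ H] [CompactSpace H]
  (D : LocalData E F X G H)

open MvPolynomial in
/-- A closed smooth immersion of the model in some Euclidean space, such that the points outside
the image of a set are separated from it by polynomials, exhibits the set as a real algebraic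
variety. -/
theorem IsRealAlgebraicVariety.of_sum {n m : ℕ} {C : Set D.Model}
    {Φ : D.Model → (Fin n ⊕ Fin m → ℝ)} (hΦ : Topology.IsClosedEmbedding Φ)
    (hs : ContMDiff D.totalModel 𝓘(ℝ, Fin n ⊕ Fin m → ℝ) ∞ (fun q => Φ (D.proj q)))
    (hi : ∀ (q : D.Total) (v : E × (D.kPerp × X)),
      mfderiv D.totalModel 𝓘(ℝ, Fin n ⊕ Fin m → ℝ) (fun q' => Φ (D.proj q')) q v = 0 →
        v ∈ D.orbitTangent q)
    (hC : ∀ w, w ∉ Φ '' C → ∃ p, (∀ c ∈ C, eval (Φ c) p = 0) ∧ eval w p ≠ 0) :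
    D.IsRealAlgebraicVariety C := by
  let Λ : (Fin n ⊕ Fin m → ℝ) ≃L[ℝ] (Fin (n + m) → ℝ) :=
    (LinearEquiv.funCongrLeft ℝ ℝ finSumFinEquiv.symm).toContinuousLinearEquiv
  refine ⟨n + m, Λ ∘ Φ, Λ.toHomeomorph.isClosedEmbedding.comp hΦ,
    -- The ideal is that of all polynomials vanishing on the image; separation of outside points
    -- says that its zero set is no larger.
    Λ.contDiff.contMDiff.comp hs, fun q v hv => hi q v ?_, vanishingIdeal ℝ (Λ ∘ Φ '' C), ?_⟩
  · have h1 := HasMFDerivAt.comp q Λ.toContinuousLinearMap.hasMFDerivAt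
      ((hs.mdifferentiableAt (x := q) (by simp)).hasMFDerivAt)
    have h2 : mfderiv D.totalModel 𝓘(ℝ, Fin (n + m) → ℝ) (fun q' => (Λ ∘ Φ) (D.proj q')) q v =
        Λ (mfderiv D.totalModel 𝓘(ℝ, Fin n ⊕ Fin m → ℝ) (fun q' => Φ (D.proj q')) q v) :=
      congrArg (fun L : (E × (D.kPerp × X)) →L[ℝ] (Fin (n + m) → ℝ) => L v) h1.mfderiv
    exact Λ.map_eq_zero_iff.1 (h2.symm.trans hv)
  · refine Set.Subset.antisymm (fun x hx p hp => hp x hx) fun x hx => ?_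
    obtain ⟨w, rfl⟩ := Λ.surjective x
    rw [Set.image_comp]
    refine Set.mem_image_of_mem _ ?_
    by_contra hw
    obtain ⟨p, hp, hpw⟩ := hC w hw
    have hΛ : ∀ w, Λ w ∘ finSumFinEquiv = w := fun w => by
      funext s
      change w (finSumFinEquiv.symm (finSumFinEquiv s)) = w s
      rw [Equiv.symm_apply_apply]
    refine hpw ?_
    have h1 := hx (rename finSumFinEquiv p) (by
      rintro _ ⟨c, hc, rfl⟩
      rw [Function.comp_apply, aeval_rename, hΛ]
      exact hp c hc)
    rwa [aeval_rename, hΛ] at h1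

-- The embedding is the frame map for V = 𝔨/𝔥 ⊕ X. The space `𝒜` joins a separating space with the
-- spaces containing the coefficient functions `P`, `c`, `d` of the equations, all of which become
-- linear in the base coordinates.
open MvPolynomial in
theorem isRealAlgebraicVariety_assocZ {b₀ : F} (hb₀ : D.dι b₀ = D.β) :
    D.IsRealAlgebraicVariety D.assocZ := by
  have : IsTopologicalGroup G := topologicalGroup_of_lieGroup 𝓘(ℝ, E) ∞
  have : IsTopologicalGroup H := topologicalGroup_of_lieGroup 𝓘(ℝ, F) ∞
  have hι := D.ι_smooth.continuous
  have hτ := D.continuous_fibreAction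
  obtain ⟨B, hB, hBτ⟩ := exists_invariant_isInnerForm D.fibreAction hτ
  obtain ⟨m, f, S, hf, hfinv, hSτ, hS⟩ :=
    exists_equivariant_frame hι D.ι_injective hτ hB hBτ
  have hflf : ∀ j, f j ∈ leftFinite G (D.kPerp × X) := fun j =>
    ⟨_, FiniteDimensional.span_of_finite ℝ (Set.finite_range f), hfinv,
      Submodule.subset_span ⟨j, rfl⟩⟩
  -- The zero set of `L` encodes ν = 0 and β x = 0 together; it commutes with `H` because β is
  -- fixed.
  let L : D.kPerp × X →ₗ[ℝ] D.kPerp × X := LinearMap.id.prodMap (D.dρ b₀).toLinearMap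
  have hLτ : ∀ h v, L (D.fibreAction h v) = D.fibreAction h (L v) := fun h v =>
    Prod.ext rfl (D.dρ_ρ hb₀ h v.2)
  let q : D.kPerp × X →ₗ[ℝ] D.kPerp × X →ₗ[ℝ] F :=
    D.Qbilin.compl₁₂ (LinearMap.snd ℝ D.kPerp X) (LinearMap.snd ℝ D.kPerp X)
  have hqτ : ∀ h v w, q (D.fibreAction h v) (D.fibreAction h w) = adHom F H h (q v w) :=
    fun h v w => D.Qbilin_ρ h v.2 w.2
  let P : Fin m → Fin m → C(G, ℝ) := fun j k => ContinuousMap.bilin (B ∘ₗ S) (f k) (f j)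
  let c : Fin m × Fin m → C(G, ℝ) := fun r =>
    ContinuousMap.bilin (B.compl₁₂ (L ∘ₗ S) (L ∘ₗ S)) (f r.1) (f r.2)
  let s : Fin m × Fin m → C(G, F) := fun r =>
    ContinuousMap.bilin (q.compl₁₂ S S) (f r.1) (f r.2)
  -- The functions `s` are only Ad-equivariant; pairing them by the invariant form makes functions
  -- on the quotient.
  let d : (Fin m × Fin m) × (Fin m × Fin m) → C(G, ℝ) := fun r =>
    ContinuousMap.bilin D.BH (s r.1) (s r.2)
  have hs : ∀ r, s r ∈ equivariantMaps D.ι (adHom F H) := fun r =>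
    bilin_mem_equivariantMaps _ (fun h v w => by
      simp only [LinearMap.compl₁₂_apply, hSτ, hqτ]) (hf _) (hf _)
  obtain ⟨𝒜₁, h𝒜₁, hP𝒜⟩ := exists_isQuotientSpace_forall_mem (ι := D.ι)
    (fun r : Fin m × Fin m => P r.1 r.2) fun r =>
    ⟨bilin_mem_equivariantMaps _ (fun h v w => by
      simp only [LinearMap.comp_apply, hSτ, hBτ]
      rfl) (hf _) (hf _), bilin_mem_leftFinite _ (hflf _) (hflf _)⟩
  obtain ⟨𝒜₂, h𝒜₂, hc𝒜⟩ := exists_isQuotientSpace_forall_mem (ι := D.ι) c fun r =>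
    ⟨bilin_mem_equivariantMaps _ (fun h v w => by
      simp only [LinearMap.compl₁₂_apply, LinearMap.comp_apply, hSτ, hLτ, hBτ]
      rfl) (hf _) (hf _), bilin_mem_leftFinite _ (hflf _) (hflf _)⟩
  obtain ⟨𝒜₃, h𝒜₃, hd𝒜⟩ := exists_isQuotientSpace_forall_mem (ι := D.ι) d fun r =>
    ⟨bilin_mem_equivariantMaps _ (fun h v w => D.BH_Ad h v w) (hs _) (hs _),
      bilin_mem_leftFinite _ (bilin_mem_leftFinite _ (hflf _) (hflf _))
        (bilin_mem_leftFinite _ (hflf _) (hflf _))⟩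
  obtain ⟨𝒜₀, h𝒜₀, hann, hsep⟩ := exists_isQuotientSpace_separating D.ι_smooth D.ι_injective
    (D.hasMFDerivAt_ι 1 rfl) D.dι_injective
  let 𝒜 := 𝒜₀ ⊔ (𝒜₁ ⊔ (𝒜₂ ⊔ 𝒜₃))
  have h𝒜 : IsQuotientSpace D.ι 𝒜 := h𝒜₀.sup (h𝒜₁.sup (h𝒜₂.sup h𝒜₃))
  have hle₀ : 𝒜₀ ≤ 𝒜 := le_sup_left
  have hle₁ : 𝒜₁ ≤ 𝒜 := le_sup_left.trans le_sup_right
  have hle₂ : 𝒜₂ ≤ 𝒜 := (le_sup_left.trans le_sup_right).trans le_sup_right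
  have hle₃ : 𝒜₃ ≤ 𝒜 := (le_sup_right.trans le_sup_right).trans le_sup_right
  have := h𝒜.finite
  let b := Module.finBasis ℝ 𝒜
  choose ℓ hℓ using fun r => exists_linear_polynomial b (hle₂ (hc𝒜 r))
  choose ℓ' hℓ' using fun r => exists_linear_polynomial b (hle₃ (hd𝒜 r))
  -- On the image `R` takes the value |L v|² + |Q_x|²; both terms are nonnegative, so one equation
  -- suffices.
  let R : MvPolynomial (Fin (Module.finrank ℝ 𝒜) ⊕ Fin m) ℝ :=
    ∑ r : Fin m × Fin m, MvPolynomial.X (Sum.inr r.1) * MvPolynomial.X (Sum.inr r.2) * rename Sum.inl (ℓ r) +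
    ∑ r : (Fin m × Fin m) × (Fin m × Fin m), MvPolynomial.X (Sum.inr r.1.1) * MvPolynomial.X (Sum.inr r.1.2) *
      (MvPolynomial.X (Sum.inr r.2.1) * MvPolynomial.X (Sum.inr r.2.2)) * rename Sum.inl (ℓ' r)
  let C : Set (D.kPerp × X) := {v | v.1 = 0 ∧ v.2 ∈ D.Z}
  have hR : ∀ g v, eval (frameMap b B f (g, v)) R = 0 ↔ v ∈ C := by
    intro g v
    have h1 := sum_smul_apply_apply (B.compl₁₂ L L) (hS g v)
    have h2 := sum_smul_apply_apply q (hS g v)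
    have h3 := sum_smul_apply_apply D.BH h2
    have hev : eval (frameMap b B f (g, v)) R = B (L v) (L v) + D.BH (q v v) (q v v) := by
      simp only [R, map_add, map_sum, map_mul, eval_X, eval_rename, frameMap_inr]
      rw [← h3]
      refine congrArg₂ (· + ·) (Eq.trans ?_ h1) ?_
      · exact Finset.sum_congr rfl fun r _ => congrArg _ (hℓ r g)
      · exact Finset.sum_congr rfl fun r _ => congrArg _ (hℓ' r g)
    have hBH : 0 ≤ D.BH (q v v) (q v v) := by
      by_cases h0 : q v v = 0
      · rw [h0, map_zero]
      · exact (D.BH_pos h0).le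
    have hqv : q v v = D.Q v.2 := D.Qbilin_self v.2
    have hC : v ∈ C ↔ L v = 0 ∧ q v v = 0 := by
      rw [hqv, Prod.ext_iff, and_assoc]
      exact and_congr_right fun _ => D.mem_Z_iff hb₀
    rw [hev, hC]
    constructor
    · intro h
      refine ⟨hB.eq_zero ?_, ?_⟩
      · linarith [hB.nonneg (L v)]
      · by_contra h0
        linarith [hB.nonneg (L v), D.BH_pos h0]
    · rintro ⟨h1, h2⟩
      rw [h1, h2]
      simp
  let Φ : D.Model → (Fin (Module.finrank ℝ 𝒜) ⊕ Fin m → ℝ) :=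
    Quotient.lift (frameMap b B f) (by
      rintro ⟨g, v⟩ _ ⟨h, rfl⟩
      exact (frameMap_act h𝒜 hBτ hf h g v).symm)
  have hΦ : ∀ q, Φ (D.proj q) = frameMap b B f q := fun q => rfl
  have hproj : Function.Surjective D.proj := Quotient.mk_surjective
  have hsep' : ∀ g, (∀ a ∈ 𝒜, a g = a 1) → g ∈ D.ι.range := fun g hg =>
    hsep g fun a ha => hg a (hle₀ ha)
  have hann' : annihilator E 𝒜 ≤ LinearMap.range D.dι.toLinearMap := fun ξ hξ =>
    hann (mem_annihilator.2 fun a ha => mem_annihilator.1 hξ a (hle₀ ha))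
  refine IsRealAlgebraicVariety.of_sum D (Φ := Φ)
    (.of_continuous_injective_isClosedMap ?_ ?_ ?_) (contMDiff_frameMap h𝒜 hfinv) ?_ ?_
  · exact (continuous_frameMap b B f).quotient_lift _
  · intro x y hxy
    obtain ⟨⟨g, v⟩, rfl⟩ := hproj x
    obtain ⟨⟨g', v'⟩, rfl⟩ := hproj y
    exact Quotient.sound (exists_eq_of_frameMap_eq h𝒜 hBτ hf hsep' hS hxy)
  · intro K hK
    have h1 : Φ '' K = frameMap b B f '' (D.proj ⁻¹' K) := by
      rw [show frameMap b B f = Φ ∘ D.proj from rfl, Set.image_comp,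
        Set.image_preimage_eq K hproj]
    rw [h1]
    exact isClosedMap_frameMap hS _ (hK.preimage continuous_quotient_mk')
  · rintro ⟨g, v⟩ η hη
    exact mem_range_mfderiv_orbit h𝒜 hann' (D.hasMFDerivAt_ι 1 rfl) hBτ hf hfinv hS
      ((D.contMDiff_act (g, v)).mdifferentiableAt (by simp)) η hη
  · intro w hw
    obtain ⟨p, hp, hpw⟩ := exists_polynomial_separating_frameMap (C := C) h𝒜 hS
      (fun j k => hle₁ (hP𝒜 (j, k))) (fun _ _ _ => rfl) hR (w := w)
      fun g v hv h => hw ⟨D.proj (g, v), ⟨g, v.2, hv.2, by rw [← hv.1]⟩, h⟩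
    refine ⟨p, ?_, hpw⟩
    rintro _ ⟨g, z, hz, rfl⟩
    exact hp g (0, z) ⟨rfl, hz⟩

end HamiltonianModel.LocalData

/-! ### The critical set of the norm square of the moment map -/

namespace HamiltonianModel.LocalData

variable {E F X G H : Type*}
  [NormedAddCommGroup E] [NormedSpace ℝ E] [FiniteDimensional ℝ E]
  [NormedAddCommGroup F] [NormedSpace ℝ F] [FiniteDimensional ℝ F]
  [NormedAddCommGroup X] [NormedSpace ℝ X] [FiniteDimensional ℝ X]
  [TopologicalSpace G] [ChartedSpace E G] [Group G] [LieGroup 𝓘(ℝ, E) ∞ G]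
  [TopologicalSpace H] [ChartedSpace F H] [Group H] [LieGroup 𝓘(ℝ, F) ∞ H]
  (D : LocalData E F X G H)

/-- Nearby values of a local one-parameter curve commute, so conjugation by γ(t) fixes the curve
near 0, and Ad of γ(t) fixes its velocity β. -/
theorem β_mem_lieK [T2Space G] : D.β ∈ D.lieK := by
  have : CompleteSpace E := FiniteDimensional.complete ℝ E
  obtain ⟨γ, h0, hγ, ε, hε, hmul⟩ := exists_local_oneParameter_curve (G := G) D.β
  have hAd : ∀ t, |t| < ε → Ad E (γ t) D.β = D.β := by
    intro t ht
    have h1 := HasMFDerivAt.comp (0 : ℝ) (hasMFDerivAt_conj (E := E) (γ t) _ h0) hγ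
    have h2 : γ =ᶠ[𝓝 0] (fun x => γ t * x * (γ t)⁻¹) ∘ γ := by
      filter_upwards [Metric.ball_mem_nhds (0 : ℝ) hε] with s hs
      have hs' : |s| < ε := by simpa using hs
      rw [Function.comp_apply, ← hmul t s ht hs', add_comm, hmul s t hs' ht, mul_inv_cancel_right]
    have h3 := DFunLike.congr_fun (hasMFDerivAt_unique (h1.congr_of_eventuallyEq h2) hγ) (1 : ℝ)
    have h4 : Ad E (γ t) ((1 : ℝ) • D.β) = (1 : ℝ) • D.β := h3
    rwa [one_smul] at h4
  -- Membership in `K` is required at all times, so the curve is set to 1 where nothing is known.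
  have hev : (fun t => if |t| < ε then γ t else 1) =ᶠ[𝓝 0] γ := by
    filter_upwards [Metric.ball_mem_nhds (0 : ℝ) hε] with s hs
    rw [if_pos (by simpa using hs)]
  refine ⟨fun t => if |t| < ε then γ t else 1,
    (contMDiffAt_of_local_oneParameter h0 hγ hε hmul).congr_of_eventuallyEq hev, ?_, fun t => ?_,
    hγ.congr_of_eventuallyEq hev⟩
  · simp [h0]
  · dsimp only
    split_ifs with ht
    · exact hAd t ht
    · exact D.K.one_mem

theorem bilin_dρ (T : X →ₗ[ℝ] X →ₗ[ℝ] ℝ) (hT : ∀ h x y, T (D.ρ h x) (D.ρ h y) = T x y) (φ : F)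
    (x y : X) : T (D.dρ φ x) y + T x (D.dρ φ y) = 0 := by
  let T' := T.toContinuousBilinearMap
  have h1 : ∀ L : X →L[ℝ] X, HasFDerivAt (fun L : X →L[ℝ] X => T' (L x) (L y))
      (_ : (X →L[ℝ] X) →L[ℝ] ℝ) L := fun L =>
    (T'.hasFDerivAt.comp L (ContinuousLinearMap.apply ℝ X x).hasFDerivAt).clm_apply
      (ContinuousLinearMap.apply ℝ X y).hasFDerivAt
  have h2 := HasMFDerivAt.comp (1 : H) (h1 (D.ρ 1)).hasMFDerivAt (D.hasMFDerivAt_ρ 1 rfl)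
  have h3 : (fun L : X →L[ℝ] X => T' (L x) (L y)) ∘ D.ρ = fun _ => T x y :=
    funext fun h => hT h x y
  rw [h3] at h2
  have h4 := DFunLike.congr_fun (hasMFDerivAt_unique h2 (hasMFDerivAt_const _ _)) φ
  have h5 : T (D.ρ 1 x) (D.dρ φ y) + T (D.dρ φ x) (D.ρ 1 y) = 0 := h4
  rw [map_one] at h5
  rw [add_comm]
  exact h5

theorem dρ_comm {b : F} (hb : D.dι b = D.β) (φ : F) (x : X) :
    D.dρ b (D.dρ φ x) = D.dρ φ (D.dρ b x) := by
  have h1 := HasMFDerivAt.comp (1 : H)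
    ((D.dρ b).comp (ContinuousLinearMap.apply ℝ X x)).hasMFDerivAt (D.hasMFDerivAt_ρ 1 rfl)
  have h2 := HasMFDerivAt.comp (1 : H)
    (ContinuousLinearMap.apply ℝ X (D.dρ b x)).hasMFDerivAt (D.hasMFDerivAt_ρ 1 rfl)
  have h3 : (D.dρ b).comp (ContinuousLinearMap.apply ℝ X x) ∘ D.ρ =
      ContinuousLinearMap.apply ℝ X (D.dρ b x) ∘ D.ρ := funext fun h => D.dρ_ρ hb h x
  rw [h3] at h1
  exact DFunLike.congr_fun (hasMFDerivAt_unique h1 h2) φ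

/-- The value of the moment map at `[1, ν, x]`. -/
noncomputable def fibreMoment (v : D.kPerp × X) : E := D.β + (v.1 - D.dι (D.Q v.2))

/-- The function `|μ|²` in terms of the coordinates in `𝔨/𝔥 ⊕ X`. -/
noncomputable def fibreNormSq (v : D.kPerp × X) : ℝ := D.B (D.fibreMoment v) (D.fibreMoment v)

theorem normSqMu_proj (q : D.Total) : D.normSqMu (D.proj q) = D.fibreNormSq q.2 :=
  D.B_Ad _ _ _

theorem hasFDerivAt_fibreNormSq (v : D.kPerp × X) :
    ∃ N : D.kPerp × X →L[ℝ] ℝ, HasFDerivAt D.fibreNormSq N v ∧ ∀ w, N w =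
      2 * D.B (D.fibreMoment v) (w.1 - D.dι (D.Qbilin v.2 w.2 + D.Qbilin w.2 v.2)) := by
  let q := D.Qbilin.toContinuousBilinearMap
  let B := D.B.toContinuousBilinearMap
  have hq : HasFDerivAt (fun v : D.kPerp × X => q v.2 v.2) (_ : D.kPerp × X →L[ℝ] F) v :=
    (q.hasFDerivAt.comp v hasFDerivAt_snd).clm_apply hasFDerivAt_snd
  have hu : HasFDerivAt (fun v : D.kPerp × X => D.β + ((v.1 : E) - D.dι (q v.2 v.2)))
      (_ : D.kPerp × X →L[ℝ] E) v :=
    ((D.kPerp.subtypeL.hasFDerivAt.comp v hasFDerivAt_fst).sub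
      (D.dι.hasFDerivAt.comp v hq)).const_add D.β
  have hu' : (fun v : D.kPerp × X => D.β + ((v.1 : E) - D.dι (q v.2 v.2))) = D.fibreMoment :=
    funext fun v => by
      change D.β + ((v.1 : E) - D.dι (D.Qbilin v.2 v.2)) = _
      rw [Qbilin_self]
      rfl
  rw [hu'] at hu
  have hn : HasFDerivAt D.fibreNormSq (_ : D.kPerp × X →L[ℝ] ℝ) v :=
    (B.hasFDerivAt.comp v hu).clm_apply hu
  refine ⟨_, hn, fun w => ?_⟩
  have h1 : ∀ a c : E, D.B a c + D.B c a = 2 * D.B a c := fun a c => by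
    rw [D.B_symm c a]
    ring
  exact h1 (D.fibreMoment v) (w.1 - D.dι (D.Qbilin v.2 w.2 + D.Qbilin w.2 v.2))

theorem hasMFDerivAt_normSqMu_iff (q : D.Total) :
    HasMFDerivAt D.totalModel 𝓘(ℝ, ℝ) (fun q' => D.normSqMu (D.proj q')) q 0 ↔
      ∀ w : D.kPerp × X, D.B (D.fibreMoment q.2)
        (w.1 - D.dι (D.Qbilin q.2.2 w.2 + D.Qbilin w.2 q.2.2)) = 0 := by
  obtain ⟨g, v⟩ := q
  obtain ⟨N, hN, hNw⟩ := D.hasFDerivAt_fibreNormSq v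
  have hfun : (fun q' => D.normSqMu (D.proj q')) = fun q' : G × (D.kPerp × X) =>
    D.fibreNormSq q'.2 := funext D.normSqMu_proj
  have hcomp : HasMFDerivAt D.totalModel 𝓘(ℝ, ℝ) (fun q' => D.normSqMu (D.proj q')) (g, v)
      (N.comp (ContinuousLinearMap.snd ℝ E (D.kPerp × X))) := by
    rw [hfun]
    exact HasMFDerivAt.comp (g, v) (g := D.fibreNormSq) hN.hasMFDerivAt (hasMFDerivAt_snd _)
  constructor
  · intro h w
    have h1 := DFunLike.congr_fun (hasMFDerivAt_unique hcomp h) ((0, w) : E × (D.kPerp × X))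
    have h2 : N w = 0 := h1
    rw [hNw] at h2
    linarith
  · intro h
    have h1 : N.comp (ContinuousLinearMap.snd ℝ E (D.kPerp × X)) = 0 := by
      refine ContinuousLinearMap.ext fun w => ?_
      change N w.2 = 0
      rw [hNw, h, mul_zero]
    exact h1 ▸ hcomp

/-- Derivatives in ν at `base` give β ⊥ 𝔨/𝔥. With `b` the orthogonal projection of β to 𝔥, the
difference β - b lies in 𝔨/𝔥 and is orthogonal to itself. -/
theorem exists_dι_eq_β [T2Space G] (hcrit : D.base ∈ D.criticalSet) : ∃ b, D.dι b = D.β := by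
  have h1 := (D.hasMFDerivAt_normSqMu_iff (1, 0, 0)).1 (hcrit _ rfl)
  have hβ : ∀ ν : D.kPerp, D.B D.β ν = 0 := by
    intro ν
    have h2 := h1 (ν, 0)
    have h3 : D.fibreMoment (0, 0) = D.β := by
      simp [fibreMoment, ← Qbilin_self]
    simpa [h3] using h2
  let b := (D.BH.toDual D.BH_nondegenerate).symm ((D.B D.β).comp D.dι.toLinearMap)
  have hb : ∀ φ, D.B (D.dι b) (D.dι φ) = D.B D.β (D.dι φ) := fun φ =>
    LinearMap.BilinForm.apply_toDual_symm_apply (hB := D.BH_nondegenerate) _ φ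
  have hmem : D.β - D.dι b ∈ D.kPerp :=
    ⟨D.lieK.sub_mem D.β_mem_lieK (D.dι_mem_lieK b), fun φ => by
      rw [map_sub, LinearMap.sub_apply, hb, sub_self]⟩
  refine ⟨b, ?_⟩
  by_contra hne
  have h2 := D.B_pos _ (sub_ne_zero.2 (Ne.symm hne))
  have h3 : D.B (D.β - D.dι b) (D.β - D.dι b) = 0 := by
    have h4 := hβ ⟨_, hmem⟩
    have h5 := hmem.2 b
    rw [D.B_symm] at h5
    rw [LinearMap.map_sub₂, h5, sub_zero]
    exact h4
  exact h2.ne' h3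

/-! ### Critical points when β lies in 𝔥. -/

variable {b : F}

/-- The moment is the orthogonal sum of ν and b - Q_x, so the conditions in ν and x separate. In the
x-condition both halves of the polarization of Q contribute equally, by skewness of the action for
ω; the sum is ω((b - Q_x) x, ·), and nondegeneracy applies. -/
theorem isCritical_iff (hb : D.dι b = D.β) (q : D.Total) :
    HasMFDerivAt D.totalModel 𝓘(ℝ, ℝ) (fun q' => D.normSqMu (D.proj q')) q 0 ↔
      q.2.1 = 0 ∧ D.dρ b q.2.2 = D.dρ (D.Q q.2.2) q.2.2 := by
  rw [hasMFDerivAt_normSqMu_iff]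
  obtain ⟨g, ν, x⟩ := q
  have key : ∀ w : D.kPerp × X, D.B (D.fibreMoment (ν, x))
      (w.1 - D.dι (D.Qbilin x w.2 + D.Qbilin w.2 x)) =
      D.B ν w.1 - D.ωX (D.dρ b x - D.dρ (D.Q x) x) w.2 := by
    intro w
    have h1 : ∀ φ : F, D.B (D.dι φ) w.1 = 0 := fun φ => by
      rw [D.B_symm]
      exact w.1.2.2 φ
    have h2 : D.BH (b - D.Q x) (D.Qbilin x w.2 + D.Qbilin w.2 x) =
        D.ωX (D.dρ b x - D.dρ (D.Q x) x) w.2 := by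
      have hsymm : ∀ φ ψ, D.BH φ ψ = D.BH ψ φ := fun φ ψ => D.B_symm _ _
      have hω := D.bilin_dρ D.ωX D.ρ_symplectic (b - D.Q x) x w.2
      have halt : ∀ y z, D.ωX y z = -D.ωX z y := by
        intro y z
        have := D.ωX_alt (y + z)
        simp only [map_add, LinearMap.add_apply, D.ωX_alt] at this
        linarith
      rw [hsymm, map_add, LinearMap.add_apply, BH_Qbilin, BH_Qbilin,
        halt (D.dρ (b - D.Q x) w.2) x, ← sub_apply, ← map_sub]
      linarith
    have h3 : D.fibreMoment (ν, x) = (ν : E) + D.dι (b - D.Q x) := by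
      rw [fibreMoment, map_sub, hb]
      abel
    rw [h3, map_add, LinearMap.add_apply, map_sub, map_sub, ν.2.2, h1, ← BH_apply, h2]
    ring
  simp only [key]
  constructor
  · intro h
    refine ⟨?_, ?_⟩
    · by_contra hne
      have h1 := h (ν, 0)
      have h2 := D.B_pos (ν : E) fun h0 => hne (Subtype.ext h0)
      rw [map_zero, sub_zero] at h1
      exact h2.ne' h1
    · refine sub_eq_zero.1 (D.ωX_nondeg _ fun y => ?_)
      have h1 := h (0, y)
      dsimp only at h1
      rwa [Submodule.coe_zero, map_zero, zero_sub, neg_eq_zero] at h1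
  · rintro ⟨rfl, h⟩ w
    rw [h, sub_self]
    simp

/-- The critical points near the zero level of `Q` lie in it. -/
theorem exists_mem_Z_of_norm_Q_lt [CompactSpace H] (hb : D.dι b = D.β) : ∃ δ > 0, ∀ x : X,
    D.dρ b x = D.dρ (D.Q x) x → ‖D.Q x‖ < δ → x ∈ D.Z := by
  have : IsTopologicalGroup H := topologicalGroup_of_lieGroup 𝓘(ℝ, F) ∞
  obtain ⟨B, hB, hBρ⟩ := exists_invariant_isInnerForm D.ρ D.ρ_smooth.continuous
  let A := D.dρ b
  -- Skewness gives B(A x, A x) = -B(x, A² x). Hence `A` is injective on its range, and bounded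
  -- below there.
  have hker : ∀ x, A (A x) = 0 → A x = 0 := by
    intro x hx
    refine hB.eq_zero ?_
    have h1 := D.bilin_dρ B hBρ b x (A x)
    rw [show D.dρ b (A x) = 0 from hx, map_zero, add_zero] at h1
    exact h1
  let R := LinearMap.range A.toLinearMap
  let A' : R →ₗ[ℝ] X := A.toLinearMap.domRestrict R
  have hA' : LinearMap.ker A' = ⊥ := by
    refine LinearMap.ker_eq_bot'.2 fun y hy => ?_
    obtain ⟨_, x, rfl⟩ := y
    exact Subtype.ext (hker x hy)
  obtain ⟨C, hC0, hC⟩ := A'.exists_antilipschitzWith hA'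
  have hlow : ∀ x, ‖A x‖ ≤ C * ‖A (A x)‖ := by
    intro x
    have := hC.le_mul_dist ⟨A x, x, rfl⟩ 0
    rw [dist_zero_right, map_zero, dist_zero_right] at this
    exact this
  have hC0' : (0 : ℝ) < C := hC0
  -- Chosen so that C ‖dρ‖ ‖Q_x‖ < 1; the added 1 covers a trivial action.
  refine ⟨1 / (C * (‖D.dρ‖ + 1)), by positivity, fun x hx hQ => ?_⟩
  have hcomm : A (A x) = D.dρ (D.Q x) (A x) := by
    conv_lhs => rw [show A x = D.dρ (D.Q x) x from hx]
    exact D.dρ_comm hb _ _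
  have hAx : A x = 0 := by
    by_contra hne
    have hpos := norm_pos_iff.2 hne
    have h1 : ‖A (A x)‖ ≤ ‖D.dρ‖ * ‖D.Q x‖ * ‖A x‖ := by
      rw [hcomm]
      exact (D.dρ (D.Q x)).le_of_opNorm_le (D.dρ.le_opNorm _) _
    rw [lt_div_iff₀ (by positivity)] at hQ
    have h2 : ‖A x‖ ≤ C * (‖D.dρ‖ * ‖D.Q x‖ * ‖A x‖) :=
      (hlow x).trans (mul_le_mul_of_nonneg_left h1 hC0'.le)
    have h3 : C * (‖D.dρ‖ * ‖D.Q x‖) < 1 := by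
      refine lt_of_le_of_lt ?_ hQ
      nlinarith [mul_nonneg hC0'.le (norm_nonneg (D.Q x))]
    nlinarith
  refine (D.mem_Z_iff hb).2 ⟨hAx, ?_⟩
  by_contra hne
  -- |Q_x|² = ½ ω(Q_x x, x) = ½ ω(b x, x) = 0.
  have h1 := D.BH_pos hne
  rw [BH_Q, ← hx, show D.dρ b x = 0 from hAx, map_zero, LinearMap.zero_apply, mul_zero] at h1
  exact lt_irrefl _ h1

/-! ### Topology of `Z` and of `assocZ`. -/

theorem continuous_Q : Continuous D.Q := by
  have h1 : Continuous fun x => D.Qbilin.toContinuousBilinearMap x x := by fun_prop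
  have h2 : D.Q = fun x => D.Qbilin.toContinuousBilinearMap x x :=
    funext fun x => (D.Qbilin_self x).symm
  rw [h2]
  exact h1

theorem ρ_mem_Z (hb : D.dι b = D.β) (h : H) {x : X} (hx : x ∈ D.Z) : D.ρ h x ∈ D.Z := by
  rw [D.mem_Z_iff hb] at hx ⊢
  rw [D.dρ_ρ hb, hx.1, Q_ρ, hx.2, map_zero, map_zero]
  exact ⟨rfl, rfl⟩

theorem smul_mem_Z (hb : D.dι b = D.β) (t : ℝ) {x : X} (hx : x ∈ D.Z) : t • x ∈ D.Z := by
  rw [D.mem_Z_iff hb] at hx ⊢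
  rw [map_smul, hx.1, smul_zero, ← Qbilin_self, map_smul, map_smul, LinearMap.smul_apply,
    Qbilin_self, hx.2, smul_zero, smul_zero]
  exact ⟨rfl, rfl⟩

theorem zero_mem_Z (hb : D.dι b = D.β) : (0 : X) ∈ D.Z := by
  rw [D.mem_Z_iff hb, map_zero, ← Qbilin_self, map_zero]
  exact ⟨rfl, rfl⟩

theorem isClosed_Z (hb : D.dι b = D.β) : IsClosed D.Z := by
  have : D.Z = {x | D.dρ b x = 0} ∩ {x | D.Q x = 0} := Set.ext fun x => D.mem_Z_iff hb
  rw [this]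
  exact (isClosed_eq (D.dρ b).continuous continuous_const).inter
    (isClosed_eq D.continuous_Q continuous_const)

theorem proj_mem_assocZ_iff (hb : D.dι b = D.β) (q : D.Total) :
    D.proj q ∈ D.assocZ ↔ q.2.1 = 0 ∧ q.2.2 ∈ D.Z := by
  constructor
  · rintro ⟨g, z, hz, h⟩
    obtain ⟨k, rfl⟩ := Quotient.exact h
    exact ⟨Subtype.ext (map_zero (Ad E (D.ι k))), D.ρ_mem_Z hb k hz⟩
  · obtain ⟨g, ν, x⟩ := q
    rintro ⟨rfl, hx⟩
    exact ⟨g, x, hx, rfl⟩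

theorem continuous_proj : Continuous D.proj := continuous_quotient_mk'

theorem isClosed_assocZ (hb : D.dι b = D.β) : IsClosed D.assocZ := by
  have h1 : IsClosed (D.proj ⁻¹' D.assocZ) := by
    have : D.proj ⁻¹' D.assocZ = {q | q.2.1 = 0} ∩ {q | q.2.2 ∈ D.Z} :=
      Set.ext fun q => D.proj_mem_assocZ_iff hb q
    rw [this]
    exact (isClosed_eq (by fun_prop) continuous_const).inter
      ((D.isClosed_Z hb).preimage (by fun_prop))
  exact isQuotientMap_quotient_mk'.isClosed_preimage.1 h1

theorem assocZ_subset_criticalSet (hb : D.dι b = D.β) : D.assocZ ⊆ D.criticalSet := by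
  rintro m hm q rfl
  obtain ⟨h1, h2⟩ := (D.proj_mem_assocZ_iff hb q).1 hm
  obtain ⟨h3, h4⟩ := (D.mem_Z_iff hb).1 h2
  refine (D.isCritical_iff hb q).2 ⟨h1, ?_⟩
  rw [h3, h4, map_zero, zero_apply]

/-- The norm on 𝔥 need not be invariant, so the condition ‖Q_x‖ < δ does not descend to the model.
The image of the set it defines serves instead: it is open because its preimage is the union of the
translates by `H`. -/
theorem exists_isOpen_inter_criticalSet_subset [CompactSpace H] (hb : D.dι b = D.β) :
    ∃ U : Set D.Model, IsOpen U ∧ D.base ∈ U ∧ D.assocZ ⊆ U ∧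
      D.criticalSet ∩ U ⊆ D.assocZ := by
  obtain ⟨δ, hδ, h⟩ := D.exists_mem_Z_of_norm_Q_lt hb
  have hsub : D.assocZ ⊆ D.proj '' {q | ‖D.Q q.2.2‖ < δ} := by
    rintro _ ⟨g, z, hz, rfl⟩
    refine ⟨(g, 0, z), ?_, rfl⟩
    change ‖D.Q z‖ < δ
    rwa [((D.mem_Z_iff hb).1 hz).2, norm_zero]
  refine ⟨D.proj '' {q | ‖D.Q q.2.2‖ < δ}, ?_, hsub ⟨1, 0, D.zero_mem_Z hb, rfl⟩, hsub, ?_⟩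
  · have h1 : D.proj ⁻¹' (D.proj '' {q | ‖D.Q q.2.2‖ < δ}) =
        ⋃ k : H, {q | ‖D.Q (D.ρ k q.2.2)‖ < δ} := by
      ext q
      simp only [Set.mem_preimage, Set.mem_image, Set.mem_iUnion]
      constructor
      · rintro ⟨q', hq', h⟩
        obtain ⟨k, rfl⟩ := Quotient.exact h.symm
        exact ⟨k, hq'⟩
      · rintro ⟨k, hk⟩
        exact ⟨D.act k q, hk, (Quotient.sound ⟨k, rfl⟩ : D.proj q = D.proj (D.act k q)).symm⟩
    refine isQuotientMap_quotient_mk'.isOpen_preimage.1 ?_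
    change IsOpen (D.proj ⁻¹' _)
    rw [h1]
    refine isOpen_iUnion fun k => isOpen_lt ?_ continuous_const
    exact (D.continuous_Q.comp ((D.ρ k).continuous.comp (by fun_prop))).norm
  · rintro _ ⟨hm, q, hq, rfl⟩
    obtain ⟨h1, h2⟩ := (D.isCritical_iff hb q).1 (hm q rfl)
    exact (D.proj_mem_assocZ_iff hb q).2 ⟨h1, h _ h2 hq⟩

/-- `Z` is a cone, so each point is joined by a line to the zero section, the continuous image of
G/H. -/
theorem isPreconnected_assocZ (hconn : ConnectedSpace (G ⧸ D.ι.range)) (hb : D.dι b = D.β) :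
    IsPreconnected D.assocZ := by
  let κ : G ⧸ D.ι.range → D.Model := Quotient.lift (fun g => D.proj (g, 0, 0)) (by
    intro g g' h
    obtain ⟨k, hk⟩ := QuotientGroup.leftRel_apply.1 h
    refine Quotient.sound ⟨k⁻¹, Prod.ext ?_ (Prod.ext ?_ (map_zero _))⟩
    · change g * (D.ι k⁻¹)⁻¹ = g'
      rw [map_inv, inv_inv, hk, mul_inv_cancel_left]
    · exact Subtype.ext (map_zero (Ad E _)))
  have hκ : Continuous κ := Continuous.quotient_lift (D.continuous_proj.comp (by fun_prop)) _
  have hκs : Set.range κ ⊆ D.assocZ := by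
    rintro _ ⟨g, rfl⟩
    induction g using QuotientGroup.induction_on with
    | H g => exact ⟨g, 0, D.zero_mem_Z hb, rfl⟩
  refine isPreconnected_of_forall D.base ?_
  rintro _ ⟨g, z, hz, rfl⟩
  let c : ℝ → D.Model := fun t => D.proj (g, 0, t • z)
  have hc : Continuous c := D.continuous_proj.comp (by fun_prop)
  refine ⟨Set.range κ ∪ Set.range c, Set.union_subset hκs ?_, Or.inl ⟨(1 : G), rfl⟩,
    Or.inr ⟨1, by simp [c]⟩,
    IsPreconnected.union (D.proj (g, 0, 0)) ⟨g, rfl⟩ ⟨0, by simp [c]⟩ (isPreconnected_range hκ)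
      (isPreconnected_range hc)⟩
  rintro _ ⟨t, rfl⟩
  exact ⟨g, _, D.smul_mem_Z hb t hz, rfl⟩

/-- A component strictly larger than `assocZ` would be split by the open set `U` and the complement
of the closed set `assocZ`, which do not meet within the critical set. -/
theorem connectedComponentIn_criticalSet [CompactSpace H]
    (hconn : ConnectedSpace (G ⧸ D.ι.range)) (hb : D.dι b = D.β) :
    connectedComponentIn D.criticalSet D.base = D.assocZ := by
  obtain ⟨U, hU, hbase, hsub, hcrit⟩ := D.exists_isOpen_inter_criticalSet_subset hb
  have hmem : D.base ∈ D.assocZ := ⟨1, 0, D.zero_mem_Z hb, rfl⟩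
  have hsubc := D.assocZ_subset_criticalSet hb
  refine Set.Subset.antisymm (fun y hy => ?_)
    ((D.isPreconnected_assocZ hconn hb).subset_connectedComponentIn hmem hsubc)
  by_contra hne
  obtain ⟨z, hz, hzU, hzZ⟩ := isPreconnected_connectedComponentIn U D.assocZᶜ hU
    (D.isClosed_assocZ hb).isOpen_compl
    (fun x _ => (em (x ∈ D.assocZ)).imp (fun h => hsub h) id)
    ⟨D.base, mem_connectedComponentIn (hsubc hmem), hbase⟩ ⟨y, hy, hne⟩
  exact hzZ (hcrit ⟨connectedComponentIn_subset _ _ hz, hzU⟩)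

end HamiltonianModel.LocalData

theorem mainTheorem6 {E F X G H : Type*}
    [NormedAddCommGroup E] [NormedSpace ℝ E] [FiniteDimensional ℝ E]
    [NormedAddCommGroup F] [NormedSpace ℝ F] [FiniteDimensional ℝ F]
    [NormedAddCommGroup X] [NormedSpace ℝ X] [FiniteDimensional ℝ X]
    [TopologicalSpace G] [ChartedSpace E G] [Group G] [LieGroup 𝓘(ℝ, E) ∞ G]
    [T2Space G] [CompactSpace G]
    [TopologicalSpace H] [ChartedSpace F H] [Group H] [LieGroup 𝓘(ℝ, F) ∞ H]
    [T2Space H] [CompactSpace H]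
    (D : HamiltonianModel.LocalData E F X G H)
    (hconn : ConnectedSpace (G ⧸ D.ι.range))
    (hcrit : D.base ∈ D.criticalSet) :
    connectedComponentIn D.criticalSet D.base = D.assocZ ∧
      D.IsRealAlgebraicVariety D.assocZ := by
  obtain ⟨b, hb⟩ := D.exists_dι_eq_β hcrit
  exact ⟨D.connectedComponentIn_criticalSet hconn hb, D.isRealAlgebraicVariety_assocZ hb⟩
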